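/- Let $\mathbb{T}^2=\mathbb{R}^2/2\pi\mathbb{Z}^2$ with Lebesgue measure $\mathrm{mes}$ (total mass $4\pi^2$), and write $\langle f\rangle=\frac{1}{4\pi^2}\int_{\mathbb{T}^2}f(x,y)\,dx\,dy$. Let $A:\mathbb{T}^2\to\mathbb{T}^2$ be a hyperbolic toral automorphism, i.e. the map induced by an integer $2\times2$ matrix with determinant $\pm1$ and no eigenvalue of modulus $1$. Let $\alpha\in C^1(\mathbb{T}^2,\mathbb{D})$, $\mathbb{D}=\{w\in\mathbb{C}:|w|<1\}$, satisfy $\langle\alpha\rangle=0$. For $n\ge 0$ put $F_n=\alpha\circ A^n$, and for $n<0$ put $\langle\bar F_0F_n\rangle:=\langle\bar F_{-n}F_0\rangle$. For $\lambda\in(0,1)$ and $(x,y)\in\mathbb{T}^2$ let $\alpha_n=\alpha_n(x,y)=\lambda\,\alpha(A^n(x,y))$, $n\ge0$, be the Verblunsky coefficients (of the associated CMV matrix) and $\rho_n=\sqrt{1-|\alpha_n|^2}$. Let $\varphi_n$ be the corresponding orthonormal polynomials on the unit circle, given by $\varphi_0=1$ and $\rho_n\varphi_{n+1}(z)=z\varphi_n(z)-\overline{\alpha_n}\,\varphi_n^*(z)$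 with $\varphi_n^*(z)=z^n\overline{\varphi_n(1/\bar z)}$, and let $\psi_n$ be the second kind polynomials, i.e. the orthonormal polynomials with Verblunsky coefficients $-\alpha_n$. Put $$L_N(z)=L_N(z;x,y)=\frac{1}{2N}\log\left(|\varphi_N(z)|^2+|\psi_N(z)|^2\right),\qquad L(z)=\lim_{N\to\infty}L_N(z)\ \text{ for a.e. }(x,y)\in\mathbb{T}^2 .$$ Fix $z=e^{i\eta}$ with $\eta\in\mathbb{R}$ and $z\ne\pm1$. Then the series $$\mathcal{J}(\eta)=\sum_{n=-\infty}^{\infty}e^{in\eta}\langle\bar F_0F_n\rangle$$ converges absolutely, and there are $\lambda_0\in(0,1)$ and $C>0$ (depending on $A$, $\alpha$ and $z$) such that for every $\lambda\in(0,\lambda_0)$ the following hold. (i) The Lyapunov exponent $L(z)$ exists, as a number that is the same for almost every $(x,y)$, and $$\left|L(z)-\frac{\lambda^2}{2}\mathcal{J}(\eta)\right|\le C\lambda^3 .$$ (ii) There are $C_\lambda>0$ and $N_0$ such that for all integers $N\ge N_0$ $$\mathrm{mes}\left[(x,y)\in\mathbb{T}^2:\left|L_N(z)-\frac{\lambda^2}{2}\mathcal{J}(\eta)\right|>\lambda^3\right]<\exp(-C_\lambda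 N).$$ -/

import Mathlib

open MeasureTheory Filter Topology

noncomputable section

instance factZeroLtTwoPi : Fact (0 < 2 * Real.pi) := ⟨Real.two_pi_pos⟩

/-- The torus `ℝ² / 2πℤ²`; its `volume` is Lebesgue measure, of total mass `4π²`. -/
abbrev Torus2 : Type := Fin 2 → AddCircle (2 * Real.pi)

/-- The toral endomorphism induced by an integer matrix. -/
def toralMap (A : Matrix (Fin 2) (Fin 2) ℤ) (p : Torus2) : Torus2 :=
  fun i => ∑ j, A i j • p j

/-- `A` induces a hyperbolic toral automorphism: it is invertible over `ℤ` and has no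
eigenvalue of modulus one. -/
def IsHyperbolicToral (A : Matrix (Fin 2) (Fin 2) ℤ) : Prop :=
  IsUnit A.det ∧ ∀ μ ∈ spectrum ℂ (A.map (Int.cast : ℤ → ℂ)), ‖μ‖ ≠ 1

/-- A function on the torus is `C¹` if its `2π`-periodic lift to the plane is. -/
def IsC1OnTorus (f : Torus2 → ℂ) : Prop :=
  ContDiff ℝ 1 (fun v : Fin 2 → ℝ => f (fun i => (v i : AddCircle (2 * Real.pi))))

/-- The mean value `⟨f⟩ = (1 / 4π²) ∫ f`. -/
def torusMean (f : Torus2 → ℂ) : ℂ :=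
  (1 / (4 * (Real.pi : ℂ) ^ 2)) * ∫ p, f p

/-- `F_n = α ∘ Aⁿ` for `n ≥ 0`. -/
def sampled (A : Matrix (Fin 2) (Fin 2) ℤ) (α : Torus2 → ℂ) (n : ℕ) (p : Torus2) : ℂ :=
  α ((toralMap A)^[n] p)

/-- `⟨F̄₀ F_n⟩`, which for negative `n` means `⟨F̄_{-n} F₀⟩`. -/
def correlation (A : Matrix (Fin 2) (Fin 2) ℤ) (α : Torus2 → ℂ) (n : ℤ) : ℂ :=
  if 0 ≤ n then
    torusMean (fun p => starRingEnd ℂ (sampled A α 0 p) * sampled A α n.toNat p)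
  else
    torusMean (fun p => starRingEnd ℂ (sampled A α (-n).toNat p) * sampled A α 0 p)

/-- The `n`-th term `e^{inη} ⟨F̄₀ F_n⟩` of the series defining `𝒥(η)`. -/
def spectralTerm (A : Matrix (Fin 2) (Fin 2) ℤ) (α : Torus2 → ℂ) (η : ℝ) (n : ℤ) : ℂ :=
  Complex.exp (Complex.I * (n : ℂ) * (η : ℂ)) * correlation A α n

/-- `𝒥(η) = ∑_{n ∈ ℤ} e^{inη} ⟨F̄₀ F_n⟩`. -/
def spectralJ (A : Matrix (Fin 2) (Fin 2) ℤ) (α : Torus2 → ℂ) (η : ℝ) : ℂ :=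
  ∑' n : ℤ, spectralTerm A α η n

/-- The Szegő dual `P*(z) = zⁿ conj (P (1 / conj z))` of a polynomial of degree at most `n`. -/
def szegoDual (n : ℕ) (P : Polynomial ℂ) : Polynomial ℂ :=
  (P.map (starRingEnd ℂ)).reflect n

/-- The orthonormal polynomials on the unit circle with Verblunsky coefficients `a`:
`φ₀ = 1` and `ρ_n φ_{n+1} = z φ_n - conj (a_n) φ_n*`, where `ρ_n = √(1 - |a_n|²)`. -/
def orthoPoly (a : ℕ → ℂ) : ℕ → Polynomial ℂ
  | 0 => 1
  | n + 1 =>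
      Polynomial.C (((Real.sqrt (1 - ‖a n‖ ^ 2))⁻¹ : ℝ) : ℂ) *
        (Polynomial.X * orthoPoly a n -
          Polynomial.C (starRingEnd ℂ (a n)) * szegoDual n (orthoPoly a n))

/-- The second kind polynomials: the orthonormal polynomials with Verblunsky coefficients `-a`. -/
def secondKindPoly (a : ℕ → ℂ) (n : ℕ) : Polynomial ℂ :=
  orthoPoly (fun k => -a k) n

/-- The Verblunsky coefficients `α_n(x, y) = lam * α (Aⁿ (x, y))`. -/
def verblunsky (A : Matrix (Fin 2) (Fin 2) ℤ) (α : Torus2 → ℂ) (lam : ℝ) (p : Torus2) (n : ℕ) :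
    ℂ :=
  (lam : ℂ) * sampled A α n p

/-- `L_N(z) = (1 / 2N) log (|φ_N(z)|² + |ψ_N(z)|²)` at the point `p` of the torus. -/
def finiteLyapunov (A : Matrix (Fin 2) (Fin 2) ℤ) (α : Torus2 → ℂ) (lam : ℝ) (z : ℂ) (N : ℕ)
    (p : Torus2) : ℝ :=
  (1 / (2 * (N : ℝ))) *
    Real.log (‖(orthoPoly (verblunsky A α lam p) N).eval z‖ ^ 2 +
      ‖(secondKindPoly (verblunsky A α lam p) N).eval z‖ ^ 2)

/-- `L` is the Lyapunov exponent `L(z) = lim_N L_N(z)`, the limit being taken at almost every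
point of the torus. -/
def IsLyapunovExponent (A : Matrix (Fin 2) (Fin 2) ℤ) (α : Torus2 → ℂ) (lam : ℝ) (z : ℂ)
    (L : ℝ) : Prop :=
  ∀ᵐ p : Torus2, Tendsto (fun N : ℕ => finiteLyapunov A α lam z N p) atTop (𝓝 L)

end

/-! Put `b_n = λ z^(n+1) α(Aⁿ p)`. In the frame rotating with `z`, the Szegő recursion on the circle
moves a unimodular phase by `v_{n+1} = (v_n - b_n) / (1 - conj b_n v_n)`, `v_0 = 1`, and `log
|φ_N|²` is the sum over `n < N` of `ξ_n = log |1 - conj b_n v_n|² - log (1 - |b_n|²)`. Replacing `α`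
by `-α` gives `ψ_N`, with the same `𝒥`. So the large deviation estimate reduces to showing that `∑
ξ_n` is within about `λ³ N` of `N λ² 𝒥`, off a set of exponentially small measure
(`exists_ldle_growth`).

The probabilistic input is that the map stretches unstable arcs and that long arcs equidistribute at
an exponential rate (`norm_avg_le`). On a short unstable arc a function of the past is nearly
constant, while the far future has already equidistributed. Averaging over such arcs plays the role
of conditional expectation, so exponential moments and Chernoff's bound give large deviations
(`expSmall_sum_gt`), and the far future decouples from the past (`ldle_decouple`). The phase `v_n`
counts as past: for small `λ` its unstable Lipschitz constant grows no faster than that of `Aⁿ`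
(`past_v`).

The growth is expanded to third order over a window starting at time `n` (`sum_xi_approx`), and the
window of length `6i` is subtracted from the one of length `9i`. The terms linear in `α` that remain
lie in the far future of `v_n` and drop out. The mean of the `|S|²` term is `3i 𝒥` up to an
exponentially small error. Each remaining power `v_n^k` is multiplied by `conj z^(kn)` and averages
out by summation by parts as long as `z^k ≠ 1` (`exists_nonres`). The choice `i ~ λ^(-1/20)` makes
`mu^(-i)`, with `mu > 1` the expansion rate, smaller than any power of `λ` while `λ i³` still tends
to `0`.

For `k = 1, 2` this uses `z ≠ ±1`. The third order term with `v³` is resonant when `z³ = 1`. If `𝒥 ≠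
0`, then expanding `v³` itself over a window gives a drift whose coefficient has real part of order
`-λ² i 𝒥`, which forces the averages of `v³` to be small (`exists_cube`). If `𝒥 = 0`, the mean
squares of the window sums stay bounded, and their third moments are of smaller order than the
window length (`third_moment`). Either way the term costs only a small multiple of `λ³` per step.

The norms of the transfer matrices form a subadditive cocycle with bounded increments. Its limit
exists almost everywhere and is constant (`exists_tendsto_of_subadditive`), because the large
deviation bounds already give Birkhoff averages converging to the mean. The expansion then locates
the limit. -/

set_option linter.unusedSectionVars false

/-! ### Hyperbolic systems and equidistribution of long unstable arcs -/

/-- A measure preserving map of a compact space with an expanded flow `U` and a contracted flow `S`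
that commute and act transitively with bounded times. -/
structure HypSys (X : Type*) [TopologicalSpace X] [MeasurableSpace X] where
  P : Measure X
  prob : IsProbabilityMeasure P
  T : X → X
  U : ℝ → X → X
  S : ℝ → X → X
  κ : ℝ
  κ' : ℝ
  R : ℝ
  cont_T : Continuous T
  mp_T : MeasurePreserving T P P
  surj_T : Function.Surjective T
  cont_U : Continuous fun q : ℝ × X => U q.1 q.2
  mp_U : ∀ s, MeasurePreserving (U s) P P
  U_add : ∀ s t p, U (s + t) p = U s (U t p)
  comm : ∀ s t p, U s (S t p) = S t (U s p)
  T_U : ∀ s p, T (U s p) = U (κ * s) (T p)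
  T_S : ∀ s p, T (S s p) = S (κ' * s) (T p)
  one_lt : 1 < |κ|
  abs_κ' : |κ'| = |κ|⁻¹
  joined : ∀ p q, ∃ a b, |a| ≤ R ∧ |b| ≤ R ∧ q = U a (S b p)

namespace HypSys

variable {X : Type*} [TopologicalSpace X] [CompactSpace X] [SecondCountableTopology X]
  [MeasurableSpace X] [BorelSpace X] (H : HypSys X)

instance : IsProbabilityMeasure H.P := H.prob

/-- The expansion rate. -/
noncomputable def mu : ℝ := |H.κ|

lemma one_lt_mu : 1 < H.mu := H.one_lt

lemma mu_pos : 0 < H.mu := zero_lt_one.trans H.one_lt_mu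

lemma mu_pow_pos (n : ℕ) : 0 < H.mu ^ n := pow_pos H.mu_pos n

lemma abs_κ_pow (n : ℕ) : |H.κ ^ n| = H.mu ^ n := abs_pow _ _

lemma abs_κ'_pow (n : ℕ) : |H.κ' ^ n| = (H.mu ^ n)⁻¹ := by
  rw [abs_pow, H.abs_κ', inv_pow]; rfl

lemma κ_ne_zero : H.κ ≠ 0 := by
  intro h; have := H.one_lt; rw [h] at this; norm_num at this

lemma iter_U (n : ℕ) (s : ℝ) (p : X) : H.T^[n] (H.U s p) = H.U (H.κ ^ n * s) (H.T^[n] p) := by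
  induction n with
  | zero => simp
  | succ n ih => rw [Function.iterate_succ_apply', ih, H.T_U, Function.iterate_succ_apply']; ring_nf

lemma iter_S (n : ℕ) (s : ℝ) (p : X) : H.T^[n] (H.S s p) = H.S (H.κ' ^ n * s) (H.T^[n] p) := by
  induction n with
  | zero => simp
  | succ n ih => rw [Function.iterate_succ_apply', ih, H.T_S, Function.iterate_succ_apply']; ring_nf

lemma cont_iter (n : ℕ) : Continuous (H.T^[n]) := H.cont_T.iterate n

lemma mp_iter (n : ℕ) : MeasurePreserving (H.T^[n]) H.P H.P := H.mp_T.iterate n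

lemma cont_U_left (p : X) : Continuous fun s => H.U s p :=
  H.cont_U.comp (continuous_id.prodMk continuous_const)

lemma integral_iter {E : Type*} [NormedAddCommGroup E] [NormedSpace ℝ E] (n : ℕ) {f : X → E}
    (hf : Continuous f) [SecondCountableTopology E] [MeasurableSpace E] [BorelSpace E] :
    ∫ x, f (H.T^[n] x) ∂H.P = ∫ x, f x ∂H.P := by
  have h := H.mp_iter n
  rw [← integral_map h.measurable.aemeasurable
    (hf.measurable.aestronglyMeasurable), h.map_eq]

lemma integrable {E : Type*} [NormedAddCommGroup E] {f : X → E} (hf : Continuous f) :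
    Integrable f H.P :=
  hf.integrable_of_hasCompactSupport (HasCompactSupport.of_compactSpace f)

section avg

variable {E : Type*} [NormedAddCommGroup E] [NormedSpace ℝ E]

/-- The average of `f` over the unstable arc of (signed) length `l` starting at `p`. -/
noncomputable def avg (l : ℝ) (f : X → E) (p : X) : E := ∫ s in (0 : ℝ)..1, f (H.U (l * s) p)

lemma cont_arc {f : X → E} (hf : Continuous f) (l : ℝ) (p : X) :
    Continuous fun s => f (H.U (l * s) p) :=
  hf.comp ((H.cont_U_left p).comp (continuous_const.mul continuous_id))

lemma avg_iter (l : ℝ) (f : X → E) (n : ℕ) (p : X) :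
    H.avg l (fun x => f (H.T^[n] x)) p = H.avg (H.κ ^ n * l) f (H.T^[n] p) := by
  unfold avg
  simp only [H.iter_U, mul_assoc]

/-- Sliding an arc along itself only exchanges two end pieces of length `|a|`. -/
lemma avg_U_sub {f : X → E} (hf : Continuous f) {B : ℝ} (hB : ∀ p, ‖f p‖ ≤ B) {l : ℝ}
    (hl : l ≠ 0) (a : ℝ) (p : X) :
    ‖H.avg l f (H.U a p) - H.avg l f p‖ ≤ 2 * B * |a| / |l| := by
  have hc : Continuous fun s => f (H.U s p) := hf.comp (H.cont_U_left p)
  have h1 : H.avg l f (H.U a p) = l⁻¹ • ∫ s in a..(l + a), f (H.U s p) := by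
    unfold avg
    have := intervalIntegral.integral_comp_mul_add (a := 0) (b := 1)
      (fun s => f (H.U s p)) hl a
    simp only [mul_zero, zero_add, mul_one] at this
    rw [← this]
    simp only [H.U_add]
  have h2 : H.avg l f p = l⁻¹ • ∫ s in (0:ℝ)..l, f (H.U s p) := by
    unfold avg
    have := intervalIntegral.integral_comp_mul_left (a := 0) (b := 1)
      (fun s => f (H.U s p)) hl
    simp only [mul_zero, mul_one] at this
    rw [← this]
  rw [h1, h2, ← smul_sub, intervalIntegral.integral_interval_sub_interval_comm
    (hc.intervalIntegrable _ _) (hc.intervalIntegrable _ _) (hc.intervalIntegrable _ _),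
    norm_smul, norm_inv, Real.norm_eq_abs]
  have h3 : ‖∫ s in a..0, f (H.U s p)‖ ≤ B * |a| := by
    have := intervalIntegral.norm_integral_le_of_norm_le_const (a := a) (b := 0)
      (f := fun s => f (H.U s p)) (C := B) (fun s _ => hB _)
    simpa using this
  have h4 : ‖∫ s in (l + a)..l, f (H.U s p)‖ ≤ B * |a| := by
    have := intervalIntegral.norm_integral_le_of_norm_le_const (a := l + a) (b := l)
      (f := fun s => f (H.U s p)) (C := B) (fun s _ => hB _)
    simpa using this
  have h5 := norm_sub_le (∫ s in a..0, f (H.U s p)) (∫ s in (l + a)..l, f (H.U s p))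
  rw [div_eq_inv_mul]
  have : 0 ≤ |l|⁻¹ := by positivity
  exact mul_le_mul_of_nonneg_left (by linarith) this

/-- The flows commute, so a stable translate of an arc stays a stable distance `|b|` from it, point
by point. -/
lemma avg_S_sub {f : X → E} (hf : Continuous f) {K : ℝ}
    (hK : ∀ b p, ‖f (H.S b p) - f p‖ ≤ K * |b|) (l b : ℝ) (p : X) :
    ‖H.avg l f (H.S b p) - H.avg l f p‖ ≤ K * |b| := by
  unfold avg
  rw [← intervalIntegral.integral_sub ((H.cont_arc hf l _).intervalIntegrable _ _)
    ((H.cont_arc hf l _).intervalIntegrable _ _)]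
  have := intervalIntegral.norm_integral_le_of_norm_le_const (a := 0) (b := 1)
      (f := fun s => f (H.U (l * s) (H.S b p)) - f (H.U (l * s) p)) (C := K * |b|)
      (fun s _ => by rw [H.comm]; exact hK _ _)
  simpa using this

lemma cont_arcs {f : X → E} (hf : Continuous f) (l : ℝ) :
    Continuous (Function.uncurry fun (s : ℝ) (p : X) => f (H.U (l * s) p)) :=
  hf.comp (H.cont_U.comp ((continuous_const.mul continuous_fst).prodMk continuous_snd))

lemma integrable_arcs {f : X → E} (hf : Continuous f) (l : ℝ) [SecondCountableTopology E] :
    Integrable (Function.uncurry fun (s : ℝ) (p : X) => f (H.U (l * s) p))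
      ((volume.restrict (Set.uIoc (0:ℝ) 1)).prod H.P) := by
  obtain ⟨B, hB⟩ := (isCompact_range hf).isBounded.exists_norm_le
  borelize E
  have : IsFiniteMeasure (volume.restrict (Set.uIoc (0:ℝ) 1)) :=
    ⟨by rw [Measure.restrict_apply_univ, Set.uIoc_of_le zero_le_one]; simp⟩
  refine Integrable.of_bound (C := B)
    (H.cont_arcs hf l).measurable.aestronglyMeasurable ?_
  exact Eventually.of_forall fun q => hB _ ⟨_, rfl⟩

lemma integral_U {f : X → E} (hf : Continuous f) [SecondCountableTopology E] (s : ℝ) :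
    ∫ x, f (H.U s x) ∂H.P = ∫ x, f x ∂H.P := by
  borelize E
  have h := H.mp_U s
  rw [← integral_map h.measurable.aemeasurable
    (hf.measurable.aestronglyMeasurable), h.map_eq]

lemma integral_avg {f : X → E} (hf : Continuous f) [SecondCountableTopology E] [CompleteSpace E]
    (l : ℝ) :
    ∫ x, H.avg l f x ∂H.P = ∫ x, f x ∂H.P := by
  unfold avg
  rw [← intervalIntegral_integral_swap (H.integrable_arcs hf l)]
  simp [H.integral_U hf]

/-- Preimages of the two points under `T^[i]` are joined by bounded unstable and stable moves.
Applying `T^[i]` stretches the first to at most `R mu^i`, negligible against a long arc, and shrinks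
the second to at most `R mu^(-i)`. The number `i` is a free parameter balancing the two errors. -/
lemma avg_sub_avg_le {f : X → E} (hf : Continuous f) {B K : ℝ} (hB : ∀ p, ‖f p‖ ≤ B)
    (hK : ∀ b p, ‖f (H.S b p) - f p‖ ≤ K * |b|) (hK0 : 0 ≤ K)
    {l : ℝ} (hl : l ≠ 0) (i : ℕ) (p q : X) :
    ‖H.avg l f p - H.avg l f q‖ ≤ H.R * (2 * B * H.mu ^ i / |l| + K * (H.mu ^ i)⁻¹) := by
  have hB0 : 0 ≤ B := (norm_nonneg _).trans (hB p)
  obtain ⟨p, rfl⟩ := H.surj_T.iterate i p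
  obtain ⟨q, rfl⟩ := H.surj_T.iterate i q
  obtain ⟨a, b, ha, hb, rfl⟩ := H.joined q p
  rw [H.iter_U, H.iter_S]
  have h1 := H.avg_U_sub hf hB hl (H.κ ^ i * a) (H.S (H.κ' ^ i * b) (H.T^[i] q))
  have h2 := H.avg_S_sub hf hK l (H.κ' ^ i * b) (H.T^[i] q)
  rw [abs_mul, H.abs_κ_pow] at h1
  rw [abs_mul, H.abs_κ'_pow] at h2
  have hm := H.mu_pow_pos i
  have h3 : 2 * B * (H.mu ^ i * |a|) / |l| ≤ 2 * B * (H.mu ^ i * H.R) / |l| := by gcongr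
  have h4 : K * ((H.mu ^ i)⁻¹ * |b|) ≤ K * ((H.mu ^ i)⁻¹ * H.R) := by gcongr
  calc _ ≤ _ := norm_sub_le_norm_sub_add_norm_sub _
          (H.avg l f (H.S (H.κ' ^ i * b) (H.T^[i] q))) _
    _ ≤ 2 * B * (H.mu ^ i * H.R) / |l| + K * ((H.mu ^ i)⁻¹ * H.R) := by linarith
    _ = _ := by ring

/-- Equidistribution of long unstable arcs, with a rate. -/
lemma norm_avg_le {f : X → E} (hf : Continuous f) [SecondCountableTopology E] [CompleteSpace E]
    {B K : ℝ} (hB : ∀ p, ‖f p‖ ≤ B)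
    (hK : ∀ b p, ‖f (H.S b p) - f p‖ ≤ K * |b|) (hK0 : 0 ≤ K) (h0 : ∫ x, f x ∂H.P = 0)
    {l : ℝ} (hl : l ≠ 0) (i : ℕ) (p : X) :
    ‖H.avg l f p‖ ≤ H.R * (2 * B * H.mu ^ i / |l| + K * (H.mu ^ i)⁻¹) := by
  have hint : Integrable (fun x => H.avg l f x) H.P := by
    have := (H.integrable_arcs hf l).integral_prod_right
    simpa [avg, intervalIntegral.intervalIntegral_eq_integral_uIoc] using this
  -- The flow preserves `P`, so arc averages have the same mean as `f`, which is zero.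
  have h1 : H.avg l f p = ∫ q, (H.avg l f p - H.avg l f q) ∂H.P := by
    rw [integral_sub (integrable_const _) hint, H.integral_avg hf, h0]; simp
  rw [h1]
  refine (norm_integral_le_of_norm_le_const
    (Eventually.of_forall fun q => H.avg_sub_avg_le hf hB hK hK0 hl i p q)).trans ?_
  simp

end avg

end HypSys

/-! ### Exponentially small sets and a calculus of large deviation bounds -/

section ExpSmall

variable {X : Type*} [MeasurableSpace X] {P : Measure X}

/-- The measures of the sets `s N` decay exponentially. -/
def ExpSmall (P : Measure X) (s : ℕ → Set X) : Prop :=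
  ∃ c : ℝ, 0 < c ∧ ∃ N₀ : ℕ, ∀ N : ℕ, N₀ ≤ N → P.real (s N) ≤ Real.exp (-(c * N))

lemma eventually_mul_exp_le (K : ℝ) {c : ℝ} (hc : 0 < c) :
    ∀ᶠ N : ℕ in atTop, K * Real.exp (-(c * N)) ≤ Real.exp (-(c / 2 * N)) := by
  have h1 : Tendsto (fun N : ℕ => Real.exp (-(c / 2 * N))) atTop (𝓝 0) :=
    Real.tendsto_exp_neg_atTop_nhds_zero.comp
      (tendsto_natCast_atTop_atTop.const_mul_atTop (by positivity))
  have h2 : Tendsto (fun N : ℕ => K * Real.exp (-(c / 2 * N))) atTop (𝓝 0) := by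
    simpa using h1.const_mul K
  filter_upwards [h2.eventually_le_const zero_lt_one] with N hN
  have h3 : Real.exp (-(c * N)) = Real.exp (-(c / 2 * N)) * Real.exp (-(c / 2 * N)) := by
    rw [← Real.exp_add]; ring_nf
  rw [h3, ← mul_assoc]
  exact mul_le_of_le_one_left (Real.exp_pos _).le hN

lemma ExpSmall.of_le {s : ℕ → Set X} (K : ℝ) {c : ℝ} (hc : 0 < c)
    (h : ∀ᶠ N : ℕ in atTop, P.real (s N) ≤ K * Real.exp (-(c * N))) : ExpSmall P s := by
  obtain ⟨N₀, hN⟩ := eventually_atTop.1 (h.and (eventually_mul_exp_le K hc))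
  exact ⟨c / 2, by positivity, N₀, fun N hN' => (hN N hN').1.trans (hN N hN').2⟩

lemma ExpSmall.mono [IsFiniteMeasure P] {s t : ℕ → Set X} (ht : ExpSmall P t)
    (h : ∀ᶠ N in atTop, s N ⊆ t N) : ExpSmall P s := by
  obtain ⟨c, hc, N₀, hN⟩ := ht
  refine ExpSmall.of_le 1 hc ?_
  filter_upwards [h, eventually_ge_atTop N₀] with N h1 h2
  rw [one_mul]
  exact (measureReal_mono h1).trans (hN N h2)

lemma ExpSmall.union {s t : ℕ → Set X} (hs : ExpSmall P s) (ht : ExpSmall P t) :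
    ExpSmall P (fun N => s N ∪ t N) := by
  obtain ⟨c, hc, N₁, h1⟩ := hs
  obtain ⟨d, hd, N₂, h2⟩ := ht
  refine ExpSmall.of_le 2 (lt_min hc hd) ?_
  filter_upwards [eventually_ge_atTop N₁, eventually_ge_atTop N₂] with N h3 h4
  have h5 : Real.exp (-(c * N)) ≤ Real.exp (-(min c d * N)) :=
    Real.exp_le_exp.2 (neg_le_neg (mul_le_mul_of_nonneg_right (min_le_left _ _) N.cast_nonneg))
  have h6 : Real.exp (-(d * N)) ≤ Real.exp (-(min c d * N)) :=
    Real.exp_le_exp.2 (neg_le_neg (mul_le_mul_of_nonneg_right (min_le_right _ _) N.cast_nonneg))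
  linarith [measureReal_union_le (μ := P) (s N) (t N), h1 N h3, h2 N h4]

lemma ExpSmall.empty {s : ℕ → Set X} (h : ∀ᶠ N in atTop, s N = ∅) : ExpSmall P s := by
  refine ExpSmall.of_le 1 one_pos ?_
  filter_upwards [h] with N h1
  rw [h1]; simp only [measureReal_empty]; positivity

end ExpSmall

section LDle

variable {X : Type*} [MeasurableSpace X] {P : Measure X} [IsFiniteMeasure P]

/-- Up to exponentially small sets, the Birkhoff-type sums of `Y` are at most `(ε + o(1)) N`. -/
def LDle (P : Measure X) (Y : ℕ → X → ℂ) (ε : ℝ) : Prop :=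
  ∀ ε' > ε, ExpSmall P fun N => {x | ε' * N < ‖∑ n ∈ Finset.range N, Y n x‖}

lemma LDle.mono {Y : ℕ → X → ℂ} {ε δ : ℝ} (h : LDle P Y ε) (hδ : ε ≤ δ) : LDle P Y δ :=
  fun ε' h' => h ε' (hδ.trans_lt h')

lemma LDle.of_forall_gt {Y : ℕ → X → ℂ} {ε : ℝ} (h : ∀ δ > ε, LDle P Y δ) : LDle P Y ε := by
  intro ε' h'
  obtain ⟨δ, h1, h2⟩ := exists_between h'
  exact h δ h1 ε' h2

lemma LDle.add {Y Z : ℕ → X → ℂ} {ε δ : ℝ} (hY : LDle P Y ε) (hZ : LDle P Z δ) :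
    LDle P (fun n x => Y n x + Z n x) (ε + δ) := by
  intro ε' h'
  have h1 := (hY (ε + (ε' - (ε + δ)) / 2) (by linarith)).union
    (hZ (δ + (ε' - (ε + δ)) / 2) (by linarith))
  refine h1.mono (Eventually.of_forall fun N x hx => ?_)
  simp only [Set.mem_union, Set.mem_ofPred_eq] at hx ⊢
  by_contra! hcon
  rw [Finset.sum_add_distrib] at hx
  have := norm_add_le (∑ n ∈ Finset.range N, Y n x) (∑ n ∈ Finset.range N, Z n x)
  nlinarith [hcon.1, hcon.2]

lemma LDle.of_sum_bounded {Y : ℕ → X → ℂ} {B : ℝ}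
    (h : ∀ N x, ‖∑ n ∈ Finset.range N, Y n x‖ ≤ B) : LDle P Y 0 := by
  intro ε' h'
  refine ExpSmall.empty ?_
  filter_upwards [(tendsto_natCast_atTop_atTop.const_mul_atTop h').eventually_ge_atTop B]
    with N hN
  ext x
  simpa using (h N x).trans hN

lemma LDle.of_bounded {Y : ℕ → X → ℂ} {ε : ℝ} (h : ∀ n x, ‖Y n x‖ ≤ ε) : LDle P Y ε := by
  intro ε' h'
  refine ExpSmall.empty (Eventually.of_forall fun N => ?_)
  ext x
  simp only [Set.mem_ofPred_eq, Set.mem_empty_iff_false, iff_false, not_lt]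
  refine (norm_sum_le _ _).trans ((Finset.sum_le_sum fun n _ => h n x).trans ?_)
  simp only [Finset.sum_const, Finset.card_range, nsmul_eq_mul]
  rw [mul_comm]
  exact mul_le_mul_of_nonneg_right h'.le N.cast_nonneg

lemma LDle.zero : LDle P (fun _ _ => 0) 0 := LDle.of_bounded (by simp)

lemma LDle.congr {Y Z : ℕ → X → ℂ} {ε : ℝ} (h : LDle P Y ε) (hYZ : ∀ n x, Z n x = Y n x) :
    LDle P Z ε := by
  have : Z = Y := by funext n x; exact hYZ n x
  rwa [this]

/-- Since `LDle` only sees sums up to `o(N)`, telescoping and shift errors that are bounded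
uniformly in `N` cost nothing. -/
lemma LDle.congr_sum {Y Z : ℕ → X → ℂ} {ε B : ℝ} (h : LDle P Y ε)
    (hYZ : ∀ N x, ‖∑ n ∈ Finset.range N, Z n x - ∑ n ∈ Finset.range N, Y n x‖ ≤ B) :
    LDle P Z ε := by
  have h1 : LDle P (fun n x => Z n x - Y n x) 0 :=
    LDle.of_sum_bounded (B := B) fun N x => by rw [Finset.sum_sub_distrib]; exact hYZ N x
  simpa using (h.add h1).congr (Z := Z) (fun n x => by ring)

lemma LDle.of_norm_sub_le {Y Z : ℕ → X → ℂ} {ε δ : ℝ} (h : LDle P Y ε)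
    (hYZ : ∀ n x, ‖Z n x - Y n x‖ ≤ δ) : LDle P Z (ε + δ) :=
  (h.add (LDle.of_bounded hYZ)).congr fun n x => by ring

lemma LDle.const_mul {Y : ℕ → X → ℂ} {ε : ℝ} (h : LDle P Y ε) (c : ℂ) :
    LDle P (fun n x => c * Y n x) (‖c‖ * ε) := by
  by_cases hc : c = 0
  · simpa [hc] using LDle.zero (P := P)
  intro ε' h'
  have hc' : 0 < ‖c‖ := norm_pos_iff.2 hc
  refine (h (ε' / ‖c‖) (by rwa [gt_iff_lt, lt_div_iff₀ hc', mul_comm])).mono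
    (Eventually.of_forall fun N x hx => ?_)
  simp only [Set.mem_ofPred_eq] at hx ⊢
  rw [← Finset.mul_sum, norm_mul] at hx
  rw [div_mul_eq_mul_div, div_lt_iff₀ hc']
  linarith

lemma LDle.neg {Y : ℕ → X → ℂ} {ε : ℝ} (h : LDle P Y ε) : LDle P (fun n x => -Y n x) ε := by
  simpa using h.const_mul (-1)

lemma LDle.sub {Y Z : ℕ → X → ℂ} {ε δ : ℝ} (hY : LDle P Y ε) (hZ : LDle P Z δ) :
    LDle P (fun n x => Y n x - Z n x) (ε + δ) :=
  (hY.add hZ.neg).congr fun n x => by ring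

lemma LDle.of_const_mul {Y : ℕ → X → ℂ} {ε : ℝ} {c : ℂ} (hc : c ≠ 0)
    (h : LDle P (fun n x => c * Y n x) ε) : LDle P Y (ε / ‖c‖) := by
  have := h.const_mul c⁻¹
  rw [norm_inv, inv_mul_eq_div] at this
  exact this.congr fun n x => by field_simp

lemma LDle.re {Y : ℕ → X → ℂ} {ε : ℝ} (h : LDle P Y ε) :
    LDle P (fun n x => ((Y n x).re : ℂ)) ε := by
  intro ε' h'
  refine (h ε' h').mono (Eventually.of_forall fun N x hx => ?_)
  simp only [Set.mem_ofPred_eq] at hx ⊢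
  refine hx.trans_le ?_
  rw [← Complex.ofReal_sum, ← Complex.re_sum, Complex.norm_real]
  exact Complex.abs_re_le_norm _

/-- A shift by `m` only exchanges `m` terms at each end. -/
lemma norm_sum_shift_le {Y : ℕ → ℂ} {B : ℝ} (hB : ∀ n, ‖Y n‖ ≤ B) (m N : ℕ) :
    ‖∑ n ∈ Finset.range N, Y n - ∑ n ∈ Finset.range N, Y (n + m)‖ ≤ 2 * B * m := by
  have h1 : ∑ n ∈ Finset.range N, Y (n + m) + ∑ n ∈ Finset.range m, Y n
      = ∑ n ∈ Finset.range m, Y (N + n) + ∑ n ∈ Finset.range N, Y n := by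
    have a := Finset.sum_range_add Y m N
    have b := Finset.sum_range_add Y N m
    rw [add_comm m N] at a
    simp only [add_comm m] at a
    rw [add_comm, ← a, b, add_comm]
  have h2 : ∑ n ∈ Finset.range N, Y n - ∑ n ∈ Finset.range N, Y (n + m)
      = ∑ n ∈ Finset.range m, Y n - ∑ n ∈ Finset.range m, Y (N + n) := by
    linear_combination -h1
  rw [h2, ← Finset.sum_sub_distrib]
  refine (norm_sum_le _ _).trans ((Finset.sum_le_sum fun n _ =>
    (norm_sub_le _ _).trans (add_le_add (hB n) (hB (N + n)))).trans (le_of_eq ?_))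
  simp; ring

lemma LDle.of_shift {Y : ℕ → X → ℂ} {ε B : ℝ} (hB : ∀ n x, ‖Y n x‖ ≤ B) (m : ℕ)
    (h : LDle P (fun n x => Y (n + m) x) ε) : LDle P Y ε :=
  h.congr_sum fun N x => norm_sum_shift_le (fun n => hB n x) m N

/-- Averaging over shifts does not change the size of Birkhoff-type sums. -/
lemma LDle.of_sum_shift {Y : ℕ → X → ℂ} {ε B : ℝ} (hB : ∀ n x, ‖Y n x‖ ≤ B) (s : Finset ℕ)
    (hs : s.Nonempty) (h : LDle P (fun n x => ∑ k ∈ s, Y (n + k) x) ε) :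
    LDle P Y (ε / s.card) := by
  have hs' : (s.card : ℂ) ≠ 0 := by exact_mod_cast hs.card_pos.ne'
  have h1 : LDle P (fun n x => (s.card : ℂ) * Y n x) ε := by
    refine h.congr_sum (B := ∑ k ∈ s, 2 * B * (k : ℕ)) fun N x => ?_
    rw [Finset.sum_comm, ← Finset.mul_sum, ← nsmul_eq_mul, ← Finset.sum_const,
      ← Finset.sum_sub_distrib]
    exact (norm_sum_le _ _).trans (Finset.sum_le_sum fun k _ =>
      norm_sum_shift_le (fun n => hB n x) k N)
  simpa using LDle.of_const_mul hs' h1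

/-- Summation by parts against a character. -/
lemma LDle.of_rotated_diff {Y : ℕ → X → ℂ} {ε B : ℝ} (hB : ∀ n x, ‖Y n x‖ ≤ B) {w : ℂ}
    (hw : ‖w‖ = 1) (hw1 : w ≠ 1) (h : LDle P (fun n x => w ^ n * (Y (n + 1) x - Y n x)) ε) :
    LDle P (fun n x => w ^ n * Y n x) (ε / ‖w⁻¹ - 1‖) := by
  have hw0 : w ≠ 0 := by rintro rfl; simp at hw
  have h1 : w⁻¹ - 1 ≠ 0 := by
    intro h2; exact hw1 (by rw [sub_eq_zero] at h2; simpa using h2)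
  refine LDle.of_const_mul h1 ?_
  refine h.congr_sum (B := 2 * B * 1) fun N x => ?_
  have h3 := norm_sum_shift_le (Y := fun n => w⁻¹ * (w ^ n * Y n x)) (B := B)
    (fun n => by simpa [hw] using hB n x) 1 N
  simp only [Nat.cast_one] at h3
  rw [norm_sub_rev, ← Finset.sum_sub_distrib] at h3
  rw [← Finset.sum_sub_distrib, ← norm_neg, ← Finset.sum_neg_distrib]
  refine le_of_eq_of_le (congrArg _ (Finset.sum_congr rfl fun n _ => ?_)) h3
  rw [pow_succ]
  field_simp
  ring

end LDle

/-! ### Exponential moments and Chernoff bounds through unstable arcs -/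

namespace HypSys

variable {X : Type*} [TopologicalSpace X] [CompactSpace X] [SecondCountableTopology X]
  [MeasurableSpace X] [BorelSpace X] (H : HypSys X)

lemma sum_pow_le {w : ℝ} (hw : 2 ≤ w) (J : ℕ) : ∑ j ∈ Finset.range J, w ^ j ≤ 2 * w ^ J / w := by
  have hw0 : 0 < w := by linarith
  rw [le_div_iff₀ hw0]
  have h := geom_sum_mul w J
  have h1 : 0 ≤ ∑ j ∈ Finset.range J, w ^ j := Finset.sum_nonneg fun j _ => by positivity
  nlinarith

/-- One step of a martingale-type estimate: integrating over unstable arcs of length `l` replaces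
conditioning on the past. On an arc the accumulated sum `R` rises by at most `δ`, while the new term
`Z` has average at most `ε₀`; `e^y ≤ 1 + y + y²` for `|y| ≤ 1` then bounds the factor gained. -/
lemma exp_integral_step {R Z : X → ℝ} (hR : Continuous R) (hZ : Continuous Z) {B l δ ε₀ t : ℝ}
    (hB : ∀ p, |Z p| ≤ B) (hRl : ∀ s ∈ Set.Icc (0:ℝ) 1, ∀ p, R (H.U (l * s) p) ≤ R p + δ)
    (havg : ∀ p, H.avg l Z p ≤ ε₀) (ht : 0 < t) (htB : t * B ≤ 1) :
    ∫ x, Real.exp (t * (R x + Z x)) ∂H.P ≤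
      Real.exp (t * (ε₀ + δ + t * B ^ 2)) * ∫ x, Real.exp (t * R x) ∂H.P := by
  have hc : Continuous fun x => Real.exp (t * (R x + Z x)) :=
    Real.continuous_exp.comp (continuous_const.mul (hR.add hZ))
  have hcR : Continuous fun x => Real.exp (t * R x) :=
    Real.continuous_exp.comp (continuous_const.mul hR)
  rw [← H.integral_avg hc l, ← integral_const_mul]
  have hint : Integrable (fun x => H.avg l (fun x => Real.exp (t * (R x + Z x))) x) H.P := by
    have := (H.integrable_arcs hc l).integral_prod_right
    simpa [avg, intervalIntegral.intervalIntegral_eq_integral_uIoc] using this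
  refine integral_mono hint ((H.integrable hcR).const_mul _) fun p => ?_
  have hB0 : 0 ≤ B := (abs_nonneg _).trans (hB p)
  have hZa : Continuous fun s => Z (H.U (l * s) p) := H.cont_arc hZ l p
  have h1 : H.avg l (fun x => Real.exp (t * (R x + Z x))) p ≤
      ∫ s in (0:ℝ)..1, Real.exp (t * (R p + δ)) * (1 + t * Z (H.U (l * s) p) + t ^ 2 * B ^ 2) := by
    refine intervalIntegral.integral_mono_on zero_le_one
      ((H.cont_arc hc l p).intervalIntegrable _ _) ?_ fun s hs => ?_
    · exact (continuous_const.mul ((continuous_const.add (continuous_const.mul hZa)).add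
        continuous_const)).intervalIntegrable _ _
    · set y := Z (H.U (l * s) p)
      have hy : |y| ≤ B := hB _
      have hty : |t * y| ≤ 1 := by
        rw [abs_mul, abs_of_pos ht]
        exact (mul_le_mul_of_nonneg_left hy ht.le).trans htB
      have h2 : Real.exp (t * y) ≤ 1 + t * y + t ^ 2 * B ^ 2 := by
        have h3 := Real.abs_exp_sub_one_sub_id_le hty
        have h4 := (abs_le.1 h3).2
        have h5 : (t * y) ^ 2 ≤ t ^ 2 * B ^ 2 := by
          rw [mul_pow]
          exact mul_le_mul_of_nonneg_left (sq_le_sq' (abs_le.1 hy).1 (abs_le.1 hy).2) (sq_nonneg t)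
        linarith
      have h6 : Real.exp (t * R (H.U (l * s) p)) ≤ Real.exp (t * (R p + δ)) :=
        Real.exp_le_exp.2 (mul_le_mul_of_nonneg_left (hRl s hs p) ht.le)
      calc Real.exp (t * (R (H.U (l * s) p) + y))
          = Real.exp (t * R (H.U (l * s) p)) * Real.exp (t * y) := by rw [← Real.exp_add]; ring_nf
        _ ≤ _ := mul_le_mul h6 h2 (Real.exp_pos _).le (Real.exp_pos _).le
  refine h1.trans ?_
  have h7 : ∫ s in (0:ℝ)..1, Real.exp (t * (R p + δ)) * (1 + t * Z (H.U (l * s) p) + t ^ 2 * B ^ 2)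
      = Real.exp (t * (R p + δ)) * (1 + t * H.avg l Z p + t ^ 2 * B ^ 2) := by
    have i1 : IntervalIntegrable (fun s => t * Z (H.U (l * s) p)) volume 0 1 :=
      (continuous_const.mul hZa).intervalIntegrable _ _
    have i2 : IntervalIntegrable (fun s => 1 + t * Z (H.U (l * s) p)) volume 0 1 :=
      (continuous_const.add (continuous_const.mul hZa)).intervalIntegrable _ _
    rw [intervalIntegral.integral_const_mul,
      intervalIntegral.integral_add i2 (continuous_const.intervalIntegrable _ _),
      intervalIntegral.integral_add (continuous_const.intervalIntegrable _ _) i1,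
      intervalIntegral.integral_const_mul]
    simp [avg]
  rw [h7]
  have h8 : 1 + t * H.avg l Z p + t ^ 2 * B ^ 2 ≤ Real.exp (t * (ε₀ + t * B ^ 2)) := by
    have := Real.add_one_le_exp (t * (ε₀ + t * B ^ 2))
    have h9 := mul_le_mul_of_nonneg_left (havg p) ht.le
    nlinarith
  calc Real.exp (t * (R p + δ)) * (1 + t * H.avg l Z p + t ^ 2 * B ^ 2)
      ≤ Real.exp (t * (R p + δ)) * Real.exp (t * (ε₀ + t * B ^ 2)) :=
        mul_le_mul_of_nonneg_left h8 (Real.exp_pos _).le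
    _ = Real.exp (t * (ε₀ + δ + t * B ^ 2)) * Real.exp (t * R p) := by
        rw [← Real.exp_add, ← Real.exp_add]; ring_nf

lemma exp_integral_le {Z : ℕ → X → ℝ} (hZ : ∀ j, Continuous (Z j)) {B δ ε₀ t : ℝ} {l : ℕ → ℝ}
    (hB : ∀ j p, |Z j p| ≤ B)
    (hRl : ∀ J, ∀ s ∈ Set.Icc (0:ℝ) 1, ∀ p, ∑ j ∈ Finset.range J, Z j (H.U (l J * s) p) ≤
      ∑ j ∈ Finset.range J, Z j p + δ)
    (havg : ∀ j p, H.avg (l j) (Z j) p ≤ ε₀) (ht : 0 < t) (htB : t * B ≤ 1) (J : ℕ) :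
    ∫ x, Real.exp (t * ∑ j ∈ Finset.range J, Z j x) ∂H.P ≤
      Real.exp (J * (t * (ε₀ + δ + t * B ^ 2))) := by
  induction J with
  | zero => simp
  | succ J ih =>
    simp only [Finset.sum_range_succ]
    refine (H.exp_integral_step (continuous_finsetSum _ fun j _ => hZ j) (hZ J) (hB J) (hRl J)
      (havg J) ht htB).trans ?_
    refine (mul_le_mul_of_nonneg_left ih (Real.exp_pos _).le).trans (le_of_eq ?_)
    rw [← Real.exp_add]; push_cast; ring_nf

/-- Chernoff's inequality applied to `exp_integral_le`. -/
lemma measure_sum_gt_le {Z : ℕ → X → ℝ} (hZ : ∀ j, Continuous (Z j)) {B δ ε₀ ε t : ℝ} {l : ℕ → ℝ}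
    (hB : ∀ j p, |Z j p| ≤ B)
    (hRl : ∀ J, ∀ s ∈ Set.Icc (0:ℝ) 1, ∀ p, ∑ j ∈ Finset.range J, Z j (H.U (l J * s) p) ≤
      ∑ j ∈ Finset.range J, Z j p + δ)
    (havg : ∀ j p, H.avg (l j) (Z j) p ≤ ε₀) (ht : 0 < t) (htB : t * B ≤ 1) (J : ℕ) :
    H.P.real {x | ε * J < ∑ j ∈ Finset.range J, Z j x} ≤
      Real.exp (-(t * (ε - (ε₀ + δ + t * B ^ 2)) * J)) := by
  have hc : Continuous fun x => Real.exp (t * ∑ j ∈ Finset.range J, Z j x) :=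
    Real.continuous_exp.comp (continuous_const.mul (continuous_finsetSum _ fun j _ => hZ j))
  have h1 := ProbabilityTheory.measure_ge_le_exp_mul_mgf (μ := H.P)
    (X := fun x => ∑ j ∈ Finset.range J, Z j x) (ε * J) ht.le (H.integrable hc)
  have h2 := H.exp_integral_le hZ hB hRl havg ht htB J
  have h3 : H.P.real {x | ε * J < ∑ j ∈ Finset.range J, Z j x} ≤
      H.P.real {x | ε * J ≤ ∑ j ∈ Finset.range J, Z j x} :=
    measureReal_mono fun x hx => le_of_lt (Set.mem_ofPred_eq ▸ hx : _ < _)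
  refine h3.trans (h1.trans ?_)
  unfold ProbabilityTheory.mgf
  refine (mul_le_mul_of_nonneg_left h2 (Real.exp_pos _).le).trans (le_of_eq ?_)
  rw [← Real.exp_add]; ring_nf

lemma sum_range_mul (Y : ℕ → ℝ) (J q : ℕ) : ∑ n ∈ Finset.range (J * q), Y n =
    ∑ r ∈ Finset.range q, ∑ j ∈ Finset.range J, Y (j * q + r) := by
  rw [Finset.sum_comm]
  induction J with
  | zero => simp
  | succ J ih => rw [Nat.succ_mul, Finset.sum_range_add, ih, Finset.sum_range_succ]

/-- A large deviation bound for sums of functions that oscillate on small unstable arcs. -/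
theorem expSmall_sum_gt {Y : ℕ → X → ℝ} (hY : ∀ n, Continuous (Y n)) {B D a ε₀ ε : ℝ}
    (hB : ∀ n p, |Y n p| ≤ B)
    (hD : ∀ n s p, |Y n (H.U s p) - Y n p| ≤ D * H.mu ^ n * |s|) (ha : 0 < a)
    (havg : ∀ n p, H.avg (a * (H.mu ^ n)⁻¹) (Y n) p ≤ ε₀) (hε : ε₀ < ε) (hε₀ : 0 ≤ ε₀) :
    ExpSmall H.P fun N => {x | ε * N < ∑ n ∈ Finset.range N, Y n x} := by
  obtain ⟨p₀⟩ : Nonempty X := H.P.nonempty_of_neZero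
  have hB0 : 0 ≤ B := (abs_nonneg _).trans (hB 0 p₀)
  have hD0 : 0 ≤ D := by
    have := (abs_nonneg _).trans (hD 0 1 p₀); simpa using this
  -- The gap `8η` is spent as follows: `η` for the variation of the past, `η` for the quadratic term
  -- `t B²`, `2η` for the exponential rate, and `4η` for the terms left over when `N` is not
  -- divisible by `q`.
  set η := (ε - ε₀) / 8 with hη
  have hη0 : 0 < η := by rw [hη]; linarith
  -- Times are split into residue classes mod `q`. Within a class consecutive scales differ by the
  -- factor `mu^q`, so the whole past sum varies by at most the geometric series `2 D a / mu^q ≤ η`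
  -- on the next arc.
  obtain ⟨q, hq2, hq1, hq0⟩ : ∃ q : ℕ, 2 ≤ H.mu ^ q ∧ 2 * D * a / η ≤ H.mu ^ q ∧ 0 < q := by
    have h1 := tendsto_pow_atTop_atTop_of_one_lt H.one_lt_mu
    exact ((h1.eventually_ge_atTop 2).and ((h1.eventually_ge_atTop _).and
      (eventually_gt_atTop 0))).exists
  set t := min (1 / (B + 1)) (η / (B ^ 2 + 1)) with ht'
  have ht : 0 < t := lt_min (by positivity) (by positivity)
  have htB : t * B ≤ 1 := by
    have h1 : t ≤ 1 / (B + 1) := min_le_left _ _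
    rw [le_div_iff₀ (by positivity)] at h1
    nlinarith
  have htB2 : t * B ^ 2 ≤ η := by
    have h1 : t ≤ η / (B ^ 2 + 1) := min_le_right _ _
    rw [le_div_iff₀ (by positivity)] at h1
    nlinarith
  set ε₂ := ε₀ + 4 * η with hε₂
  have key : ∀ r J : ℕ, H.P.real {x | ε₂ * J < ∑ j ∈ Finset.range J, Y (j * q + r) x} ≤
      Real.exp (-(t * (2 * η) * J)) := by
    intro r J
    refine (H.measure_sum_gt_le (Z := fun j => Y (j * q + r))
      (l := fun j => a * (H.mu ^ (j * q + r))⁻¹) (δ := η) (fun j => hY _)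
      (fun j p => hB _ p) ?_ (fun j p => havg _ p) ht htB J).trans ?_
    · intro J s hs p
      have h1 : ∀ j ∈ Finset.range J, Y (j * q + r) (H.U (a * (H.mu ^ (J * q + r))⁻¹ * s) p) ≤
          Y (j * q + r) p + D * H.mu ^ (j * q + r) * (a * (H.mu ^ (J * q + r))⁻¹) := by
        intro j _
        have h2 := (abs_le.1 (hD (j * q + r) (a * (H.mu ^ (J * q + r))⁻¹ * s) p)).2
        have h3 : |a * (H.mu ^ (J * q + r))⁻¹ * s| ≤ a * (H.mu ^ (J * q + r))⁻¹ := by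
          have hm := H.mu_pow_pos (J * q + r)
          rw [abs_of_nonneg (by have := hs.1; positivity)]
          exact mul_le_of_le_one_right (by positivity) hs.2
        have hm := H.mu_pow_pos (j * q + r)
        have := mul_le_mul_of_nonneg_left h3 (mul_nonneg hD0 hm.le)
        linarith
      refine (Finset.sum_le_sum h1).trans ?_
      rw [Finset.sum_add_distrib]
      gcongr
      have h4 : ∑ j ∈ Finset.range J, D * H.mu ^ (j * q + r) * (a * (H.mu ^ (J * q + r))⁻¹)
          = (D * a / (H.mu ^ q) ^ J) * ∑ j ∈ Finset.range J, (H.mu ^ q) ^ j := by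
        rw [Finset.mul_sum]
        refine Finset.sum_congr rfl fun j _ => ?_
        have hm := H.mu_pos.ne'
        rw [← pow_mul, ← pow_mul, pow_add, pow_add, mul_comm q j, mul_comm q J]
        field_simp
      rw [h4]
      have hw := H.mu_pow_pos q
      have h5 := sum_pow_le hq2 J
      calc _ ≤ (D * a / (H.mu ^ q) ^ J) * (2 * (H.mu ^ q) ^ J / H.mu ^ q) := by gcongr
        _ = 2 * D * a / H.mu ^ q := by field_simp
        _ ≤ η := by
          rw [div_le_iff₀ hw]; rw [div_le_iff₀ hη0] at hq1; linarith
    · refine Real.exp_le_exp.2 (neg_le_neg ?_)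
      have : 2 * η ≤ ε₂ - (ε₀ + η + t * B ^ 2) := by rw [hε₂]; linarith
      gcongr
  have hq0' : (0:ℝ) < q := by exact_mod_cast hq0
  refine ExpSmall.of_le (q * Real.exp (t * (2 * η))) (c := t * (2 * η) / q) (by positivity) ?_
  filter_upwards [(tendsto_natCast_atTop_atTop.const_mul_atTop
    (show 0 < 4 * η by positivity)).eventually_ge_atTop ((q:ℝ) * B)] with N hN
  set J := N / q with hJ
  have hJN : J * q ≤ N := Nat.div_mul_le_self N q
  have hNJ : N < J * q + q := by
    have := Nat.lt_div_mul_add (a := N) hq0; simpa [hJ] using this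
  have hsub : {x | ε * N < ∑ n ∈ Finset.range N, Y n x} ⊆
      ⋃ r ∈ Finset.range q, {x | ε₂ * J < ∑ j ∈ Finset.range J, Y (j * q + r) x} := by
    intro x hx
    simp only [Set.mem_iUnion, Set.mem_ofPred_eq] at hx ⊢
    by_contra! hcon
    have h1 : ∑ n ∈ Finset.range (J * q), Y n x ≤ q * (ε₂ * J) := by
      rw [sum_range_mul (fun n => Y n x)]
      refine (Finset.sum_le_sum hcon).trans (le_of_eq (by simp))
    have h2 : ∑ n ∈ Finset.range N, Y n x ≤ ∑ n ∈ Finset.range (J * q), Y n x + q * B := by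
      have h3 : N = J * q + (N - J * q) := by omega
      rw [h3, Finset.sum_range_add]
      gcongr
      refine (Finset.sum_le_sum fun n _ => (le_abs_self _).trans (hB _ x)).trans ?_
      simp only [Finset.sum_const, Finset.card_range, nsmul_eq_mul]
      gcongr
      omega
    have h4 : (J:ℝ) * q ≤ N := by exact_mod_cast hJN
    have h5 : 0 ≤ ε₂ := by rw [hε₂]; positivity
    have h6 : ε = ε₂ + 4 * η := by rw [hε₂, hη]; ring
    have h7 : ε₂ * (J * q) ≤ ε₂ * N := mul_le_mul_of_nonneg_left h4 h5
    rw [h6] at hx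
    linarith
  refine (measureReal_mono hsub (measure_ne_top _ _)).trans ((measureReal_biUnion_finset_le _ _).trans
    ((Finset.sum_le_sum fun r _ => key r J).trans ?_))
  simp only [Finset.sum_const, Finset.card_range, nsmul_eq_mul]
  rw [mul_assoc (q:ℝ) (Real.exp _) (Real.exp _), ← Real.exp_add]
  gcongr
  have h8 : (N:ℝ) ≤ J * q + q := by exact_mod_cast hNJ.le
  have h9 : (N:ℝ) / q ≤ J + 1 := by rw [div_le_iff₀ hq0']; linarith
  have h10 : t * (2 * η) / q * N = t * (2 * η) * (N / q) := by ring
  rw [h10]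
  nlinarith [mul_le_mul_of_nonneg_left h9 (show 0 ≤ t * (2 * η) by positivity)]

end HypSys

/-! ### The Szegő recursion on the circle and its expansion over a window -/

namespace Szego

open ComplexConjugate

/-- One step of the Szegő recursion in the rotating frame, acting on the unit circle. -/
noncomputable def vStep (b v : ℂ) : ℂ := (v - b) / (1 - conj b * v)

/-- The orbit of `v₀` under the Szegő recursion. -/
noncomputable def vSeq (b : ℕ → ℂ) (v₀ : ℂ) : ℕ → ℂ
  | 0 => v₀
  | n + 1 => vStep (b n) (vSeq b v₀ n)

/-- The logarithmic growth of the squared modulus in one step. -/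
noncomputable def xi (b v : ℂ) : ℝ := Real.log (‖1 - conj b * v‖ ^ 2) - Real.log (1 - ‖b‖ ^ 2)

/-- The entries of the product of the first `n` transfer matrices. -/
noncomputable def xy (b : ℕ → ℂ) : ℕ → ℂ × ℂ
  | 0 => (1, 0)
  | n + 1 => ((xy b n).1 - b n * conj (xy b n).2, (xy b n).2 - b n * conj (xy b n).1)

/-- Iterating the recursion for `xy` gives `1 + wX + ...` for the first entry and `-wS + wY + ...`
for the second; `wS`, `wX`, `wY` are the parts of degree 1, 2, 3 in `b`. -/
noncomputable def wS (b : ℕ → ℂ) (n : ℕ) : ℂ := ∑ k ∈ Finset.range n, b k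

noncomputable def wX (b : ℕ → ℂ) (n : ℕ) : ℂ := ∑ k ∈ Finset.range n, b k * conj (wS b k)

noncomputable def wY (b : ℕ → ℂ) (n : ℕ) : ℂ := -∑ k ∈ Finset.range n, b k * conj (wX b k)

/-- The cubic coefficient of `v` in the logarithm of the denominator: `conj wY` enters directly, the
product is the cross term of `log (1 + w)`. -/
noncomputable def wτ (b : ℕ → ℂ) (n : ℕ) : ℂ :=
  conj (wY b n) + conj (wS b n) * conj (wX b n)

lemma wS_smul (c : ℂ) (b : ℕ → ℂ) (n : ℕ) : wS (fun k => c * b k) n = c * wS b n := by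
  simp [wS, Finset.mul_sum]

lemma wX_smul (c : ℂ) (b : ℕ → ℂ) (n : ℕ) :
    wX (fun k => c * b k) n = c * conj c * wX b n := by
  simp only [wX, wS_smul, map_mul, Finset.mul_sum]
  exact Finset.sum_congr rfl fun k _ => by ring

lemma wY_smul (c : ℂ) (b : ℕ → ℂ) (n : ℕ) :
    wY (fun k => c * b k) n = c * (c * conj c) * wY b n := by
  simp only [wY, wX_smul, map_mul, Finset.mul_sum, mul_neg, Complex.conj_conj]
  exact congrArg _ (Finset.sum_congr rfl fun k _ => by ring)

lemma wτ_smul (c : ℂ) (b : ℕ → ℂ) (n : ℕ) :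
    wτ (fun k => c * b k) n = conj c * (c * conj c) * wτ b n := by
  simp only [wτ, wX_smul, wS_smul, wY_smul, map_mul, Complex.conj_conj]
  ring

lemma vSeq_add (b : ℕ → ℂ) (v₀ : ℂ) (n k : ℕ) :
    vSeq b v₀ (n + k) = vSeq (fun j => b (n + j)) (vSeq b v₀ n) k := by
  induction k with
  | zero => rfl
  | succ k ih => rw [← add_assoc, vSeq, vSeq, ih]

lemma norm_conj_mul_lt {b v : ℂ} (hb : ‖b‖ < 1) (hv : ‖v‖ = 1) : ‖conj b * v‖ < 1 := by
  simpa [hv] using hb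

lemma den_ne_zero {b v : ℂ} (hb : ‖b‖ < 1) (hv : ‖v‖ = 1) : 1 - conj b * v ≠ 0 := by
  intro h
  have := norm_conj_mul_lt hb hv
  rw [← sub_eq_zero.1 h] at this
  simp at this

lemma le_norm_den {b v : ℂ} (hv : ‖v‖ = 1) : 1 - ‖b‖ ≤ ‖1 - conj b * v‖ := by
  have := norm_sub_norm_le (1 : ℂ) (conj b * v)
  simpa [hv] using this

lemma conj_eq_inv {v : ℂ} (hv : ‖v‖ = 1) : conj v * v = 1 := by
  rw [mul_comm, Complex.mul_conj, Complex.normSq_eq_norm_sq, hv]; norm_num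

/-- On the circle the numerator is `v` times the conjugate of the denominator. -/
lemma norm_vStep {b v : ℂ} (hb : ‖b‖ < 1) (hv : ‖v‖ = 1) : ‖vStep b v‖ = 1 := by
  have h1 : v - b = v * conj (1 - conj b * v) := by
    simp only [map_sub, map_one, map_mul, Complex.conj_conj]
    linear_combination b * conj_eq_inv hv
  rw [vStep, norm_div, h1, norm_mul, hv, RCLike.norm_conj, one_mul,
    div_self (norm_ne_zero_iff.2 (den_ne_zero hb hv))]

lemma norm_vSeq {b : ℕ → ℂ} (hb : ∀ n, ‖b n‖ < 1) {v₀ : ℂ} (hv : ‖v₀‖ = 1) (n : ℕ) :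
    ‖vSeq b v₀ n‖ = 1 := by
  induction n with
  | zero => exact hv
  | succ n ih => exact norm_vStep (hb n) ih

lemma vStep_sub_self {b v : ℂ} (hb : ‖b‖ < 1) (hv : ‖v‖ = 1) :
    vStep b v - v = (conj b * v ^ 2 - b) / (1 - conj b * v) := by
  rw [vStep, div_sub' (den_ne_zero hb hv)]; ring

lemma norm_vStep_sub_le {b v : ℂ} {lam : ℝ} (hb : ‖b‖ ≤ lam) (hl : lam ≤ 1 / 2) (hv : ‖v‖ = 1) :
    ‖vStep b v - v‖ ≤ 4 * lam := by
  have hb1 : ‖b‖ < 1 := by linarith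
  have hd := le_norm_den (b := b) hv
  rw [vStep_sub_self hb1 hv, norm_div, div_le_iff₀ (by linarith)]
  have : ‖conj b * v ^ 2 - b‖ ≤ lam + lam := by
    refine (norm_sub_le _ _).trans (add_le_add ?_ hb); simpa [hv] using hb
  have h0 : 0 ≤ lam := (norm_nonneg _).trans hb
  nlinarith

lemma norm_vStep_sub_sub_le {b v : ℂ} {lam : ℝ} (hb : ‖b‖ ≤ lam) (hl : lam ≤ 1 / 2)
    (hv : ‖v‖ = 1) : ‖vStep b v - v - (conj b * v ^ 2 - b)‖ ≤ 4 * lam ^ 2 := by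
  have hb1 : ‖b‖ < 1 := by linarith
  have h0 : 0 ≤ lam := (norm_nonneg _).trans hb
  have h1 : vStep b v - v - (conj b * v ^ 2 - b) = conj b * v * (vStep b v - v) := by
    rw [vStep_sub_self hb1 hv]
    have := den_ne_zero hb1 hv
    field_simp
    ring
  rw [h1, norm_mul]
  have h2 : ‖conj b * v‖ ≤ lam := by simpa [hv] using hb
  calc _ ≤ lam * (4 * lam) := mul_le_mul h2 (norm_vStep_sub_le hb hl hv) (norm_nonneg _) h0
    _ = _ := by ring

lemma norm_pow_sub_pow_le {v w : ℂ} (hv : ‖v‖ = 1) (hw : ‖w‖ = 1) (k : ℕ) :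
    ‖w ^ k - v ^ k‖ ≤ k * ‖w - v‖ := by
  induction k with
  | zero => simp
  | succ k ih =>
    have : w ^ (k + 1) - v ^ (k + 1) = w * (w ^ k - v ^ k) + v ^ k * (w - v) := by ring
    rw [this]
    refine (norm_add_le _ _).trans ?_
    rw [norm_mul, norm_mul, hw, norm_pow, hv, one_pow]
    push_cast; linarith

lemma norm_pow_sub_sub_le {v w : ℂ} (hv : ‖v‖ = 1) (hw : ‖w‖ = 1) (k : ℕ) :
    ‖w ^ k - v ^ k - k * v ^ (k - 1) * (w - v)‖ ≤ k ^ 2 * ‖w - v‖ ^ 2 := by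
  induction k with
  | zero => simp
  | succ k ih =>
    have hk : (k : ℂ) * v ^ (k - 1) * v = k * v ^ k := by
      cases k with
      | zero => simp
      | succ k => simp only [Nat.add_sub_cancel]; ring
    have : w ^ (k + 1) - v ^ (k + 1) - ((k + 1 : ℕ) : ℂ) * v ^ (k + 1 - 1) * (w - v) =
        w * (w ^ k - v ^ k - k * v ^ (k - 1) * (w - v)) + k * v ^ (k - 1) * (w - v) ^ 2 := by
      simp only [Nat.add_sub_cancel]; push_cast
      linear_combination (w - v) * hk
    rw [this]
    refine (norm_add_le _ _).trans ?_
    rw [norm_mul, hw, one_mul, norm_mul, norm_mul, norm_pow, norm_pow, hv, one_pow, mul_one,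
      Complex.norm_natCast]
    push_cast
    nlinarith [sq_nonneg ‖w - v‖, (Nat.cast_nonneg k : (0:ℝ) ≤ k)]

/-- To first order every increment of `v^k` is linear in `b`; this is what makes powers of the phase
slow variables. -/
lemma norm_vStep_pow_le {b v : ℂ} {lam : ℝ} (hb : ‖b‖ ≤ lam) (hl : lam ≤ 1 / 2)
    (hv : ‖v‖ = 1) (k : ℕ) (hk : 1 ≤ k) :
    ‖vStep b v ^ k - v ^ k - k * (conj b * v ^ (k + 1) - b * v ^ (k - 1))‖ ≤
      20 * k ^ 2 * lam ^ 2 := by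
  have hb1 : ‖b‖ < 1 := by linarith
  have h0 : 0 ≤ lam := (norm_nonneg _).trans hb
  have h1 := norm_pow_sub_sub_le hv (norm_vStep hb1 hv) k
  have h2 := norm_vStep_sub_sub_le hb hl hv
  have h3 := norm_vStep_sub_le hb hl hv
  have h4 : vStep b v ^ k - v ^ k - k * (conj b * v ^ (k + 1) - b * v ^ (k - 1)) =
      (vStep b v ^ k - v ^ k - k * v ^ (k - 1) * (vStep b v - v)) +
      k * v ^ (k - 1) * (vStep b v - v - (conj b * v ^ 2 - b)) := by
    obtain ⟨k, rfl⟩ := Nat.exists_eq_succ_of_ne_zero (Nat.one_le_iff_ne_zero.1 hk)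
    simp only [Nat.succ_eq_add_one, Nat.add_sub_cancel]
    ring
  rw [h4]
  refine (norm_add_le _ _).trans ?_
  rw [norm_mul, norm_mul, norm_pow, hv, one_pow, mul_one, Complex.norm_natCast]
  have hk1 : (1:ℝ) ≤ k := by exact_mod_cast hk
  have h5 : ‖vStep b v - v‖ ^ 2 ≤ (4 * lam) ^ 2 := by gcongr
  have h6 : (k:ℝ) ^ 2 * ‖vStep b v - v‖ ^ 2 ≤ k ^ 2 * (4 * lam) ^ 2 := by gcongr
  have h7 : (k:ℝ) * ‖vStep b v - v - (conj b * v ^ 2 - b)‖ ≤ k * (4 * lam ^ 2) := by gcongr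
  have h8 : (k:ℝ) * lam ^ 2 ≤ k ^ 2 * lam ^ 2 := by
    apply mul_le_mul_of_nonneg_right _ (sq_nonneg _); nlinarith
  nlinarith

lemma norm_vSeq_sub_le {b : ℕ → ℂ} {lam : ℝ} (hb : ∀ n, ‖b n‖ ≤ lam) (hl : lam ≤ 1 / 2)
    {v₀ : ℂ} (hv : ‖v₀‖ = 1) (n : ℕ) : ‖vSeq b v₀ n - v₀‖ ≤ 4 * (n * lam) := by
  induction n with
  | zero => simp [vSeq]
  | succ n ih =>
    have h1 := norm_vStep_sub_le (hb n) hl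
      (norm_vSeq (fun n => (hb n).trans_lt (by linarith)) hv n)
    have h2 := norm_sub_le_norm_sub_add_norm_sub (vSeq b v₀ (n + 1)) (vSeq b v₀ n) v₀
    rw [vSeq] at h2 ⊢
    push_cast
    linarith

/-- The Möbius map stretches the circle by at most `(1 + |b|) / (1 - |b|)`. It matters that the
Lipschitz constant in `v` tends to `1` with `lam`: it has to stay below the expansion rate of the
dynamics. -/
lemma norm_vStep_sub_vStep_le {b b' v v' : ℂ} {lam : ℝ} (hb : ‖b‖ ≤ lam) (hb' : ‖b'‖ ≤ lam)
    (hl : lam ≤ 1 / 4) (hv : ‖v‖ = 1) (hv' : ‖v'‖ = 1) :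
    ‖vStep b v - vStep b' v'‖ ≤ (1 + 4 * lam) * ‖v - v'‖ + 8 * ‖b - b'‖ := by
  have h0 : 0 ≤ lam := (norm_nonneg _).trans hb
  have d1 := den_ne_zero (hb.trans_lt (by linarith)) hv
  have d2 := den_ne_zero (hb.trans_lt (by linarith)) hv'
  have d3 := den_ne_zero (hb'.trans_lt (by linarith)) hv'
  have n1 := le_norm_den (b := b) hv
  have n2 := le_norm_den (b := b) hv'
  have n3 := le_norm_den (b := b') hv'
  have e1 : vStep b v - vStep b v' =
      (v - v') * (1 - b * conj b) / ((1 - conj b * v) * (1 - conj b * v')) := by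
    rw [vStep, vStep, div_sub_div _ _ d1 d2]; ring
  have e2 : vStep b v' - vStep b' v' =
      ((b' - b) + v' ^ 2 * (conj b - conj b') +
        v' * (b * (conj b' - conj b) + (b - b') * conj b)) /
      ((1 - conj b * v') * (1 - conj b' * v')) := by
    rw [vStep, vStep, div_sub_div _ _ d2 d3]; ring
  have hbb : ‖b‖ < 1 := hb.trans_lt (by linarith)
  have f1 : ‖vStep b v - vStep b v'‖ ≤ (1 + 4 * lam) * ‖v - v'‖ := by
    rw [e1, norm_div, norm_mul, norm_mul]
    have g1 : ‖(1:ℂ) - b * conj b‖ = 1 - ‖b‖ ^ 2 := by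
      rw [Complex.mul_conj, Complex.normSq_eq_norm_sq, ← Complex.ofReal_one, ← Complex.ofReal_sub,
        Complex.norm_real, Real.norm_of_nonneg]
      nlinarith [norm_nonneg b]
    rw [g1]
    have g2 : (1 - ‖b‖) * (1 - ‖b‖) ≤ ‖1 - conj b * v‖ * ‖1 - conj b * v'‖ :=
      mul_le_mul n1 n2 (by linarith) (norm_nonneg _)
    rw [div_le_iff₀ (by nlinarith)]
    have g3 : 1 - ‖b‖ ^ 2 ≤ (1 + 4 * lam) * ((1 - ‖b‖) * (1 - ‖b‖)) := by
      have : 1 + ‖b‖ ≤ (1 + 4 * lam) * (1 - ‖b‖) := by nlinarith [norm_nonneg b]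
      nlinarith
    have g4 := mul_le_mul_of_nonneg_left g2 (show 0 ≤ 1 + 4 * lam by linarith)
    nlinarith [mul_le_mul_of_nonneg_left (g3.trans g4) (norm_nonneg (v - v'))]
  have f2 : ‖vStep b v' - vStep b' v'‖ ≤ 8 * ‖b - b'‖ := by
    have hc : ‖conj b - conj b'‖ = ‖b - b'‖ := by rw [← map_sub, RCLike.norm_conj]
    rw [e2, norm_div, norm_mul]
    have g2 : (3 / 4) * (3 / 4) ≤ ‖1 - conj b * v'‖ * ‖1 - conj b' * v'‖ :=
      mul_le_mul (by linarith) (by linarith) (by norm_num) (norm_nonneg _)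
    rw [div_le_iff₀ (by nlinarith)]
    have g3 : ‖(b' - b) + v' ^ 2 * (conj b - conj b') +
        v' * (b * (conj b' - conj b) + (b - b') * conj b)‖ ≤
        ‖b - b'‖ + ‖b - b'‖ + (lam * ‖b - b'‖ + ‖b - b'‖ * lam) := by
      refine (norm_add_le _ _).trans (add_le_add ((norm_add_le _ _).trans (add_le_add ?_ ?_)) ?_)
      · rw [norm_sub_rev]
      · rw [norm_mul, norm_pow, hv', hc]; simp
      · rw [norm_mul, hv', one_mul]
        refine (norm_add_le _ _).trans (add_le_add ?_ ?_)
        · rw [norm_mul, norm_sub_rev, hc]; gcongr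
        · rw [norm_mul, RCLike.norm_conj]; gcongr
    nlinarith [norm_nonneg (b - b'), mul_le_mul_of_nonneg_left g2 (norm_nonneg (b - b'))]
  have := norm_sub_le_norm_sub_add_norm_sub (vStep b v) (vStep b v') (vStep b' v')
  linarith

section window

variable {b : ℕ → ℂ} {lam : ℝ}

lemma norm_wS_le (hb : ∀ n, ‖b n‖ ≤ lam) (n : ℕ) : ‖wS b n‖ ≤ n * lam := by
  refine (norm_sum_le_of_le _ fun k _ => hb k).trans (le_of_eq (by simp))

lemma norm_wX_le (hb : ∀ n, ‖b n‖ ≤ lam) (n : ℕ) : ‖wX b n‖ ≤ (n * lam) ^ 2 := by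
  have h0 : 0 ≤ lam := (norm_nonneg _).trans (hb 0)
  have h : ∀ k ∈ Finset.range n, ‖b k * conj (wS b k)‖ ≤ lam * (n * lam) := fun k hk => by
    rw [norm_mul, RCLike.norm_conj]
    have : (k:ℝ) ≤ n := by exact_mod_cast (Finset.mem_range.1 hk).le
    exact mul_le_mul (hb k) ((norm_wS_le hb k).trans (by gcongr)) (norm_nonneg _) h0
  refine (norm_sum_le_of_le _ h).trans (le_of_eq ?_)
  simp; ring

lemma norm_wY_le (hb : ∀ n, ‖b n‖ ≤ lam) (n : ℕ) : ‖wY b n‖ ≤ (n * lam) ^ 3 := by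
  have h0 : 0 ≤ lam := (norm_nonneg _).trans (hb 0)
  have h : ∀ k ∈ Finset.range n, ‖b k * conj (wX b k)‖ ≤ lam * (n * lam) ^ 2 := fun k hk => by
    rw [norm_mul, RCLike.norm_conj]
    have : (k:ℝ) ≤ n := by exact_mod_cast (Finset.mem_range.1 hk).le
    exact mul_le_mul (hb k) ((norm_wX_le hb k).trans (by gcongr)) (norm_nonneg _) h0
  rw [wY, norm_neg]
  refine (norm_sum_le_of_le _ h).trans (le_of_eq ?_)
  simp; ring

lemma xy_approx (hb : ∀ n, ‖b n‖ ≤ lam) (n : ℕ) (hn : n * lam ≤ 1) :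
    ‖(xy b n).1 - (1 + wX b n)‖ ≤ (n * lam) ^ 4 ∧
    ‖(xy b n).2 - (-wS b n + wY b n)‖ ≤ (n * lam) ^ 4 := by
  have h0 : 0 ≤ lam := (norm_nonneg _).trans (hb 0)
  induction n with
  | zero => simp [xy, wX, wS, wY]
  | succ n ih =>
    push_cast at hn ⊢
    obtain ⟨i1, i2⟩ := ih (by nlinarith)
    have hY := norm_wY_le hb n
    set θ := n * lam with hθ
    have hθ0 : 0 ≤ θ := by positivity
    have hθ1 : θ ≤ 1 := by nlinarith
    have e : ((n:ℝ) + 1) * lam = θ + lam := by rw [hθ]; ring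
    rw [e]
    have p4 : θ ^ 4 ≤ θ ^ 3 := pow_le_pow_of_le_one hθ0 hθ1 (by norm_num)
    have p5 : lam * θ ^ 4 ≤ lam * θ ^ 3 := mul_le_mul_of_nonneg_left p4 h0
    -- Each step adds at most `lam (θ^4 + θ^3) ≤ 2 lam θ^3` to the error, which the growth of the
    -- fourth power covers.
    have q : θ ^ 4 + 4 * (lam * θ ^ 3) ≤ (θ + lam) ^ 4 := by
      have : (θ + lam) ^ 4 = θ ^ 4 + 4 * (lam * θ ^ 3) +
        (6 * θ ^ 2 * lam ^ 2 + 4 * θ * lam ^ 3 + lam ^ 4) := by ring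
      rw [this]; linarith [show 0 ≤ 6 * θ ^ 2 * lam ^ 2 + 4 * θ * lam ^ 3 + lam ^ 4 by positivity]
    have p6 : 0 ≤ lam * θ ^ 3 := by positivity
    constructor
    · have : (xy b (n + 1)).1 - (1 + wX b (n + 1)) = ((xy b n).1 - (1 + wX b n)) -
          b n * conj (((xy b n).2 - (-wS b n + wY b n)) + wY b n) := by
        simp only [xy, wX, Finset.sum_range_succ, map_add, map_sub, map_neg]; ring
      rw [this]
      refine (norm_sub_le _ _).trans ?_
      rw [norm_mul, RCLike.norm_conj]
      have := mul_le_mul (hb n) ((norm_add_le ((xy b n).2 - (-wS b n + wY b n)) (wY b n)).trans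
        (add_le_add i2 hY)) (norm_nonneg _) h0
      nlinarith
    · have : (xy b (n + 1)).2 - (-wS b (n + 1) + wY b (n + 1)) =
          ((xy b n).2 - (-wS b n + wY b n)) - b n * conj ((xy b n).1 - (1 + wX b n)) := by
        simp only [xy, wS, wY, Finset.sum_range_succ, map_add, map_sub, map_one]; ring
      rw [this]
      refine (norm_sub_le _ _).trans ?_
      rw [norm_mul, RCLike.norm_conj]
      have := mul_le_mul (hb n) i1 (norm_nonneg _) h0
      nlinarith

/-- The denominator of the window Möbius map at `v₀`. -/
noncomputable def den (b : ℕ → ℂ) (v₀ : ℂ) (n : ℕ) : ℂ :=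
  conj (xy b n).1 + conj (xy b n).2 * v₀

lemma conj_den {v₀ : ℂ} (hv : ‖v₀‖ = 1) (n : ℕ) :
    v₀ * conj (den b v₀ n) = (xy b n).1 * v₀ + (xy b n).2 := by
  simp only [den, map_add, map_mul, Complex.conj_conj]
  linear_combination (xy b n).2 * conj_eq_inv hv

/-- The composed Möbius map sends `v₀` to `v₀ * conj den / den`, and its denominators multiply along
the orbit. Hence the logarithms telescope in `sum_log_den`. -/
lemma den_spec (hb : ∀ n, ‖b n‖ < 1) {v₀ : ℂ} (hv : ‖v₀‖ = 1) (n : ℕ) :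
    den b v₀ n ≠ 0 ∧ vSeq b v₀ n * den b v₀ n = v₀ * conj (den b v₀ n) ∧
    den b v₀ (n + 1) = den b v₀ n * (1 - conj (b n) * vSeq b v₀ n) := by
  have step : ∀ m, vSeq b v₀ m * den b v₀ m = v₀ * conj (den b v₀ m) →
      den b v₀ (m + 1) = den b v₀ m * (1 - conj (b m) * vSeq b v₀ m) := by
    intro m h
    have h2 : den b v₀ (m + 1) = den b v₀ m - conj (b m) * (v₀ * conj (den b v₀ m)) := by
      rw [conj_den hv]
      simp only [den, xy, map_sub, map_mul, Complex.conj_conj]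
      ring
    rw [h2, ← h]; ring
  suffices h : den b v₀ n ≠ 0 ∧ vSeq b v₀ n * den b v₀ n = v₀ * conj (den b v₀ n) from
    ⟨h.1, h.2, step n h.2⟩
  induction n with
  | zero => simp [den, xy, vSeq]
  | succ n ih =>
    have h1 := step n ih.2
    have h3 := den_ne_zero (hb n) (norm_vSeq hb hv n)
    refine ⟨by rw [h1]; exact mul_ne_zero ih.1 h3, ?_⟩
    have h2 : v₀ * conj (den b v₀ (n + 1)) = (v₀ * conj (den b v₀ n)) - b n * den b v₀ n := by
      rw [conj_den hv, conj_den hv]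
      simp only [den, xy]
      ring
    rw [h2, ← ih.2, h1, vSeq, vStep, div_mul_eq_mul_div, div_eq_iff h3]
    ring

lemma sum_log_den (hb : ∀ n, ‖b n‖ < 1) {v₀ : ℂ} (hv : ‖v₀‖ = 1) (n : ℕ) :
    ∑ k ∈ Finset.range n, Real.log (‖1 - conj (b k) * vSeq b v₀ k‖ ^ 2) =
      Real.log (‖den b v₀ n‖ ^ 2) := by
  induction n with
  | zero => simp [den, xy]
  | succ n ih =>
    rw [Finset.sum_range_succ, ih, (den_spec hb hv n).2.2, norm_mul, mul_pow, Real.log_mul]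
    · exact pow_ne_zero _ (norm_ne_zero_iff.2 (den_spec hb hv n).1)
    · exact pow_ne_zero _ (norm_ne_zero_iff.2 (den_ne_zero (hb n) (norm_vSeq hb hv n)))

/-- Expanding the square, the off-diagonal pairs give `2 Re wX`. Thus the two second order
contributions to the growth that are free of `v` combine into `|wS|²`, whose mean produces the
spectral density. -/
lemma norm_wS_sq (b : ℕ → ℂ) (n : ℕ) :
    ‖wS b n‖ ^ 2 = 2 * (wX b n).re + ∑ k ∈ Finset.range n, ‖b k‖ ^ 2 := by
  induction n with
  | zero => simp [wS, wX]
  | succ n ih =>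
    have h1 : wS b (n + 1) = wS b n + b n := Finset.sum_range_succ _ _
    have h2 : wX b (n + 1) = wX b n + b n * conj (wS b n) := Finset.sum_range_succ _ _
    rw [h1, h2, Finset.sum_range_succ, ← Complex.normSq_eq_norm_sq, Complex.normSq_add,
      Complex.normSq_eq_norm_sq, Complex.normSq_eq_norm_sq, ih, Complex.add_re]
    have h3 : (wS b n * conj (b n)).re = (b n * conj (wS b n)).re := by
      rw [← Complex.conj_re]; simp [mul_comm]
    rw [h3]; ring

lemma abs_neg_log_sub_le {t : ℝ} (h1 : t ≤ 1 / 2) :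
    |-Real.log (1 - t) - t| ≤ 2 * t ^ 2 := by
  have h2 : 0 < 1 - t := by linarith
  have h3 := Real.log_le_sub_one_of_pos h2
  have h4 := Real.log_le_sub_one_of_pos (inv_pos.2 h2)
  rw [Real.log_inv] at h4
  have h5 : (1 - t)⁻¹ ≤ 1 + t + 2 * t ^ 2 := by
    rw [inv_le_iff_one_le_mul₀ h2]; nlinarith [mul_nonneg (sq_nonneg t) (sub_nonneg.2 h1)]
  rw [abs_le]; constructor <;> nlinarith [sq_nonneg t]

lemma log_norm_approx {w : ℂ} (hw : ‖w‖ ≤ 1 / 2) :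
    |Real.log ‖1 + w‖ - (w - w ^ 2 / 2 + w ^ 3 / 3).re| ≤ ‖w‖ ^ 4 := by
  have h := Complex.norm_log_sub_logTaylor_le 3 (z := w) (by linarith)
  have h1 : Complex.logTaylor (3 + 1) w = w - w ^ 2 / 2 + w ^ 3 / 3 := by
    simp [Complex.logTaylor, Finset.sum_range_succ]; ring
  rw [h1] at h
  have h2 : Real.log ‖1 + w‖ = (Complex.log (1 + w)).re := (Complex.log_re _).symm
  rw [h2, ← Complex.sub_re]
  refine (Complex.abs_re_le_norm _).trans (h.trans ?_)
  have h3 : (1 - ‖w‖)⁻¹ ≤ 2 := by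
    rw [inv_le_comm₀ (by linarith) (by norm_num)]; linarith
  have : 0 ≤ ‖w‖ ^ 4 := by positivity
  norm_num
  nlinarith [mul_le_mul_of_nonneg_left h3 this]

end window

end Szego

namespace Szego

open ComplexConjugate

/-- Third order truncation of `log (1 + a + c + d)` with `a`, `c`, `d` of orders `1`, `2`, `3`. -/
lemma log_poly_approx {a c d e : ℂ} {θ : ℝ} (hθ : 0 ≤ θ) (hθ1 : θ ≤ 1 / 8) (ha : ‖a‖ ≤ θ)
    (hc : ‖c‖ ≤ θ ^ 2) (hd : ‖d‖ ≤ θ ^ 3) (he : ‖e - (a + c + d)‖ ≤ 2 * θ ^ 4) :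
    |Real.log ‖1 + e‖ - (a + c + d - a ^ 2 / 2 - a * c + a ^ 3 / 3).re| ≤ 50 * θ ^ 4 := by
  have t2 : θ ^ 2 ≤ θ / 8 := by nlinarith
  have t3 : θ ^ 3 ≤ θ / 64 := by nlinarith
  have t4 : θ ^ 4 ≤ θ / 512 := by nlinarith
  set w := a + c + d with hw
  have hwn : ‖w‖ ≤ 2 * θ := by
    have := norm_add₃_le (a := a) (b := c) (c := d); linarith
  have hen : ‖e‖ ≤ 2 * θ + 2 * θ ^ 4 := by
    have := norm_add_le w (e - w); rw [add_sub_cancel] at this; linarith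
  have hen2 : ‖e‖ ≤ 9 / 4 * θ := by linarith
  have h1 := log_norm_approx (w := e) (by linarith)
  have h1' : ‖e‖ ^ 4 ≤ (9 / 4 * θ) ^ 4 := by gcongr
  have h2 : ‖(e - e ^ 2 / 2 + e ^ 3 / 3) - (a + c + d - a ^ 2 / 2 - a * c + a ^ 3 / 3)‖ ≤
      24 * θ ^ 4 := by
    have e1 : (e - e ^ 2 / 2 + e ^ 3 / 3) - (a + c + d - a ^ 2 / 2 - a * c + a ^ 3 / 3) =
        (e - w) * (1 - (e + w) / 2 + (e ^ 2 + e * w + w ^ 2) / 3)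
        - (c * c + 2 * a * d + 2 * c * d + d * d) / 2
        + (3 * a * a * (c + d) + 3 * a * ((c + d) * (c + d)) + (c + d) * (c + d) * (c + d)) / 3 := by
      rw [hw]; ring
    have e2 : ‖1 - (e + w) / 2 + (e ^ 2 + e * w + w ^ 2) / 3‖ ≤ 2 := by
      have g : ‖1 - (e + w) / 2 + (e ^ 2 + e * w + w ^ 2) / 3‖ ≤
          1 + (‖e‖ + ‖w‖) / 2 + (‖e‖ ^ 2 + ‖e‖ * ‖w‖ + ‖w‖ ^ 2) / 3 := by
        refine (norm_add_le _ _).trans (add_le_add ((norm_sub_le _ _).trans (add_le_add ?_ ?_)) ?_)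
        · simp
        · rw [norm_div]; norm_num; have := norm_add_le e w; linarith
        · rw [norm_div]; norm_num
          have := norm_add₃_le (a := e ^ 2) (b := e * w) (c := w ^ 2)
          simp only [norm_mul, norm_pow] at this; linarith
      have e3 : ‖e‖ ≤ 1 / 2 := by linarith
      have e4 : ‖w‖ ≤ 1 / 2 := by linarith
      nlinarith [norm_nonneg e, norm_nonneg w]
    have hcd : ‖c + d‖ ≤ 2 * θ ^ 2 := by
      have := norm_add_le c d
      nlinarith
    have f1 : ‖(e - w) * (1 - (e + w) / 2 + (e ^ 2 + e * w + w ^ 2) / 3)‖ ≤ 2 * θ ^ 4 * 2 := by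
      rw [norm_mul]; exact mul_le_mul he e2 (norm_nonneg _) (by positivity)
    have f2 : ‖(c * c + 2 * a * d + 2 * c * d + d * d) / 2‖ ≤ 6 * θ ^ 4 := by
      rw [norm_div]; norm_num
      have g1 : ‖c * c‖ ≤ θ ^ 2 * θ ^ 2 := by rw [norm_mul]; gcongr
      have g2 : ‖2 * a * d‖ ≤ 2 * θ * θ ^ 3 := by rw [norm_mul, norm_mul]; norm_num; gcongr
      have g3 : ‖2 * c * d‖ ≤ 2 * θ ^ 2 * θ ^ 3 := by rw [norm_mul, norm_mul]; norm_num; gcongr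
      have g4 : ‖d * d‖ ≤ θ ^ 3 * θ ^ 3 := by rw [norm_mul]; gcongr
      have g5 := norm_add_le (c * c + 2 * a * d + 2 * c * d) (d * d)
      have g6 := norm_add₃_le (a := c * c) (b := 2 * a * d) (c := 2 * c * d)
      have g7 : θ ^ 5 ≤ θ ^ 4 := pow_le_pow_of_le_one hθ (by linarith) (by norm_num)
      have g8 : θ ^ 6 ≤ θ ^ 4 := pow_le_pow_of_le_one hθ (by linarith) (by norm_num)
      nlinarith
    have f3 : ‖(3 * a * a * (c + d) + 3 * a * ((c + d) * (c + d)) +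
        (c + d) * (c + d) * (c + d)) / 3‖ ≤ 10 * θ ^ 4 := by
      rw [norm_div]; norm_num
      have g1 : ‖3 * a * a * (c + d)‖ ≤ 3 * θ * θ * (2 * θ ^ 2) := by
        rw [norm_mul, norm_mul, norm_mul]; norm_num; gcongr
      have g2 : ‖3 * a * ((c + d) * (c + d))‖ ≤ 3 * θ * (2 * θ ^ 2 * (2 * θ ^ 2)) := by
        rw [norm_mul, norm_mul, norm_mul]; norm_num; gcongr
      have g3 : ‖(c + d) * (c + d) * (c + d)‖ ≤ 2 * θ ^ 2 * (2 * θ ^ 2) * (2 * θ ^ 2) := by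
        rw [norm_mul, norm_mul]; gcongr
      have g6 := norm_add₃_le (a := 3 * a * a * (c + d)) (b := 3 * a * ((c + d) * (c + d)))
        (c := (c + d) * (c + d) * (c + d))
      have g7 : θ ^ 5 ≤ θ ^ 4 := pow_le_pow_of_le_one hθ (by linarith) (by norm_num)
      have g8 : θ ^ 6 ≤ θ ^ 4 := pow_le_pow_of_le_one hθ (by linarith) (by norm_num)
      nlinarith
    rw [e1]
    have f4 := norm_add_le ((e - w) * (1 - (e + w) / 2 + (e ^ 2 + e * w + w ^ 2) / 3)
        - (c * c + 2 * a * d + 2 * c * d + d * d) / 2) ((3 * a * a * (c + d) +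
        3 * a * ((c + d) * (c + d)) + (c + d) * (c + d) * (c + d)) / 3)
    have f5 := norm_sub_le ((e - w) * (1 - (e + w) / 2 + (e ^ 2 + e * w + w ^ 2) / 3))
      ((c * c + 2 * a * d + 2 * c * d + d * d) / 2)
    nlinarith [pow_nonneg hθ 4]
  have h3 := Complex.abs_re_le_norm
    ((e - e ^ 2 / 2 + e ^ 3 / 3) - (a + c + d - a ^ 2 / 2 - a * c + a ^ 3 / 3))
  rw [Complex.sub_re] at h3
  have h4 := abs_sub_le (Real.log ‖1 + e‖) (e - e ^ 2 / 2 + e ^ 3 / 3).re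
    (a + c + d - a ^ 2 / 2 - a * c + a ^ 3 / 3).re
  have h5 : (9 / 4 * θ) ^ 4 ≤ 26 * θ ^ 4 := by
    rw [mul_pow]; exact mul_le_mul_of_nonneg_right (by norm_num) (by positivity)
  linarith

variable {b : ℕ → ℂ} {lam : ℝ}

lemma den_approx (hb : ∀ n, ‖b n‖ ≤ lam) {v₀ : ℂ} (hv : ‖v₀‖ = 1) (n : ℕ) (hn : n * lam ≤ 1) :
    ‖(den b v₀ n - 1) - (-(conj (wS b n) * v₀) + conj (wX b n) + conj (wY b n) * v₀)‖ ≤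
      2 * (n * lam) ^ 4 := by
  obtain ⟨h1, h2⟩ := xy_approx hb n hn
  have : (den b v₀ n - 1) - (-(conj (wS b n) * v₀) + conj (wX b n) + conj (wY b n) * v₀) =
      conj ((xy b n).1 - (1 + wX b n)) + conj ((xy b n).2 - (-wS b n + wY b n)) * v₀ := by
    simp only [den, map_sub, map_add, map_neg, map_one]; ring
  rw [this]
  refine (norm_add_le _ _).trans ?_
  rw [norm_mul, RCLike.norm_conj, RCLike.norm_conj, hv]
  linarith

/-- Third order expansion of the growth over a window. -/
noncomputable def growthPoly (b : ℕ → ℂ) (v : ℂ) (n : ℕ) : ℂ :=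
  -2 * (conj (wS b n) * v) + wS b n * conj (wS b n) - conj (wS b n) ^ 2 * v ^ 2 +
    2 * (wτ b n * v) - 2 / 3 * (conj (wS b n) ^ 3 * v ^ 3)

/-- The growth equals `2 log |den| - ∑ log (1 - |b_k|²)`. The first part is expanded by
`log_poly_approx`, the second is `∑ |b_k|²` up to fourth order, and `norm_wS_sq` merges the latter
with `2 Re wX`. -/
lemma sum_xi_approx (hb : ∀ n, ‖b n‖ ≤ lam) {v₀ : ℂ} (hv : ‖v₀‖ = 1) (n : ℕ)
    (hn : n * lam ≤ 1 / 8) (hl : lam ≤ 1 / 4) :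
    |∑ k ∈ Finset.range n, xi (b k) (vSeq b v₀ k) - (growthPoly b v₀ n).re| ≤
      102 * (n * lam) ^ 4 := by
  have h0 : 0 ≤ lam := (norm_nonneg _).trans (hb 0)
  have hb1 : ∀ n, ‖b n‖ < 1 := fun n => (hb n).trans_lt (by linarith)
  have h1 : |∑ k ∈ Finset.range n, -Real.log (1 - ‖b k‖ ^ 2) - ∑ k ∈ Finset.range n, ‖b k‖ ^ 2| ≤
      2 * (n * lam) ^ 4 := by
    rw [← Finset.sum_sub_distrib]
    have hk : ∀ k ∈ Finset.range n, |-Real.log (1 - ‖b k‖ ^ 2) - ‖b k‖ ^ 2| ≤ 2 * lam ^ 4 := by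
      intro k _
      have h2 : ‖b k‖ ^ 2 ≤ lam ^ 2 := by gcongr; exact hb k
      refine (abs_neg_log_sub_le (by nlinarith)).trans ?_
      have : (‖b k‖ ^ 2) ^ 2 ≤ (lam ^ 2) ^ 2 := by gcongr
      nlinarith
    refine (Finset.abs_sum_le_sum_abs _ _).trans ((Finset.sum_le_sum hk).trans ?_)
    simp only [Finset.sum_const, Finset.card_range, nsmul_eq_mul]
    rcases Nat.eq_zero_or_pos n with rfl | hpos
    · simp
    have : (n:ℝ) ≤ (n:ℝ) ^ 4 := by
      have : (1:ℝ) ≤ n := by exact_mod_cast hpos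
      exact le_self_pow₀ this (by norm_num)
    rw [mul_pow]
    nlinarith [pow_nonneg h0 4]
  have h2 : ∑ k ∈ Finset.range n, xi (b k) (vSeq b v₀ k) =
      2 * Real.log ‖den b v₀ n‖ + ∑ k ∈ Finset.range n, -Real.log (1 - ‖b k‖ ^ 2) := by
    have := sum_log_den hb1 hv n
    rw [Real.log_pow] at this
    simp only [xi, Finset.sum_sub_distrib, Finset.sum_neg_distrib]
    rw [this]
    push_cast; ring
  have h3 := log_poly_approx (a := -(conj (wS b n) * v₀)) (c := conj (wX b n))
    (d := conj (wY b n) * v₀) (e := den b v₀ n - 1) (θ := n * lam) (by positivity) hn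
    (by rw [norm_neg, norm_mul, hv, RCLike.norm_conj, mul_one]; exact norm_wS_le hb n)
    (by rw [RCLike.norm_conj]; exact norm_wX_le hb n)
    (by rw [norm_mul, hv, RCLike.norm_conj, mul_one]; exact norm_wY_le hb n)
    (den_approx hb hv n (by linarith))
  rw [add_sub_cancel] at h3
  have h4 : (growthPoly b v₀ n).re = 2 * (-(conj (wS b n) * v₀) + conj (wX b n) +
      conj (wY b n) * v₀ - (-(conj (wS b n) * v₀)) ^ 2 / 2 -
      -(conj (wS b n) * v₀) * conj (wX b n) + (-(conj (wS b n) * v₀)) ^ 3 / 3).re +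
      ∑ k ∈ Finset.range n, ‖b k‖ ^ 2 := by
    have h5 : ((wS b n * conj (wS b n) : ℂ)).re = 2 * (conj (wX b n)).re +
        ∑ k ∈ Finset.range n, ‖b k‖ ^ 2 := by
      rw [Complex.conj_re, ← norm_wS_sq, Complex.mul_conj, Complex.normSq_eq_norm_sq,
        Complex.ofReal_re]
    have h6 : growthPoly b v₀ n = 2 * (-(conj (wS b n) * v₀) + conj (wX b n) +
      conj (wY b n) * v₀ - (-(conj (wS b n) * v₀)) ^ 2 / 2 -
      -(conj (wS b n) * v₀) * conj (wX b n) + (-(conj (wS b n) * v₀)) ^ 3 / 3) +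
      (wS b n * conj (wS b n) - 2 * conj (wX b n)) := by
      simp only [growthPoly, wτ]; ring
    have re2 : ∀ w : ℂ, (2 * w).re = 2 * w.re := fun w => by simp
    rw [h6, Complex.add_re, Complex.sub_re, h5, re2, re2]; ring
  rw [h2, h4]
  rw [abs_le] at *
  constructor <;> linarith [h1.1, h1.2, h3.1, h3.2]

/-- Second order truncation of `((1 + e) / (1 + f)) ^ 3`. -/
def cubePoly (e f : ℂ) : ℂ := 1 + 3 * e + 3 * e ^ 2 - 3 * f + 6 * f ^ 2 - 9 * (e * f)

lemma cube_approx {e f : ℂ} {t : ℝ} (he : ‖e‖ ≤ t) (hf : ‖f‖ ≤ t) (ht : t ≤ 1 / 4) :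
    ‖(1 + e) ^ 3 / (1 + f) ^ 3 - cubePoly e f‖ ≤ 400 * t ^ 3 := by
  have t0 : 0 ≤ t := (norm_nonneg _).trans he
  have hf1 : 3 / 4 ≤ ‖1 + f‖ := by
    have := norm_sub_norm_le (1:ℂ) (-f)
    rw [sub_neg_eq_add, norm_neg, norm_one] at this
    linarith
  have hne : 1 + f ≠ 0 := by
    intro h; rw [h, norm_zero] at hf1; linarith
  have key : (1 + e) ^ 3 / (1 + f) ^ 3 - cubePoly e f =
      (e * e * e - (3 * f * (3 * e ^ 2 + 6 * f ^ 2 - 9 * (e * f)) +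
        3 * f * f * (3 * e - 3 * f + 3 * e ^ 2 + 6 * f ^ 2 - 9 * (e * f)) +
        f * f * f * cubePoly e f)) / (1 + f) ^ 3 := by
    rw [eq_div_iff (pow_ne_zero 3 hne), sub_mul, div_mul_cancel₀ _ (pow_ne_zero 3 hne)]
    simp only [cubePoly]; ring
  have a1 : ‖3 * e ^ 2 + 6 * f ^ 2 - 9 * (e * f)‖ ≤ 18 * t ^ 2 := by
    have g := norm_sub_le (3 * e ^ 2 + 6 * f ^ 2) (9 * (e * f))
    have g' := norm_add_le (3 * e ^ 2) (6 * f ^ 2)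
    simp only [norm_mul, norm_pow] at g g'
    norm_num at g g'
    nlinarith [pow_le_pow_left₀ (norm_nonneg e) he 2, pow_le_pow_left₀ (norm_nonneg f) hf 2,
      mul_le_mul he hf (norm_nonneg _) t0]
  have a2 : ‖3 * e - 3 * f + 3 * e ^ 2 + 6 * f ^ 2 - 9 * (e * f)‖ ≤ 11 * t := by
    have e1 : 3 * e - 3 * f + 3 * e ^ 2 + 6 * f ^ 2 - 9 * (e * f) =
      (3 * e - 3 * f) + (3 * e ^ 2 + 6 * f ^ 2 - 9 * (e * f)) := by ring
    rw [e1]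
    have g := norm_add_le (3 * e - 3 * f) (3 * e ^ 2 + 6 * f ^ 2 - 9 * (e * f))
    have g' := norm_sub_le (3 * e) (3 * f)
    simp only [norm_mul] at g'
    norm_num at g'
    nlinarith
  have a3 : ‖cubePoly e f‖ ≤ 4 := by
    have e1 : cubePoly e f = 1 + (3 * e - 3 * f + 3 * e ^ 2 + 6 * f ^ 2 - 9 * (e * f)) := by
      simp only [cubePoly]; ring
    rw [e1]
    have g := norm_add_le (1:ℂ) (3 * e - 3 * f + 3 * e ^ 2 + 6 * f ^ 2 - 9 * (e * f))
    rw [norm_one] at g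
    linarith
  rw [key, norm_div, norm_pow]
  have d3 : (3 / 4 : ℝ) ^ 3 ≤ ‖1 + f‖ ^ 3 := by gcongr
  rw [div_le_iff₀ (by positivity)]
  have b1 : ‖e * e * e‖ ≤ t * t * t := by rw [norm_mul, norm_mul]; gcongr
  have b2 : ‖3 * f * (3 * e ^ 2 + 6 * f ^ 2 - 9 * (e * f))‖ ≤ 3 * t * (18 * t ^ 2) := by
    rw [norm_mul, norm_mul]; norm_num; gcongr
  have b3 : ‖3 * f * f * (3 * e - 3 * f + 3 * e ^ 2 + 6 * f ^ 2 - 9 * (e * f))‖ ≤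
      3 * t * t * (11 * t) := by
    rw [norm_mul, norm_mul, norm_mul]; norm_num; gcongr
  have b4 : ‖f * f * f * cubePoly e f‖ ≤ t * t * t * 4 := by
    rw [norm_mul, norm_mul, norm_mul]; gcongr
  refine (norm_sub_le _ _).trans ?_
  have b5 := norm_add₃_le (a := 3 * f * (3 * e ^ 2 + 6 * f ^ 2 - 9 * (e * f)))
    (b := 3 * f * f * (3 * e - 3 * f + 3 * e ^ 2 + 6 * f ^ 2 - 9 * (e * f)))
    (c := f * f * f * cubePoly e f)
  have t3 : 0 ≤ t ^ 3 := by positivity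
  nlinarith

/-- Second order expansion of the cube of the Möbius action over a window. -/
noncomputable def cubeWin (b : ℕ → ℂ) (v : ℂ) (n : ℕ) : ℂ :=
  v ^ 3 + 3 * (conj (wS b n) * v ^ 4) - 3 * (wS b n * v ^ 2) + 6 * (conj (wS b n) ^ 2 * v ^ 5) +
    3 * (wS b n ^ 2 * v) - 9 * (wS b n * conj (wS b n) * v ^ 3) +
    3 * ((wX b n - conj (wX b n)) * v ^ 3)

/-- With `den = 1 + f` the cube is `v₀³ ((1 + conj f) / (1 + f))³`; second order in `f` suffices. -/
lemma vSeq_cube_approx (hb : ∀ n, ‖b n‖ ≤ lam) {v₀ : ℂ} (hv : ‖v₀‖ = 1) (n : ℕ)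
    (hn : n * lam ≤ 1 / 16) (hl : lam ≤ 1 / 4) :
    ‖vSeq b v₀ n ^ 3 - cubeWin b v₀ n‖ ≤ 20000 * (n * lam) ^ 3 := by
  have h0 : 0 ≤ lam := (norm_nonneg _).trans (hb 0)
  have hb1 : ∀ n, ‖b n‖ < 1 := fun n => (hb n).trans_lt (by linarith)
  have hS := norm_wS_le hb n
  have hX := norm_wX_le hb n
  have hY := norm_wY_le hb n
  have hd := den_approx hb hv n (by linarith)
  obtain ⟨hne, hvd, -⟩ := den_spec hb1 hv n
  set θ := n * lam with hθ
  have hθ0 : 0 ≤ θ := by positivity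
  set f := den b v₀ n - 1 with hf
  have hden : den b v₀ n = 1 + f := by rw [hf]; ring
  -- The part of `f` of degree at most two in `b`; `cubeWin` comes from it by dropping terms of
  -- degree at least three.
  set f₀ := -(conj (wS b n) * v₀) + conj (wX b n) with hf₀
  have hv1 : v₀ * conj v₀ = 1 := by rw [mul_comm]; exact conj_eq_inv hv
  have p3 : θ ^ 3 ≤ θ / 256 := by nlinarith
  have p2 : θ ^ 2 ≤ θ / 16 := by nlinarith
  have p4 : θ ^ 4 ≤ θ ^ 3 / 16 := by nlinarith [pow_nonneg hθ0 3]
  have hff : ‖f - f₀‖ ≤ 2 * θ ^ 3 := by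
    have e1 : f - f₀ = (f - (f₀ + conj (wY b n) * v₀)) + conj (wY b n) * v₀ := by ring
    have := norm_add_le (f - (f₀ + conj (wY b n) * v₀)) (conj (wY b n) * v₀)
    rw [← e1, norm_mul, hv, RCLike.norm_conj, mul_one] at this
    linarith [pow_nonneg hθ0 3]
  have hf0n : ‖f₀‖ ≤ θ + θ ^ 2 := by
    have := norm_add_le (-(conj (wS b n) * v₀)) (conj (wX b n))
    rw [norm_neg, norm_mul, hv, RCLike.norm_conj, RCLike.norm_conj, mul_one] at this
    rw [hf₀]; linarith
  have hf0n' : ‖f₀‖ ≤ 2 * θ := by linarith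
  have hfn : ‖f‖ ≤ 2 * θ := by
    have := norm_add_le (f - f₀) f₀
    rw [sub_add_cancel] at this
    linarith
  have hmain := cube_approx (e := conj f) (f := f) (t := 2 * θ) (by rwa [RCLike.norm_conj]) hfn
    (by linarith)
  have hv3 : vSeq b v₀ n ^ 3 = v₀ ^ 3 * ((1 + conj f) ^ 3 / (1 + f) ^ 3) := by
    have h5 : vSeq b v₀ n = v₀ * (1 + conj f) / (1 + f) := by
      rw [← hden, eq_div_iff hne, hvd, hden]; simp
    rw [h5, div_pow, mul_pow, mul_div_assoc]
  have hdiff : ‖cubePoly (conj f) f - cubePoly (conj f₀) f₀‖ ≤ 10 * (2 * θ ^ 3) := by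
    have e1 : cubePoly (conj f) f - cubePoly (conj f₀) f₀ =
        conj (f - f₀) * (3 + 3 * (conj f + conj f₀) - 9 * f) +
        (f - f₀) * (-3 + 6 * (f + f₀) - 9 * conj f₀) := by
      simp only [cubePoly, map_sub]; ring
    rw [e1]
    have g1 : ‖3 + 3 * (conj f + conj f₀) - 9 * f‖ ≤ 5 := by
      have a := norm_sub_le (3 + 3 * (conj f + conj f₀)) (9 * f)
      have a' := norm_add_le 3 (3 * (conj f + conj f₀))
      have a'' := norm_add_le (conj f) (conj f₀)
      simp only [norm_mul, RCLike.norm_conj] at a a' a''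
      norm_num at a a'
      linarith
    have g2 : ‖-3 + 6 * (f + f₀) - 9 * conj f₀‖ ≤ 5 + 1 := by
      have a := norm_sub_le (-3 + 6 * (f + f₀)) (9 * conj f₀)
      have a' := norm_add_le (-3) (6 * (f + f₀))
      have a'' := norm_add_le f f₀
      simp only [norm_mul, RCLike.norm_conj] at a a' a''
      norm_num at a a'
      linarith
    have g3 : ‖-3 + 6 * (f + f₀) - 9 * conj f₀‖ ≤ 5 := by
      have a := norm_sub_le (-3 + 6 * (f + f₀)) (9 * conj f₀)
      have a' := norm_add_le (-3) (6 * (f + f₀))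
      have a'' := norm_add_le f f₀
      simp only [norm_mul, RCLike.norm_conj] at a a' a''
      norm_num at a a'
      linarith
    refine (norm_add_le _ _).trans ?_
    rw [norm_mul, norm_mul, RCLike.norm_conj]
    nlinarith [norm_nonneg (f - f₀)]
  have hwin : ‖v₀ ^ 3 * cubePoly (conj f₀) f₀ - cubeWin b v₀ n‖ ≤ 60 * θ ^ 3 := by
    have e1 : v₀ ^ 3 * cubePoly (conj f₀) f₀ - cubeWin b v₀ n =
        v₀ ^ 3 * (3 * (wX b n * wX b n) + 6 * (conj (wX b n) * conj (wX b n)) -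
          9 * (wX b n * conj (wX b n))) + v₀ ^ 2 * (-6 * (wS b n * wX b n)) +
          v₀ ^ 4 * (-12 * (conj (wS b n) * conj (wX b n))) +
          (9 * v₀ ^ 2 * (wS b n * conj (wX b n)) + 9 * v₀ ^ 4 * (conj (wS b n) * wX b n)) := by
      have q1 : v₀ ^ 3 * conj v₀ = v₀ ^ 2 := by linear_combination v₀ ^ 2 * hv1
      have q2 : v₀ ^ 3 * conj v₀ ^ 2 = v₀ := by
        linear_combination (v₀ ^ 2 * conj v₀ + v₀) * hv1
      have q3 : v₀ ^ 4 * conj v₀ = v₀ ^ 3 := by linear_combination v₀ ^ 3 * hv1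
      simp only [cubePoly, cubeWin, hf₀, map_add, map_neg, map_mul, Complex.conj_conj]
      linear_combination (-3 * wS b n - 6 * wS b n * wX b n + 9 * wS b n * conj (wX b n)) * q1 +
        3 * wS b n ^ 2 * q2 - 9 * wS b n * conj (wS b n) * q3
    have g1 : ‖wX b n * wX b n‖ ≤ θ ^ 3 := by
      rw [norm_mul]; nlinarith [mul_le_mul hX hX (norm_nonneg _) (sq_nonneg θ), pow_nonneg hθ0 3]
    have g2 : ‖wX b n‖ * ‖wX b n‖ ≤ θ ^ 3 := by rwa [norm_mul] at g1
    have g3 : ‖wS b n‖ * ‖wX b n‖ ≤ θ ^ 3 := by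
      nlinarith [mul_le_mul hS hX (norm_nonneg _) hθ0]
    rw [e1]
    refine (norm_add_le _ _).trans ((add_le_add (norm_add₃_le) (norm_add_le _ _)).trans ?_)
    have g4 := norm_sub_le (3 * (wX b n * wX b n) + 6 * (conj (wX b n) * conj (wX b n)))
      (9 * (wX b n * conj (wX b n)))
    have g5 := norm_add_le (3 * (wX b n * wX b n)) (6 * (conj (wX b n) * conj (wX b n)))
    simp only [norm_mul, norm_neg, norm_pow, hv, RCLike.norm_conj, one_pow, one_mul, mul_one]
      at g4 g5 ⊢
    norm_num at g4 g5 ⊢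
    linarith [pow_nonneg hθ0 3]
  have hfin : vSeq b v₀ n ^ 3 - cubeWin b v₀ n =
      v₀ ^ 3 * ((1 + conj f) ^ 3 / (1 + f) ^ 3 - cubePoly (conj f) f) +
      v₀ ^ 3 * (cubePoly (conj f) f - cubePoly (conj f₀) f₀) +
      (v₀ ^ 3 * cubePoly (conj f₀) f₀ - cubeWin b v₀ n) := by
    rw [hv3]; ring
  rw [hfin]
  refine norm_add₃_le.trans ?_
  rw [norm_mul, norm_mul, norm_pow, hv, one_pow, one_mul, one_mul]
  nlinarith [pow_nonneg hθ0 3]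

end Szego

/-! ### Observables, functions of the past, and decoupling -/

namespace HypSys

open ComplexConjugate

variable {X : Type*} [TopologicalSpace X] [CompactSpace X] [SecondCountableTopology X]
  [MeasurableSpace X] [BorelSpace X] (H : HypSys X)

/-- Observables: bounded by `C`, `C`-Lipschitz along the stable flow, and Lipschitz along the
unstable flow. -/
structure Obs (C : ℝ) (f : X → ℂ) : Prop where
  cont : Continuous f
  bound : ∀ p, ‖f p‖ ≤ C
  slip : ∀ b p, ‖f (H.S b p) - f p‖ ≤ C * |b|
  ulip : ∃ D, 0 ≤ D ∧ ∀ s p, ‖f (H.U s p) - f p‖ ≤ D * |s|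

/-- Functions that essentially depend on the trajectory up to time `n` only. -/
structure Past (n : ℕ) (D : ℝ) (G : X → ℂ) : Prop where
  cont : Continuous G
  bound : ∀ p, ‖G p‖ ≤ D
  ulip : ∀ s p, ‖G (H.U s p) - G p‖ ≤ D * H.mu ^ n * |s|

lemma nonempty (H : HypSys X) : Nonempty X := H.P.nonempty_of_neZero

variable {H}

namespace Obs

variable {C C₁ C₂ : ℝ} {f g : X → ℂ}

lemma nonneg (hf : H.Obs C f) : 0 ≤ C := by
  obtain ⟨p⟩ := H.nonempty; exact (norm_nonneg _).trans (hf.bound p)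

lemma mono (hf : H.Obs C₁ f) (h : C₁ ≤ C₂) : H.Obs C₂ f :=
  ⟨hf.cont, fun p => (hf.bound p).trans h,
    fun b p => (hf.slip b p).trans (mul_le_mul_of_nonneg_right h (abs_nonneg b)), hf.ulip⟩

lemma const (c : ℂ) : H.Obs ‖c‖ fun _ => c :=
  ⟨continuous_const, fun _ => le_rfl, fun b p => by simp; positivity, 0, le_rfl, by simp⟩

lemma add (hf : H.Obs C₁ f) (hg : H.Obs C₂ g) : H.Obs (C₁ + C₂) fun x => f x + g x := by
  obtain ⟨D₁, h1, h1'⟩ := hf.ulip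
  obtain ⟨D₂, h2, h2'⟩ := hg.ulip
  refine ⟨hf.cont.add hg.cont, fun p => (norm_add_le _ _).trans (add_le_add (hf.bound p)
    (hg.bound p)), fun b p => ?_, D₁ + D₂, add_nonneg h1 h2, fun s p => ?_⟩
  · rw [add_sub_add_comm, add_mul]
    exact (norm_add_le _ _).trans (add_le_add (hf.slip b p) (hg.slip b p))
  · rw [add_sub_add_comm, add_mul]
    exact (norm_add_le _ _).trans (add_le_add (h1' s p) (h2' s p))

lemma mul (hf : H.Obs C₁ f) (hg : H.Obs C₂ g) : H.Obs (2 * C₁ * C₂) fun x => f x * g x := by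
  obtain ⟨D₁, h1, h1'⟩ := hf.ulip
  obtain ⟨D₂, h2, h2'⟩ := hg.ulip
  have n1 := hf.nonneg
  have n2 := hg.nonneg
  have key : ∀ p q, ‖f q * g q - f p * g p‖ ≤ ‖f q - f p‖ * C₂ + C₁ * ‖g q - g p‖ := by
    intro p q
    have e : f q * g q - f p * g p = (f q - f p) * g q + f p * (g q - g p) := by ring
    rw [e]
    refine (norm_add_le _ _).trans ?_
    rw [norm_mul, norm_mul]
    gcongr
    · exact hg.bound q
    · exact hf.bound p
  refine ⟨hf.cont.mul hg.cont, fun p => ?_, fun b p => ?_, D₁ * C₂ + C₁ * D₂, by positivity,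
    fun s p => ?_⟩
  · rw [norm_mul]
    have := mul_le_mul (hf.bound p) (hg.bound p) (norm_nonneg _) n1
    nlinarith [mul_nonneg n1 n2]
  · refine (key _ _).trans ?_
    have := mul_le_mul_of_nonneg_right (hf.slip b p) n2
    have := mul_le_mul_of_nonneg_left (hg.slip b p) n1
    linarith
  · refine (key _ _).trans ?_
    have := mul_le_mul_of_nonneg_right (h1' s p) n2
    have := mul_le_mul_of_nonneg_left (h2' s p) n1
    linarith

lemma const_mul (c : ℂ) (hf : H.Obs C f) : H.Obs (‖c‖ * C) fun x => c * f x := by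
  obtain ⟨D, h1, h2⟩ := hf.ulip
  refine ⟨continuous_const.mul hf.cont, fun p => ?_, fun b p => ?_, ‖c‖ * D, by positivity,
    fun s p => ?_⟩
  · rw [norm_mul]; gcongr; exact hf.bound p
  · rw [← mul_sub, norm_mul, mul_assoc]; gcongr; exact hf.slip b p
  · rw [← mul_sub, norm_mul, mul_assoc]; gcongr; exact h2 s p

lemma neg (hf : H.Obs C f) : H.Obs C fun x => -f x := by
  simpa using hf.const_mul (-1)

lemma sub (hf : H.Obs C₁ f) (hg : H.Obs C₂ g) : H.Obs (C₁ + C₂) fun x => f x - g x := by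
  simpa [sub_eq_add_neg] using hf.add hg.neg

lemma cconj (hf : H.Obs C f) : H.Obs C fun x => conj (f x) := by
  obtain ⟨D, h1, h2⟩ := hf.ulip
  refine ⟨Complex.continuous_conj.comp hf.cont, fun p => ?_, fun b p => ?_, D, h1, fun s p => ?_⟩
  · rw [RCLike.norm_conj]; exact hf.bound p
  · rw [← map_sub, RCLike.norm_conj]; exact hf.slip b p
  · rw [← map_sub, RCLike.norm_conj]; exact h2 s p

lemma sum {ι : Type*} (s : Finset ι) {F : ι → X → ℂ} {C : ι → ℝ} (h : ∀ i ∈ s, H.Obs (C i) (F i)) :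
    H.Obs (∑ i ∈ s, C i) fun x => ∑ i ∈ s, F i x := by
  classical
  induction s using Finset.induction_on with
  | empty => simpa using Obs.const (H := H) 0
  | insert a s ha ih =>
    simp only [Finset.sum_insert ha]
    exact (h a (Finset.mem_insert_self a s)).add (ih fun i hi => h i (Finset.mem_insert_of_mem hi))

/-- The stable flow is contracted, so `C` survives composition with `T^[n]`. The unstable constant
does grow, which is why `Obs` keeps it existential and separate from `C`. -/
lemma iter (hf : H.Obs C f) (n : ℕ) : H.Obs C fun x => f (H.T^[n] x) := by
  obtain ⟨D, h1, h2⟩ := hf.ulip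
  have hm := H.mu_pow_pos n
  refine ⟨hf.cont.comp (H.cont_iter n), fun p => hf.bound _, fun b p => ?_, D * H.mu ^ n,
    by positivity, fun s p => ?_⟩
  · rw [H.iter_S]
    refine (hf.slip _ _).trans ?_
    rw [abs_mul, H.abs_κ'_pow]
    have h3 : (H.mu ^ n)⁻¹ ≤ 1 := inv_le_one_of_one_le₀ (one_le_pow₀ H.one_lt_mu.le)
    have := hf.nonneg
    gcongr
    exact mul_le_of_le_one_left (abs_nonneg b) h3
  · rw [H.iter_U]
    refine (h2 _ _).trans ?_
    rw [abs_mul, H.abs_κ_pow, mul_assoc]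

lemma sub_integral (hf : H.Obs C f) : H.Obs (2 * C) fun x => f x - ∫ y, f y ∂H.P := by
  have : ‖∫ y, f y ∂H.P‖ ≤ C := by
    simpa using norm_integral_le_of_norm_le_const (μ := H.P) (Eventually.of_forall hf.bound)
  rw [two_mul]
  exact hf.sub ((const _).mono this)

lemma integral_sub_integral (hf : H.Obs C f) : ∫ x, (f x - ∫ y, f y ∂H.P) ∂H.P = 0 := by
  rw [integral_sub (H.integrable hf.cont) (integrable_const _)]; simp

end Obs

namespace Past

variable {n m : ℕ} {D D₁ D₂ C : ℝ} {F G f : X → ℂ}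

lemma nonneg (hG : H.Past n D G) : 0 ≤ D := by
  obtain ⟨p⟩ := H.nonempty; exact (norm_nonneg _).trans (hG.bound p)

lemma mono (hG : H.Past n D₁ G) (hn : n ≤ m) (h : D₁ ≤ D₂) : H.Past m D₂ G := by
  refine ⟨hG.cont, fun p => (hG.bound p).trans h, fun s p => (hG.ulip s p).trans ?_⟩
  have := H.one_lt_mu
  have := hG.nonneg
  have := H.mu_pos
  gcongr
  · linarith
  · exact H.one_lt_mu.le

lemma const (c : ℂ) : H.Past n ‖c‖ fun _ => c :=
  ⟨continuous_const, fun _ => le_rfl, fun s p => by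
    have := H.mu_pow_pos n; simp; positivity⟩

lemma mul (hF : H.Past n D₁ F) (hG : H.Past n D₂ G) : H.Past n (2 * D₁ * D₂)
    fun x => F x * G x := by
  have n1 := hF.nonneg
  have n2 := hG.nonneg
  refine ⟨hF.cont.mul hG.cont, fun p => ?_, fun s p => ?_⟩
  · rw [norm_mul]
    have := mul_le_mul (hF.bound p) (hG.bound p) (norm_nonneg _) n1
    nlinarith [mul_nonneg n1 n2]
  · have e : F (H.U s p) * G (H.U s p) - F p * G p =
      (F (H.U s p) - F p) * G (H.U s p) + F p * (G (H.U s p) - G p) := by ring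
    rw [e]
    refine (norm_add_le _ _).trans ?_
    rw [norm_mul, norm_mul]
    have h1 := mul_le_mul (hF.ulip s p) (hG.bound (H.U s p)) (norm_nonneg _)
      ((norm_nonneg _).trans (hF.ulip s p))
    have h2 := mul_le_mul (hF.bound p) (hG.ulip s p) (norm_nonneg _) n1
    linarith

lemma const_mul (c : ℂ) (hG : H.Past n D G) : H.Past n (‖c‖ * D) fun x => c * G x := by
  refine ⟨continuous_const.mul hG.cont, fun p => ?_, fun s p => ?_⟩
  · rw [norm_mul]; gcongr; exact hG.bound p
  · rw [← mul_sub, norm_mul, mul_assoc, mul_assoc]; gcongr; rw [← mul_assoc]; exact hG.ulip s p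

lemma pow (hG : H.Past n D G) (k : ℕ) : H.Past n ((2 * D) ^ k) fun x => G x ^ k := by
  induction k with
  | zero => simpa using Past.const (H := H) (n := n) 1
  | succ k ih => simpa [pow_succ, mul_comm, mul_assoc, mul_left_comm] using ih.mul hG

lemma of_ulip (hc : Continuous f) (hb : ∀ p, ‖f p‖ ≤ C) {K : ℝ}
    (hu : ∀ s p, ‖f (H.U s p) - f p‖ ≤ K * |s|) :
    H.Past n (max C K) fun x => f (H.T^[n] x) := by
  refine ⟨hc.comp (H.cont_iter n), fun p => (hb _).trans (le_max_left _ _), fun s p => ?_⟩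
  rw [H.iter_U]
  refine (hu _ _).trans ?_
  rw [abs_mul, H.abs_κ_pow, mul_assoc]
  have := H.mu_pow_pos n
  gcongr
  exact le_max_right _ _

lemma cconj (hG : H.Past n D G) : H.Past n D fun x => conj (G x) := by
  refine ⟨Complex.continuous_conj.comp hG.cont, fun p => ?_, fun s p => ?_⟩
  · rw [RCLike.norm_conj]; exact hG.bound p
  · rw [← map_sub, RCLike.norm_conj]; exact hG.ulip s p

lemma sum {ι : Type*} (s : Finset ι) {F : ι → X → ℂ} {D : ℝ} (h : ∀ i ∈ s, H.Past n D (F i)) :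
    H.Past n (s.card * D) fun x => ∑ i ∈ s, F i x := by
  refine ⟨continuous_finsetSum _ fun i hi => (h i hi).cont, fun p => ?_, fun t p => ?_⟩
  · refine (norm_sum_le_of_le _ fun i hi => (h i hi).bound p).trans (by simp)
  · rw [← Finset.sum_sub_distrib]
    refine (norm_sum_le_of_le _ fun i hi => (h i hi).ulip t p).trans (le_of_eq ?_)
    simp; ring

end Past

variable (H)

lemma R_nonneg : 0 ≤ H.R := by
  obtain ⟨p⟩ := H.nonempty
  obtain ⟨a, b, ha, -, -⟩ := H.joined p p
  exact (abs_nonneg a).trans ha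

lemma avg_re (c : ℂ) {Y : X → ℂ} (hY : Continuous Y) (l : ℝ) (p : X) :
    H.avg l (fun x => (c * Y x).re) p = (c * H.avg l Y p).re := by
  unfold avg
  rw [← intervalIntegral.integral_const_mul]
  exact Complex.reCLM.intervalIntegral_comp_comm
    ((continuous_const.mul (H.cont_arc hY l p)).intervalIntegrable _ _)

/-- The real bound is applied to `±1` and `±I` times `Y`; adding the real and imaginary parts costs
the factor `2`. -/
theorem ldle_of_avg {Y : ℕ → X → ℂ} (hY : ∀ n, Continuous (Y n)) {B D a ε₀ : ℝ}
    (hB : ∀ n p, ‖Y n p‖ ≤ B)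
    (hD : ∀ n s p, ‖Y n (H.U s p) - Y n p‖ ≤ D * H.mu ^ n * |s|) (ha : 0 < a)
    (havg : ∀ n p, ‖H.avg (a * (H.mu ^ n)⁻¹) (Y n) p‖ ≤ ε₀) :
    LDle H.P Y (2 * ε₀) := by
  intro ε hε
  have hε₀ : 0 ≤ ε₀ := by
    obtain ⟨p⟩ := H.nonempty; exact (norm_nonneg _).trans (havg 0 p)
  have key : ∀ c : ℂ, ‖c‖ = 1 → ExpSmall H.P fun N =>
      {x | ε / 2 * N < ∑ n ∈ Finset.range N, (c * Y n x).re} := by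
    intro c hc
    refine H.expSmall_sum_gt (Y := fun n x => (c * Y n x).re) (B := B) (D := D) (a := a)
      (ε₀ := ε₀) (fun n => Complex.continuous_re.comp (continuous_const.mul (hY n)))
      (fun n p => ?_) (fun n s p => ?_) ha (fun n p => ?_) (by linarith) hε₀
    · refine (Complex.abs_re_le_norm _).trans ?_
      rw [norm_mul, hc, one_mul]; exact hB n p
    · rw [← Complex.sub_re, ← mul_sub]
      refine (Complex.abs_re_le_norm _).trans ?_
      rw [norm_mul, hc, one_mul]; exact hD n s p
    · rw [H.avg_re c (hY n)]
      refine (Complex.re_le_norm _).trans ?_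
      rw [norm_mul, hc, one_mul]; exact havg n p
  refine (((key 1 (by simp)).union (key (-1) (by simp))).union
    ((key Complex.I (by simp)).union (key (-Complex.I) (by simp)))).mono
    (Eventually.of_forall fun N x hx => ?_)
  simp only [Set.mem_union, Set.mem_ofPred_eq] at hx ⊢
  by_contra! hcon
  have h1 := Complex.norm_le_abs_re_add_abs_im (∑ n ∈ Finset.range N, Y n x)
  obtain ⟨⟨c1, c2⟩, c3, c4⟩ := hcon
  simp only [← Complex.re_sum, ← Finset.mul_sum] at c1 c2 c3 c4
  simp only [one_mul, neg_mul, Complex.neg_re, Complex.I_mul_re, neg_neg] at c1 c2 c3 c4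
  have h2 : |(∑ n ∈ Finset.range N, Y n x).re| ≤ ε / 2 * N := abs_le.2 ⟨by linarith, c1⟩
  have h3 : |(∑ n ∈ Finset.range N, Y n x).im| ≤ ε / 2 * N := abs_le.2 ⟨by linarith, c4⟩
  linarith

variable {H}

/-- On an arc of length `mu^(-(n+q+i))` the factor `G` varies by at most `D mu^(-i)`. The map `T^[n
+ j]` stretches the same arc to length at least `mu^(2i)`, because `j ≥ q + 3i`, and there the
average of `f` is at most `3 R C mu^(-i)` by `norm_avg_le`. -/
lemma norm_avg_mul_le {q n j i : ℕ} {D C : ℝ} {G f : X → ℂ} (hG : H.Past (n + q) D G)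
    (hf : H.Obs C f) (h0 : ∫ x, f x ∂H.P = 0) (hj : q + 3 * i ≤ j) (p : X) :
    ‖H.avg ((H.mu ^ (q + i))⁻¹ * (H.mu ^ n)⁻¹) (fun x => G x * f (H.T^[n + j] x)) p‖ ≤
      (1 + 3 * H.R) * (D * C * (H.mu ^ i)⁻¹) := by
  set l := (H.mu ^ (q + i))⁻¹ * (H.mu ^ n)⁻¹ with hl
  have m1 := H.mu_pow_pos (q + i)
  have m2 := H.mu_pow_pos n
  have m3 := H.mu_pow_pos i
  have m4 := H.mu_pow_pos (n + q)
  have hD := hG.nonneg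
  have hC := hf.nonneg
  have hR := H.R_nonneg
  have hl0 : 0 < l := by positivity
  have hft := (hf.iter (n + j)).cont
  have h1 : H.avg l (fun x => G x * f (H.T^[n + j] x)) p =
      H.avg l (fun x => (G x - G p) * f (H.T^[n + j] x)) p +
      G p * H.avg (H.κ ^ (n + j) * l) f (H.T^[n + j] p) := by
    rw [← H.avg_iter]
    unfold avg
    rw [← intervalIntegral.integral_const_mul, ← intervalIntegral.integral_add]
    · congr 1; funext s; ring
    · exact (H.cont_arc ((hG.cont.sub continuous_const).mul hft) l p).intervalIntegrable _ _
    · exact (continuous_const.mul (H.cont_arc hft l p)).intervalIntegrable _ _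
  have h2 : ‖H.avg l (fun x => (G x - G p) * f (H.T^[n + j] x)) p‖ ≤ D * C * (H.mu ^ i)⁻¹ := by
    unfold avg
    have := intervalIntegral.norm_integral_le_of_norm_le_const (a := 0) (b := 1)
      (f := fun s => (G (H.U (l * s) p) - G p) * f (H.T^[n + j] (H.U (l * s) p)))
      (C := D * C * (H.mu ^ i)⁻¹) (fun s hs => by
        rw [Set.uIoc_of_le zero_le_one] at hs
        rw [norm_mul]
        have a1 := hG.ulip (l * s) p
        have a2 : |l * s| ≤ l := by
          rw [abs_mul, abs_of_pos hl0, abs_of_pos hs.1]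
          exact mul_le_of_le_one_right hl0.le hs.2
        have a3 : D * H.mu ^ (n + q) * |l * s| ≤ D * H.mu ^ (n + q) * l := by gcongr
        have a4 : D * H.mu ^ (n + q) * l = D * (H.mu ^ i)⁻¹ := by
          rw [hl, pow_add, pow_add]; have := H.mu_pos.ne'; field_simp
        rw [a4] at a3
        have := mul_le_mul (a1.trans a3) (hf.bound (H.T^[n + j] (H.U (l * s) p)))
          (norm_nonneg _) (by positivity)
        linarith)
    simpa using this
  have h3 := H.norm_avg_le hf.cont hf.bound hf.slip hC h0 (l := H.κ ^ (n + j) * l)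
    (mul_ne_zero (pow_ne_zero _ H.κ_ne_zero) hl0.ne') i (H.T^[n + j] p)
  have h4 : H.mu ^ (2 * i) ≤ |H.κ ^ (n + j) * l| := by
    rw [abs_mul, H.abs_κ_pow, abs_of_pos hl0, hl]
    have e : H.mu ^ (n + j) * ((H.mu ^ (q + i))⁻¹ * (H.mu ^ n)⁻¹) = H.mu ^ j / H.mu ^ (q + i) := by
      rw [pow_add]; field_simp
    rw [e, le_div_iff₀ m1, ← pow_add]
    exact pow_le_pow_right₀ H.one_lt_mu.le (by omega)
  have h5 : 2 * C * H.mu ^ i / |H.κ ^ (n + j) * l| ≤ 2 * C * (H.mu ^ i)⁻¹ := by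
    have m5 := H.mu_pow_pos (2 * i)
    calc _ ≤ 2 * C * H.mu ^ i / H.mu ^ (2 * i) := by gcongr
      _ = _ := by rw [two_mul i, pow_add]; field_simp
  have h6 : ‖H.avg (H.κ ^ (n + j) * l) f (H.T^[n + j] p)‖ ≤ H.R * (3 * C * (H.mu ^ i)⁻¹) :=
    h3.trans (mul_le_mul_of_nonneg_left (by linarith) hR)
  rw [h1]
  refine (norm_add_le _ _).trans ?_
  rw [norm_mul]
  have := mul_le_mul (hG.bound p) h6 (norm_nonneg _) hD
  linarith

variable (H) in
/-- The constant in the decoupling estimates. -/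
noncomputable def C0 : ℝ := 2 * (1 + 3 * H.R)

lemma C0_nonneg : 0 ≤ H.C0 := by have := H.R_nonneg; unfold C0; positivity

/-- Decoupling of the past and the far future. -/
theorem ldle_decouple {q j i : ℕ} {D C : ℝ} {G : ℕ → X → ℂ} {f : X → ℂ}
    (hG : ∀ n, H.Past (n + q) D (G n)) (hf : H.Obs C f) (h0 : ∫ x, f x ∂H.P = 0)
    (hj : q + 3 * i ≤ j) :
    LDle H.P (fun n x => G n x * f (H.T^[n + j] x)) (H.C0 * (D * C * (H.mu ^ i)⁻¹)) := by
  obtain ⟨K, hK, hK'⟩ := hf.ulip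
  have hP : ∀ n, H.Past (n + j) (2 * D * max C K) fun x => G n x * f (H.T^[n + j] x) := fun n =>
    ((hG n).mono (by omega) le_rfl).mul (Past.of_ulip hf.cont hf.bound hK')
  have hm := H.mu_pow_pos (q + i)
  have h := H.ldle_of_avg (Y := fun n x => G n x * f (H.T^[n + j] x)) (a := (H.mu ^ (q + i))⁻¹)
    (fun n => (hP n).cont) (fun n => (hP n).bound) (D := 2 * D * max C K * H.mu ^ j)
    (fun n s p => ((hP n).ulip s p).trans (le_of_eq (by rw [pow_add]; ring)))
    (by positivity) (fun n p => norm_avg_mul_le (hG n) hf h0 hj p)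
  unfold C0
  rwa [mul_assoc]

lemma tendsto_inv_mu_pow : Tendsto (fun i : ℕ => (H.mu ^ i)⁻¹) atTop (𝓝 0) :=
  (tendsto_pow_atTop_atTop_of_one_lt H.one_lt_mu).inv_tendsto_atTop

/-- Large deviations for Birkhoff sums with rotating weights. -/
theorem ldle_birkhoff {C : ℝ} {w : ℕ → ℂ} (hw : ∀ n, ‖w n‖ ≤ 1) {f : X → ℂ} (hf : H.Obs C f)
    (h0 : ∫ x, f x ∂H.P = 0) : LDle H.P (fun n x => w n * f (H.T^[n] x)) 0 := by
  refine LDle.of_forall_gt fun δ hδ => ?_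
  have h1 : Tendsto (fun i : ℕ => H.C0 * (1 * C * (H.mu ^ i)⁻¹)) atTop (𝓝 0) := by
    simpa using (H.tendsto_inv_mu_pow.const_mul (1 * C)).const_mul H.C0
  obtain ⟨i, hi⟩ := (h1.eventually_le_const hδ).exists
  -- A time shift by `3i` is free and opens the gap that decoupling needs; `i` is chosen for the
  -- given `δ`.
  refine LDle.of_shift (B := C) (fun n x => ?_) (3 * i) (LDle.mono ?_ hi)
  · rw [norm_mul]
    exact (mul_le_mul (hw n) (hf.bound _) (norm_nonneg _) zero_le_one).trans (by simp)
  · exact ldle_decouple (q := 0) (G := fun n _ => w (n + 3 * i)) (D := 1)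
      (fun n => (Past.const _).mono le_rfl (hw _)) hf h0 (by omega)

theorem ldle_birkhoff_mean {C : ℝ} {f : X → ℂ} (hf : H.Obs C f) :
    LDle H.P (fun n x => f (H.T^[n] x) - ∫ y, f y ∂H.P) 0 := by
  simpa using ldle_birkhoff (w := fun _ => 1) (by simp) hf.sub_integral hf.integral_sub_integral

/-- Exponential decay of correlations: the integral does not change when the integrand is averaged
over unstable arcs. -/
lemma norm_integral_mul_le {j i : ℕ} {D C : ℝ} {G f : X → ℂ} (hG : H.Past 0 D G)
    (hf : H.Obs C f) (h0 : ∫ x, f x ∂H.P = 0) (hj : 3 * i ≤ j) :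
    ‖∫ x, G x * f (H.T^[j] x) ∂H.P‖ ≤ H.C0 * (D * C * (H.mu ^ i)⁻¹) := by
  have h1 := H.integral_avg (f := fun x => G x * f (H.T^[j] x))
    (hG.cont.mul (hf.iter j).cont) ((H.mu ^ i)⁻¹)
  rw [← h1]
  have h2 : ∀ p, ‖H.avg (H.mu ^ i)⁻¹ (fun x => G x * f (H.T^[j] x)) p‖ ≤
      (1 + 3 * H.R) * (D * C * (H.mu ^ i)⁻¹) := fun p => by
    simpa using norm_avg_mul_le (q := 0) (n := 0) (j := j) (i := i) hG hf h0 (by omega) p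
  have h3 := norm_integral_le_of_norm_le_const (μ := H.P) (Eventually.of_forall h2)
  have := H.R_nonneg
  have := hG.nonneg
  have := hf.nonneg
  have := H.mu_pow_pos i
  have h4 : 0 ≤ (1 + 3 * H.R) * (D * C * (H.mu ^ i)⁻¹) := by positivity
  rw [probReal_univ, mul_one] at h3
  refine h3.trans ?_
  unfold C0
  linarith

end HypSys

/-! ### Phases driven by the dynamics: decoupling and nonresonance -/

namespace HypSys

open ComplexConjugate Szego

variable {X : Type*} [TopologicalSpace X] [CompactSpace X] [SecondCountableTopology X]
  [MeasurableSpace X] [BorelSpace X] {H : HypSys X}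

/-- A sampling function with mean zero, and a spectral parameter on the unit circle. -/
structure Data (H : HypSys X) where
  α : X → ℂ
  z : ℂ
  K : ℝ
  one_le_K : 1 ≤ K
  obs : H.Obs K α
  ulip : ∀ s p, ‖α (H.U s p) - α p‖ ≤ K * |s|
  bound : ∀ p, ‖α p‖ ≤ 1
  mean : ∫ x, α x ∂H.P = 0
  hz : ‖z‖ = 1

namespace Data

variable (d : H.Data)

/-- Rotated Verblunsky coefficients. -/
noncomputable def b (lam : ℝ) (x : X) (n : ℕ) : ℂ := lam * d.z ^ (n + 1) * d.α (H.T^[n] x)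

/-- The Prüfer phase in the rotating frame. -/
noncomputable def v (lam : ℝ) (n : ℕ) (x : X) : ℂ := vSeq (d.b lam x) 1 n

/-- The coefficients of a window without coupling constant and starting phase: by `b_add`, the
coefficient at time `n + k` is `lam z^(n+1)` times `beta` at the point `T^[n] x`. -/
noncomputable def beta (x : X) (k : ℕ) : ℂ := d.z ^ k * d.α (H.T^[k] x)

/-- Admissible coupling constants. -/
def Small (_ : H.Data) (lam : ℝ) : Prop := 0 < lam ∧ lam ≤ 1 / 4 ∧ 8 * lam ≤ H.mu - 1

variable {d} {lam : ℝ}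

lemma norm_z_pow (n : ℕ) : ‖d.z ^ n‖ = 1 := by rw [norm_pow, d.hz, one_pow]

lemma conj_z_mul : conj d.z * d.z = 1 := conj_eq_inv d.hz

lemma conj_z_pow_mul (n : ℕ) : conj (d.z ^ n) * d.z ^ n = 1 := conj_eq_inv (norm_z_pow n)

lemma K_pos : 0 < d.K := zero_lt_one.trans_le d.one_le_K

lemma norm_beta_le (x : X) (k : ℕ) : ‖d.beta x k‖ ≤ 1 := by
  rw [beta, norm_mul, norm_z_pow, one_mul]; exact d.bound _

lemma norm_b_le (h : d.Small lam) (x : X) (n : ℕ) : ‖d.b lam x n‖ ≤ lam := by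
  rw [b, norm_mul, norm_mul, norm_z_pow, mul_one, Complex.norm_real, Real.norm_of_nonneg h.1.le]
  exact mul_le_of_le_one_right h.1.le (d.bound _)

lemma norm_b_lt (h : d.Small lam) (x : X) (n : ℕ) : ‖d.b lam x n‖ < 1 :=
  (norm_b_le h x n).trans_lt (by linarith [h.2.1])

lemma norm_v (h : d.Small lam) (n : ℕ) (x : X) : ‖d.v lam n x‖ = 1 :=
  norm_vSeq (norm_b_lt h x) norm_one n

lemma b_add (n k : ℕ) (x : X) :
    d.b lam x (n + k) = (lam * d.z ^ (n + 1)) * d.beta (H.T^[n] x) k := by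
  rw [b, beta, ← Function.iterate_add_apply, add_comm n k]; ring

lemma v_add (n k : ℕ) (x : X) :
    d.v lam (n + k) x = vSeq (fun j => (lam * d.z ^ (n + 1)) * d.beta (H.T^[n] x) j)
      (d.v lam n x) k := by
  rw [v, vSeq_add]; simp only [b_add]; rfl

lemma norm_c_beta_le (h : d.Small lam) (n : ℕ) (x : X) (k : ℕ) :
    ‖(lam * d.z ^ (n + 1)) * d.beta (H.T^[n] x) k‖ ≤ lam := by
  rw [← b_add]; exact norm_b_le h x _

lemma norm_v_sub_le (h : d.Small lam) (n k : ℕ) (x : X) :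
    ‖d.v lam (n + k) x - d.v lam n x‖ ≤ 4 * (k * lam) := by
  rw [v_add]
  exact norm_vSeq_sub_le (norm_c_beta_le h n x) (by linarith [h.2.1]) (norm_v h n x) k

lemma norm_v_pow_sub_le (h : d.Small lam) (n k j : ℕ) (x : X) :
    ‖d.v lam (n + k) x ^ j - d.v lam n x ^ j‖ ≤ j * (4 * (k * lam)) :=
  (norm_pow_sub_pow_le (norm_v h n x) (norm_v h (n + k) x) j).trans
    (mul_le_mul_of_nonneg_left (norm_v_sub_le h n k x) j.cast_nonneg)

variable (d) in
/-- Lipschitz constant of the phases. -/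
noncomputable def D0 : ℝ := max 1 (16 * d.K / (H.mu - 1))

lemma one_le_D0 : 1 ≤ d.D0 := le_max_left _ _

lemma past_α (n : ℕ) : H.Past n d.K fun x => d.α (H.T^[n] x) := by
  simpa using Past.of_ulip (n := n) d.obs.cont d.obs.bound d.ulip

/-- A recursion step multiplies the Lipschitz constant by at most `1 + 4 lam` and adds at most `8
lam K mu^n`. As `8 lam ≤ mu - 1`, the factor uses at most half of the room below `mu`, and `D0` is
large enough for the rest to absorb the forcing. -/
lemma past_v (h : d.Small lam) (n : ℕ) : H.Past n d.D0 (d.v lam n) := by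
  have hmu := H.one_lt_mu
  induction n with
  | zero =>
    exact (Past.const (H := H) (n := 0) 1).mono le_rfl (by rw [norm_one]; exact one_le_D0)
  | succ n ih =>
    have hbc : Continuous fun x => d.b lam x n := continuous_const.mul (d.past_α n).cont
    have hden : ∀ x, 1 - conj (d.b lam x n) * d.v lam n x ≠ 0 := fun x =>
      den_ne_zero (norm_b_lt h x n) (norm_v h n x)
    refine ⟨?_, fun p => (norm_v h _ p).le.trans one_le_D0, fun s p => ?_⟩
    · exact (ih.cont.sub hbc).div (continuous_const.sub
        ((Complex.continuous_conj.comp hbc).mul ih.cont)) hden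
    · have h1 := norm_vStep_sub_vStep_le (norm_b_le h (H.U s p) n) (norm_b_le h p n) h.2.1
        (norm_v h n (H.U s p)) (norm_v h n p)
      have h2 : ‖d.b lam (H.U s p) n - d.b lam p n‖ ≤ lam * (d.K * H.mu ^ n * |s|) := by
        rw [b, b, ← mul_sub, norm_mul, norm_mul, norm_z_pow, mul_one, Complex.norm_real,
          Real.norm_of_nonneg h.1.le]
        exact mul_le_mul_of_nonneg_left ((d.past_α n).ulip s p) h.1.le
      have h3 := ih.ulip s p
      have h4 : 16 * d.K ≤ d.D0 * (H.mu - 1) := by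
        rw [← div_le_iff₀ (by linarith)]; exact le_max_right _ _
      refine h1.trans ?_
      have hm := H.mu_pow_pos n
      have h5 : 0 ≤ H.mu ^ n * |s| := by positivity
      have h6 : (1 + 4 * lam) * d.D0 + 8 * (lam * d.K) ≤ d.D0 * H.mu := by
        have := one_le_D0 (d := d)
        have hK := d.K_pos
        nlinarith [h.1, h.2.1, h.2.2]
      calc _ ≤ (1 + 4 * lam) * (d.D0 * H.mu ^ n * |s|) + 8 * (lam * (d.K * H.mu ^ n * |s|)) :=
            add_le_add (mul_le_mul_of_nonneg_left h3 (by linarith [h.1])) (by linarith)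
        _ = ((1 + 4 * lam) * d.D0 + 8 * (lam * d.K)) * (H.mu ^ n * |s|) := by ring
        _ ≤ d.D0 * H.mu * (H.mu ^ n * |s|) := mul_le_mul_of_nonneg_right h6 h5
        _ = _ := by rw [pow_succ]; ring

/-- The basic error scale. -/
noncomputable def err (H : HypSys X) (lam : ℝ) (i : ℕ) : ℝ := (H.mu ^ i)⁻¹ + i * lam

lemma err_nonneg (h : d.Small lam) (i : ℕ) : 0 ≤ err H lam i := by
  have := H.mu_pow_pos i; have := h.1; unfold err; positivity

lemma inv_le_err (h : d.Small lam) (i : ℕ) : (H.mu ^ i)⁻¹ ≤ err H lam i := by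
  have := h.1; unfold err; linarith [show 0 ≤ (i:ℝ) * lam by positivity]

lemma mul_le_err (i : ℕ) : i * lam ≤ err H lam i := by
  have := H.mu_pow_pos i; unfold err; linarith [show 0 ≤ (H.mu ^ i)⁻¹ by positivity]

/-- Decoupling a power of the phase from an observable at the same time, to first order. -/
lemma exists_fod (d : H.Data) (k : ℕ) : ∃ C, 0 ≤ C ∧ ∀ lam, d.Small lam → ∀ i : ℕ, ∀ A : ℝ,
    ∀ f : X → ℂ, H.Obs A f → ∀ w : ℕ → ℂ, (∀ n, ‖w n‖ ≤ 1) →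
    LDle H.P (fun n x => w n * d.v lam n x ^ k * (f (H.T^[n] x) - ∫ y, f y ∂H.P))
      (C * A * err H lam i) := by
  have hD := one_le_D0 (d := d)
  have hC0 := H.C0_nonneg
  refine ⟨H.C0 * ((2 * d.D0) ^ k * 2) + 24 * k, by positivity, fun lam h i A f hf w hw => ?_⟩
  have hA := hf.nonneg
  -- Evaluate at time `n + 3i` and replace the phase there by the one at time `n`: this costs `O(i
  -- lam)`, and the observable is then `3i` steps ahead of the phase.
  refine LDle.of_shift (B := 2 * A) (fun n x => ?_) (3 * i) ?_
  · rw [norm_mul, norm_mul, norm_pow, norm_v h, one_pow, mul_one]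
    have := mul_le_mul (hw n) (hf.sub_integral.bound (H.T^[n] x)) (norm_nonneg _) zero_le_one
    linarith
  have h1 := ldle_decouple (q := 0) (j := 3 * i) (i := i)
    (G := fun n x => w (n + 3 * i) * d.v lam n x ^ k) (D := (2 * d.D0) ^ k)
    (fun n => (((past_v h n).pow k).const_mul _).mono le_rfl
      (mul_le_of_le_one_left (by positivity) (hw _)))
    hf.sub_integral hf.integral_sub_integral (by omega)
  have h2 := h1.of_norm_sub_le (δ := k * (4 * ((3 * i : ℕ) * lam)) * (2 * A))
    (Z := fun n x => w (n + 3 * i) * d.v lam (n + 3 * i) x ^ k *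
      (f (H.T^[n + 3 * i] x) - ∫ y, f y ∂H.P)) (fun n x => ?_)
  · refine h2.mono ?_
    have e1 := inv_le_err h i
    have e2 : (i:ℝ) * lam ≤ err H lam i := mul_le_err i
    push_cast
    have : 0 ≤ H.C0 * (2 * d.D0) ^ k * 2 * A := by positivity
    have := mul_le_mul_of_nonneg_left e1 this
    have : 0 ≤ 24 * (k:ℝ) * A := by positivity
    have := mul_le_mul_of_nonneg_left e2 this
    nlinarith
  · rw [← sub_mul, ← mul_sub, norm_mul, norm_mul]
    have a1 := norm_v_pow_sub_le h n (3 * i) k x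
    have a2 := mul_le_mul (hw (n + 3 * i)) a1 (norm_nonneg _) zero_le_one
    rw [one_mul] at a2
    exact mul_le_mul a2 (hf.sub_integral.bound _) (norm_nonneg _) ((norm_nonneg _).trans a1)

/-- Terms that are linear in the coefficients are negligible. -/
lemma ldle_linear (h : d.Small lam) (m i : ℕ) {f : X → ℂ} (hf : H.Obs d.K f)
    (hf0 : ∫ x, f x ∂H.P = 0) (hf1 : ∀ p, ‖f p‖ ≤ 1) {u : ℕ → ℂ} (hu : ∀ n, ‖u n‖ ≤ 1) :
    LDle H.P (fun n x => lam * (u n * d.v lam n x ^ m * f (H.T^[n] x)))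
      (lam * (H.C0 * ((2 * d.D0) ^ m * d.K * (H.mu ^ i)⁻¹) + m * (12 * (i * lam)))) := by
  have hD := one_le_D0 (d := d)
  refine LDle.mono (LDle.const_mul (ε := H.C0 * ((2 * d.D0) ^ m * d.K * (H.mu ^ i)⁻¹) +
    m * (12 * (i * lam))) ?_ (lam : ℂ)) (le_of_eq (by
      rw [Complex.norm_real, Real.norm_of_nonneg h.1.le]))
  refine LDle.of_shift (B := 1) (fun n x => ?_) (3 * i) ?_
  · rw [norm_mul, norm_mul, norm_pow, norm_v h, one_pow, mul_one]
    exact mul_le_one₀ (hu n) (norm_nonneg _) (hf1 _)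
  have h1 := ldle_decouple (q := 0) (j := 3 * i) (i := i)
    (G := fun n x => u (n + 3 * i) * d.v lam n x ^ m) (D := (2 * d.D0) ^ m)
    (fun n => (((past_v h n).pow m).const_mul _).mono le_rfl
      (mul_le_of_le_one_left (by positivity) (hu _))) hf hf0 (by omega)
  refine h1.of_norm_sub_le (fun n x => ?_)
  rw [← sub_mul, ← mul_sub, norm_mul, norm_mul]
  have a1 := norm_v_pow_sub_le h n (3 * i) m x
  have a2 := mul_le_mul (hu (n + 3 * i)) a1 (norm_nonneg _) zero_le_one
  have a3 := mul_le_mul a2 (hf1 (H.T^[n + 3 * i] x)) (norm_nonneg _)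
    (by rw [one_mul]; exact (norm_nonneg _).trans a1)
  refine a3.trans (le_of_eq ?_)
  push_cast; ring

/-- Nonresonant powers of the phase average out. -/
lemma exists_nonres (d : H.Data) (k : ℕ) (hk : 1 ≤ k) (hzk : d.z ^ k ≠ 1) :
    ∃ C, 0 ≤ C ∧ ∀ lam, d.Small lam → ∀ i : ℕ, 1 ≤ i →
    LDle H.P (fun n x => (conj d.z ^ k) ^ n * d.v lam n x ^ k) (C * (lam * err H lam i)) := by
  have hD := one_le_D0 (d := d)
  have hC0 := H.C0_nonneg
  have hK := d.K_pos
  set w := conj d.z ^ k with hw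
  have hwn : ‖w‖ = 1 := by rw [hw, norm_pow, RCLike.norm_conj, d.hz, one_pow]
  have hw1 : w ≠ 1 := by
    intro h1
    apply hzk
    have := congrArg conj h1
    simpa [hw] using this
  have hwinv : 0 < ‖w⁻¹ - 1‖ := by
    rw [norm_pos_iff, sub_ne_zero]; intro h1; exact hw1 (by simpa using h1)
  obtain ⟨C₁, hC₁⟩ : ∃ C₁ : ℝ, C₁ = H.C0 * ((2 * d.D0) ^ (k + 1) * d.K) := ⟨_, rfl⟩
  obtain ⟨C₂, hC₂⟩ : ∃ C₂ : ℝ, C₂ = H.C0 * ((2 * d.D0) ^ (k - 1) * d.K) := ⟨_, rfl⟩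
  have hC₁0 : 0 ≤ C₁ := by rw [hC₁]; positivity
  have hC₂0 : 0 ≤ C₂ := by rw [hC₂]; positivity
  refine ⟨(k * (C₁ + (k + 1) * 12 + (C₂ + k * 12)) + 20 * k ^ 2) / ‖w⁻¹ - 1‖,
    by positivity, fun lam h i hi => ?_⟩
  have hi1 : (1:ℝ) ≤ i := by exact_mod_cast hi
  have hlam := h.1
  have hk1 : (1:ℝ) ≤ k := by exact_mod_cast hk
  have t1 := ldle_linear h (k + 1) i (f := fun x => conj (d.α x)) d.obs.cconj
    (by rw [integral_conj, d.mean, map_zero]) (fun p => by rw [RCLike.norm_conj]; exact d.bound p)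
    (u := fun n => w ^ n * conj d.z ^ (n + 1)) (fun n => by
      rw [norm_mul, norm_pow w, hwn, norm_pow, RCLike.norm_conj, d.hz]; simp)
  have t2 := ldle_linear h (k - 1) i d.obs d.mean d.bound
    (u := fun n => w ^ n * d.z ^ (n + 1)) (fun n => by
      rw [norm_mul, norm_pow w, hwn, norm_z_pow]; simp)
  -- The increments are linear in the coefficients up to `O(lam²)`, and the linear terms are already
  -- negligible. Summation by parts, possible because `w ≠ 1`, passes from increments to `v^k`
  -- itself.
  have key : LDle H.P (fun n x => w ^ n * (d.v lam (n + 1) x ^ k - d.v lam n x ^ k)) _ :=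
    ((t1.sub t2).const_mul k).of_norm_sub_le (δ := 20 * k ^ 2 * lam ^ 2) fun n x => by
      have := norm_vStep_pow_le (norm_b_le h x n) (by linarith [h.2.1]) (norm_v h n x) k hk
      have e : w ^ n * (d.v lam (n + 1) x ^ k - d.v lam n x ^ k) - k *
          (lam * (w ^ n * conj d.z ^ (n + 1) * d.v lam n x ^ (k + 1) * conj (d.α (H.T^[n] x))) -
          lam * (w ^ n * d.z ^ (n + 1) * d.v lam n x ^ (k - 1) * d.α (H.T^[n] x))) =
          w ^ n * (vStep (d.b lam x n) (d.v lam n x) ^ k - d.v lam n x ^ k -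
            k * (conj (d.b lam x n) * d.v lam n x ^ (k + 1) -
              d.b lam x n * d.v lam n x ^ (k - 1))) := by
        have : d.v lam (n + 1) x = vStep (d.b lam x n) (d.v lam n x) := rfl
        rw [this, b]
        simp only [map_mul, map_pow, Complex.conj_ofReal]
        ring
      rw [e, norm_mul, norm_pow, hwn, one_pow, one_mul]
      exact this
  refine (LDle.of_rotated_diff (Y := fun n x => d.v lam n x ^ k) (B := 1)
    (fun n x => by rw [norm_pow, norm_v h, one_pow]) hwn hw1 key).mono ?_
  rw [div_mul_eq_mul_div]
  gcongr
  rw [Complex.norm_natCast]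
  have e0 := err_nonneg h i
  have e1 := inv_le_err h i
  have e2 : (i:ℝ) * lam ≤ err H lam i := mul_le_err i
  have e3 : lam ≤ err H lam i := by nlinarith
  have hk2 : ((k - 1 : ℕ) : ℝ) ≤ k := by exact_mod_cast Nat.sub_le k 1
  have f1 : H.C0 * ((2 * d.D0) ^ (k + 1) * d.K * (H.mu ^ i)⁻¹) + ((k + 1 : ℕ) : ℝ) * (12 * (i * lam))
      ≤ (C₁ + (k + 1) * 12) * err H lam i := by
    have g1 := mul_le_mul_of_nonneg_left e1 hC₁0
    have g2 := mul_le_mul_of_nonneg_left e2 (show 0 ≤ ((k:ℝ) + 1) * 12 by positivity)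
    push_cast
    rw [hC₁] at g1 ⊢
    linarith
  have f2 : H.C0 * ((2 * d.D0) ^ (k - 1) * d.K * (H.mu ^ i)⁻¹) + ((k - 1 : ℕ) : ℝ) * (12 * (i * lam))
      ≤ (C₂ + k * 12) * err H lam i := by
    have g1 := mul_le_mul_of_nonneg_left e1 hC₂0
    have g2 := mul_le_mul_of_nonneg_left e2 (show 0 ≤ (k:ℝ) * 12 by positivity)
    have g3 : ((k - 1 : ℕ) : ℝ) * (12 * (i * lam)) ≤ k * (12 * (i * lam)) := by gcongr
    rw [hC₂] at g1 ⊢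
    linarith
  have f3 : 20 * (k:ℝ) ^ 2 * lam ^ 2 ≤ 20 * k ^ 2 * (lam * err H lam i) := by
    rw [sq lam]; gcongr
  have f4 : 0 ≤ 20 * (k:ℝ) ^ 2 * (lam * err H lam i) := by positivity
  calc _ ≤ k * (lam * ((C₁ + (k + 1) * 12) * err H lam i) +
        lam * ((C₂ + k * 12) * err H lam i)) + 20 * k ^ 2 * (lam * err H lam i) := by gcongr
    _ ≤ _ := by linarith

/-- Nonresonant powers of the phase times an observable. -/
lemma exists_nonres_obs (d : H.Data) (k : ℕ) (hk : 1 ≤ k) (hzk : d.z ^ k ≠ 1) :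
    ∃ C, 0 ≤ C ∧ ∀ lam, d.Small lam → ∀ i : ℕ, 1 ≤ i → ∀ A : ℝ, ∀ f : X → ℂ, H.Obs A f →
    LDle H.P (fun n x => (conj d.z ^ k) ^ n * d.v lam n x ^ k * f (H.T^[n] x))
      (C * A * err H lam i) := by
  obtain ⟨C₁, h1, h1'⟩ := exists_fod d k
  obtain ⟨C₂, h2, h2'⟩ := exists_nonres d k hk hzk
  refine ⟨C₁ + C₂, by positivity, fun lam h i hi A f hf => ?_⟩
  have a := h1' lam h i A f hf (fun n => (conj d.z ^ k) ^ n) (fun n => by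
    rw [norm_pow, norm_pow, RCLike.norm_conj, d.hz]; simp)
  have b := (h2' lam h i hi).const_mul (∫ y, f y ∂H.P)
  refine LDle.mono ((a.add b).congr fun n x => by ring) ?_
  have hm : ‖∫ y, f y ∂H.P‖ ≤ A := by
    simpa using norm_integral_le_of_norm_le_const (μ := H.P) (Eventually.of_forall hf.bound)
  have e0 := err_nonneg h i
  have hlam := h.1
  have hl1 : lam * err H lam i ≤ err H lam i := by nlinarith [h.2.1]
  have : ‖∫ y, f y ∂H.P‖ * (C₂ * (lam * err H lam i)) ≤ A * (C₂ * err H lam i) := by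
    have := hf.nonneg; gcongr
  linarith

end Data

end HypSys

/-! ### Window sums and their linear and quadratic contributions -/

namespace HypSys

open ComplexConjugate Szego

variable {X : Type*} [TopologicalSpace X] [CompactSpace X] [SecondCountableTopology X]
  [MeasurableSpace X] [BorelSpace X] {H : HypSys X}

namespace Data

variable {d : H.Data} {lam : ℝ}

variable (d) in
noncomputable def s (M : ℕ) (x : X) : ℂ := wS (d.beta x) M

variable (d) in
noncomputable def wx (M : ℕ) (x : X) : ℂ := wX (d.beta x) M

variable (d) in
noncomputable def τ (M : ℕ) (x : X) : ℂ := wτ (d.beta x) M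

lemma obs_beta (k : ℕ) : H.Obs d.K fun x => d.beta x k := by
  have h := (d.obs.iter k).const_mul (d.z ^ k)
  rw [norm_z_pow, one_mul] at h
  exact h

lemma obs_s (M : ℕ) : H.Obs (M * d.K) (d.s M) := by
  have h := Obs.sum (Finset.range M) (fun k _ => d.obs_beta k)
  rw [Finset.sum_const, Finset.card_range, nsmul_eq_mul] at h
  exact h

lemma obs_wx (M : ℕ) : H.Obs (2 * (M * d.K) ^ 2) (d.wx M) := by
  have hK := d.K_pos
  have h : ∀ k ∈ Finset.range M, H.Obs (2 * d.K * (M * d.K))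
      fun x => d.beta x k * conj (wS (d.beta x) k) := fun k hk =>
    ((d.obs_beta k).mul (d.obs_s k).cconj).mono (by
      have : (k:ℝ) ≤ M := by exact_mod_cast (Finset.mem_range.1 hk).le
      gcongr)
  refine (Obs.sum (Finset.range M) h).mono (le_of_eq ?_)
  simp; ring

lemma obs_wy (M : ℕ) : H.Obs (4 * (M * d.K) ^ 3) (fun x => wY (d.beta x) M) := by
  have hK := d.K_pos
  have h : ∀ k ∈ Finset.range M, H.Obs (2 * d.K * (2 * (M * d.K) ^ 2))
      fun x => d.beta x k * conj (wX (d.beta x) k) := fun k hk =>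
    ((d.obs_beta k).mul (d.obs_wx k).cconj).mono (by
      have : (k:ℝ) ≤ M := by exact_mod_cast (Finset.mem_range.1 hk).le
      gcongr)
  refine (Obs.sum (Finset.range M) h).neg.mono (le_of_eq ?_)
  simp; ring

lemma obs_τ (M : ℕ) : H.Obs (8 * (M * d.K) ^ 3) (d.τ M) :=
  ((obs_wy M).cconj.add ((obs_s M).cconj.mul (obs_wx M).cconj)).mono (le_of_eq (by ring))

lemma integral_beta (k : ℕ) : ∫ x, d.beta x k ∂H.P = 0 := by
  unfold beta
  rw [integral_const_mul, H.integral_iter k d.obs.cont, d.mean, mul_zero]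

lemma integral_s (M : ℕ) : ∫ x, d.s M x ∂H.P = 0 := by
  unfold s wS
  rw [integral_finsetSum _ fun k _ => H.integrable (d.obs_beta k).cont]
  simp [integral_beta]

lemma integral_conj_s (M : ℕ) : ∫ x, conj (d.s M x) ∂H.P = 0 := by
  rw [integral_conj, integral_s, map_zero]

lemma s_add (M N : ℕ) (x : X) : d.s (M + N) x = d.s M x + d.z ^ M * d.s N (H.T^[M] x) := by
  unfold s wS
  rw [Finset.sum_range_add, Finset.mul_sum]
  congr 1
  refine Finset.sum_congr rfl fun k _ => ?_
  rw [beta, beta, ← Function.iterate_add_apply, add_comm M k, pow_add]; ring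

lemma past_s (n M : ℕ) : H.Past (n + M) (M * d.K) fun x => d.s M (H.T^[n] x) := by
  have h : ∀ k ∈ Finset.range M, H.Past (n + M) d.K fun x => d.beta (H.T^[n] x) k := by
    intro k hk
    have h1 := ((d.past_α (n + k)).const_mul (d.z ^ k)).mono
      (show n + k ≤ n + M by have := Finset.mem_range.1 hk; omega) (le_refl _)
    rw [norm_z_pow, one_mul] at h1
    convert h1 using 2 with x
    rw [beta, ← Function.iterate_add_apply, add_comm n k]
  have h2 := Past.sum (Finset.range M) h
  rw [Finset.card_range] at h2
  exact h2

/-- Subtracting the two windows leaves only times from `6i` on, far ahead of the initial phase. -/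
lemma s_diff (i : ℕ) (x : X) :
    d.s (9 * i) x - d.s (6 * i) x = d.z ^ (6 * i) * d.s (3 * i) (H.T^[6 * i] x) := by
  have : 9 * i = 6 * i + 3 * i := by ring
  rw [this, s_add]; ring

/-- Linear window terms are negligible. -/
lemma exists_linear_window (d : H.Data) (m : ℕ) : ∃ C, 0 ≤ C ∧ ∀ lam, d.Small lam → ∀ i : ℕ,
    ∀ w : ℕ → ℂ, (∀ n, ‖w n‖ ≤ 1) →
    LDle H.P (fun n x => w n * d.v lam n x ^ m * (d.s (9 * i) (H.T^[n] x) - d.s (6 * i) (H.T^[n] x)))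
      (C * (i * (H.mu ^ i)⁻¹)) ∧
    LDle H.P (fun n x => w n * d.v lam n x ^ m *
      conj (d.s (9 * i) (H.T^[n] x) - d.s (6 * i) (H.T^[n] x))) (C * (i * (H.mu ^ i)⁻¹)) := by
  have hD := one_le_D0 (d := d)
  have hC0 := H.C0_nonneg
  have hK := d.K_pos
  refine ⟨H.C0 * ((2 * d.D0) ^ m * (3 * d.K)), by positivity, fun lam h i w hw => ?_⟩
  have key : ∀ u : ℂ, ‖u‖ = 1 → ∀ f : X → ℂ, H.Obs ((3 * i : ℕ) * d.K) f → ∫ x, f x ∂H.P = 0 →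
      LDle H.P (fun n x => w n * u * d.v lam n x ^ m * f (H.T^[n + 6 * i] x))
        (H.C0 * ((2 * d.D0) ^ m * (3 * d.K)) * (i * (H.mu ^ i)⁻¹)) := by
    intro u hu f hf hf0
    refine LDle.mono (ldle_decouple (q := 0) (j := 6 * i) (i := i)
      (G := fun n x => w n * u * d.v lam n x ^ m) (D := (2 * d.D0) ^ m)
      (fun n => (((past_v h n).pow m).const_mul _).mono le_rfl
        (mul_le_of_le_one_left (by positivity) (by rw [norm_mul, hu, mul_one]; exact hw n)))
      hf hf0 (by omega)) (le_of_eq ?_)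
    push_cast; ring
  constructor
  · refine (key (d.z ^ (6 * i)) (norm_z_pow _) (d.s (3 * i)) (obs_s _) (integral_s _)).congr
      fun n x => ?_
    rw [s_diff, ← Function.iterate_add_apply, add_comm (6 * i) n]; ring
  · refine (key (conj (d.z ^ (6 * i))) (by rw [RCLike.norm_conj, norm_z_pow])
      (fun x => conj (d.s (3 * i) x)) (obs_s _).cconj (integral_conj_s _)).congr fun n x => ?_
    rw [s_diff, ← Function.iterate_add_apply, add_comm (6 * i) n, map_mul]; ring

/-- The nonresonant quadratic window terms, to second order. -/
lemma exists_quadratic_window (d : H.Data) (hz2 : d.z ^ 2 ≠ 1) :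
    ∃ C, 0 ≤ C ∧ ∀ lam, d.Small lam → ∀ i : ℕ, 1 ≤ i →
    LDle H.P (fun n x => (conj d.z ^ 2) ^ n * d.v lam n x ^ 2 *
      conj (d.s (9 * i) (H.T^[n] x) ^ 2 - d.s (6 * i) (H.T^[n] x) ^ 2))
      (C * (i ^ 2 * ((H.mu ^ i)⁻¹ + lam * err H lam i))) := by
  have hD := one_le_D0 (d := d)
  have hC0 := H.C0_nonneg
  have hK := d.K_pos
  -- The cruder bound of `exists_nonres_obs` has an error `i λ` that would give a term of order `λ³
  -- i³` in the growth. Decoupling the fluctuation exactly and using nonresonance only for the mean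
  -- gains one more power of `λ`.
  obtain ⟨C₁, h1, h1'⟩ := exists_nonres d 2 (by norm_num) hz2
  refine ⟨H.C0 * (2 * (2 * (2 * d.D0) ^ 2 * (3 * d.K)) * (3 * d.K)) +
    H.C0 * ((2 * d.D0) ^ 2 * (2 * (54 * d.K ^ 2))) + 54 * d.K ^ 2 * C₁, by positivity,
    fun lam h i hi => ?_⟩
  have hwn : ∀ n : ℕ, ‖(conj d.z ^ 2) ^ n‖ = 1 := fun n => by
    rw [norm_pow, norm_pow, RCLike.norm_conj, d.hz]; simp
  -- the product of the far window with the near past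
  have A := ldle_decouple (q := 3 * i) (j := 6 * i) (i := i)
      (G := fun n x => (2 * (conj d.z ^ 2) ^ n * conj (d.z ^ (6 * i))) *
        (d.v lam n x ^ 2 * conj (d.s (3 * i) (H.T^[n] x))))
      (D := 2 * (2 * (2 * d.D0) ^ 2 * ((3 * i : ℕ) * d.K)))
      (f := fun x => conj (d.s (3 * i) x)) (C := (3 * i : ℕ) * d.K)
      (fun n => (((((past_v h n).pow 2).mono (show n ≤ n + 3 * i by omega) le_rfl).mul
        (past_s n (3 * i)).cconj).const_mul _).mono le_rfl (by
          rw [norm_mul, norm_mul, hwn, RCLike.norm_conj, norm_z_pow]; simp))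
      (obs_s _).cconj (integral_conj_s _) (by omega)
  -- Divide `[0, 9i)` into three blocks. The difference of squares consists of the square of the
  -- last block and twice its products with the first two. The product with the first block was
  -- treated in `A`; the rest, as seen from time `n + 3i`, is `g`, which splits into a centered part
  -- (`B`) and its mean (`D`).
  set g : X → ℂ := fun x => conj (d.z ^ (12 * i) * (d.s (3 * i) (H.T^[3 * i] x) *
    d.s (3 * i) (H.T^[3 * i] x)) + 2 * d.z ^ (9 * i) * (d.s (3 * i) (H.T^[3 * i] x) *
    d.s (3 * i) x)) with hg
  have og : H.Obs (54 * d.K ^ 2 * i ^ 2) g := by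
    have o3 := d.obs_s (3 * i)
    have o4 := o3.iter (3 * i)
    refine (((o4.mul o4).const_mul (d.z ^ (12 * i))).add
      ((o4.mul o3).const_mul (2 * d.z ^ (9 * i)))).cconj.mono (le_of_eq ?_)
    rw [norm_mul, norm_z_pow, norm_z_pow, Complex.norm_ofNat]; push_cast; ring
  have B := ldle_decouple (q := 0) (j := 3 * i) (i := i)
      (G := fun n x => (conj d.z ^ 2) ^ n * d.v lam n x ^ 2) (D := (2 * d.D0) ^ 2)
      (fun n => (((past_v h n).pow 2).const_mul _).mono le_rfl (by rw [hwn, one_mul]))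
      og.sub_integral og.integral_sub_integral (by omega)
  have D := (h1' lam h i hi).const_mul (∫ y, g y ∂H.P)
  refine LDle.mono (((A.add B).add D).congr fun n x => ?_) ?_
  · have e6 : d.s (6 * i) (H.T^[n] x) = d.s (3 * i) (H.T^[n] x) +
        d.z ^ (3 * i) * d.s (3 * i) (H.T^[n + 3 * i] x) := by
      have : 6 * i = 3 * i + 3 * i := by ring
      rw [this, s_add, ← Function.iterate_add_apply, add_comm (3 * i) n]
    have e9 : d.s (9 * i) (H.T^[n] x) = d.s (6 * i) (H.T^[n] x) +
        d.z ^ (6 * i) * d.s (3 * i) (H.T^[n + 6 * i] x) := by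
      have := d.s_diff i (H.T^[n] x)
      rw [← Function.iterate_add_apply, add_comm (6 * i) n] at this
      linear_combination this
    have eg : g (H.T^[n + 3 * i] x) = conj (d.z ^ (12 * i) * (d.s (3 * i) (H.T^[n + 6 * i] x) *
        d.s (3 * i) (H.T^[n + 6 * i] x)) + 2 * d.z ^ (9 * i) * (d.s (3 * i) (H.T^[n + 6 * i] x) *
        d.s (3 * i) (H.T^[n + 3 * i] x))) := by
      have : 3 * i + (n + 3 * i) = n + 6 * i := by ring
      simp only [hg, ← Function.iterate_add_apply, this]
    rw [eg, e9, e6]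
    simp only [map_add, map_sub, map_mul, map_pow, map_ofNat]
    have p1 : conj d.z ^ (12 * i) = conj d.z ^ (6 * i) * conj d.z ^ (6 * i) := by
      rw [← pow_add]; ring_nf
    have p2 : conj d.z ^ (9 * i) = conj d.z ^ (6 * i) * conj d.z ^ (3 * i) := by
      rw [← pow_add]; ring_nf
    rw [p1, p2]
    ring
  · have hm : ‖∫ y, g y ∂H.P‖ ≤ 54 * d.K ^ 2 * i ^ 2 := by
      simpa using norm_integral_le_of_norm_le_const (μ := H.P) (Eventually.of_forall og.bound)
    have e0 := err_nonneg h i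
    have hlam := h.1
    have hmu := H.mu_pow_pos i
    have : ‖∫ y, g y ∂H.P‖ * (C₁ * (lam * err H lam i)) ≤
      54 * d.K ^ 2 * i ^ 2 * (C₁ * (lam * err H lam i)) := by gcongr
    push_cast
    have p1 : 0 ≤ H.C0 * (2 * (2 * (2 * d.D0) ^ 2 * (3 * d.K)) * (3 * d.K)) *
      (i ^ 2 * (lam * err H lam i)) := by positivity
    have p2 : 0 ≤ H.C0 * ((2 * d.D0) ^ 2 * (2 * (54 * d.K ^ 2))) *
      (i ^ 2 * (lam * err H lam i)) := by positivity
    have p3 : 0 ≤ 54 * d.K ^ 2 * C₁ * (i ^ 2 * (H.mu ^ i)⁻¹) := by positivity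
    nlinarith

end Data

end HypSys

/-! ### Growth over a window up to the resonant term -/

lemma LDle.nonneg {X : Type*} [MeasurableSpace X] {P : Measure X}
    [IsProbabilityMeasure P] {Y : ℕ → X → ℂ} {ε : ℝ} (h : LDle P Y ε) : 0 ≤ ε := by
  by_contra! hneg
  obtain ⟨c, hc, N₀, hN⟩ := h (ε / 2) (by linarith)
  have h0 : (0:ℝ) < ((N₀ + 1 : ℕ) : ℝ) := by positivity
  have h2 : {x : X | ε / 2 * ((N₀ + 1 : ℕ) : ℝ) < ‖∑ n ∈ Finset.range (N₀ + 1), Y n x‖} =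
      Set.univ := by
    ext x
    simp only [Set.mem_ofPred_eq, Set.mem_univ, iff_true]
    exact lt_of_lt_of_le (by nlinarith) (norm_nonneg _)
  have h1 : P.real {x : X | ε / 2 * ((N₀ + 1 : ℕ) : ℝ) < ‖∑ n ∈ Finset.range (N₀ + 1), Y n x‖} ≤
    Real.exp (-(c * ((N₀ + 1 : ℕ) : ℝ))) := hN (N₀ + 1) (by omega)
  rw [h2, probReal_univ] at h1
  have h3 : Real.exp (-(c * ((N₀ + 1 : ℕ) : ℝ))) < 1 := by
    rw [Real.exp_lt_one_iff]
    nlinarith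
  linarith

namespace HypSys

open ComplexConjugate Szego

variable {X : Type*} [TopologicalSpace X] [CompactSpace X] [SecondCountableTopology X]
  [MeasurableSpace X] [BorelSpace X] {H : HypSys X}

namespace Data

variable {d : H.Data} {lam : ℝ}

variable (d) in
/-- The logarithmic growth at time `n`. -/
noncomputable def ξ (lam : ℝ) (n : ℕ) (x : X) : ℝ := xi (d.b lam x n) (d.v lam n x)

variable (d) in
/-- Increment of the mean square of the window sums. -/
noncomputable def m2 (i : ℕ) : ℂ :=
  ∫ x, (d.s (9 * i) x * conj (d.s (9 * i) x) - d.s (6 * i) x * conj (d.s (6 * i) x)) ∂H.P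

variable (d) in
/-- Increment of the third moment of the window sums. -/
noncomputable def m3 (i : ℕ) : ℂ :=
  ∫ x, (conj (d.s (9 * i) x ^ 3 - d.s (6 * i) x ^ 3)) ∂H.P

lemma obs_window_sq (i : ℕ) : H.Obs (400 * d.K ^ 2 * i ^ 2)
    fun x => d.s (9 * i) x * conj (d.s (9 * i) x) - d.s (6 * i) x * conj (d.s (6 * i) x) := by
  refine (((d.obs_s (9 * i)).mul (d.obs_s (9 * i)).cconj).sub
    ((d.obs_s (6 * i)).mul (d.obs_s (6 * i)).cconj)).mono ?_
  push_cast; nlinarith [show 0 ≤ d.K ^ 2 * (i:ℝ) ^ 2 by positivity]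

lemma obs_window_sq' (i : ℕ) : H.Obs (400 * d.K ^ 2 * i ^ 2)
    fun x => d.s (9 * i) x ^ 2 - d.s (6 * i) x ^ 2 := by
  simp only [sq (d.s _ _)]
  refine (((d.obs_s (9 * i)).mul (d.obs_s (9 * i))).sub
    ((d.obs_s (6 * i)).mul (d.obs_s (6 * i)))).mono ?_
  push_cast; nlinarith [show 0 ≤ d.K ^ 2 * (i:ℝ) ^ 2 by positivity]

lemma obs_window_cube (i : ℕ) : H.Obs (5000 * d.K ^ 3 * i ^ 3)
    fun x => conj (d.s (9 * i) x ^ 3 - d.s (6 * i) x ^ 3) := by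
  have e : ∀ w : ℂ, w ^ 3 = w * w * w := fun w => by ring
  simp only [e]
  refine ((((d.obs_s (9 * i)).mul (d.obs_s (9 * i))).mul (d.obs_s (9 * i))).sub
    (((d.obs_s (6 * i)).mul (d.obs_s (6 * i))).mul (d.obs_s (6 * i)))).cconj.mono ?_
  have := d.K_pos
  push_cast; nlinarith [show 0 ≤ d.K ^ 3 * (i:ℝ) ^ 3 by positivity]

lemma obs_window_τ (i : ℕ) : H.Obs (10000 * d.K ^ 3 * i ^ 3)
    fun x => d.τ (9 * i) x - d.τ (6 * i) x := by
  refine ((d.obs_τ (9 * i)).sub (d.obs_τ (6 * i))).mono ?_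
  have := d.K_pos
  push_cast; nlinarith [show 0 ≤ d.K ^ 3 * (i:ℝ) ^ 3 by positivity]

lemma obs_window_wx (i : ℕ) : H.Obs (1000 * d.K ^ 2 * i ^ 2)
    fun x => (d.wx (9 * i) x - conj (d.wx (9 * i) x)) - (d.wx (6 * i) x - conj (d.wx (6 * i) x)) := by
  refine (((d.obs_wx (9 * i)).sub (d.obs_wx (9 * i)).cconj).sub
    ((d.obs_wx (6 * i)).sub (d.obs_wx (6 * i)).cconj)).mono ?_
  push_cast; nlinarith [show 0 ≤ d.K ^ 2 * (i:ℝ) ^ 2 by positivity]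

lemma sum_ξ_approx (h : d.Small lam) (M n : ℕ) (x : X) (hM : M * lam ≤ 1 / 8) :
    |∑ k ∈ Finset.range M, d.ξ lam (n + k) x -
      (growthPoly (fun k => (lam * d.z ^ (n + 1)) * d.beta (H.T^[n] x) k) (d.v lam n x) M).re| ≤
      102 * (M * lam) ^ 4 := by
  have h1 := sum_xi_approx (norm_c_beta_le h n x) (norm_v h n x) M hM h.2.1
  have h2 : ∑ k ∈ Finset.range M, d.ξ lam (n + k) x = ∑ k ∈ Finset.range M,
      xi ((lam * d.z ^ (n + 1)) * d.beta (H.T^[n] x) k)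
        (vSeq (fun k => (lam * d.z ^ (n + 1)) * d.beta (H.T^[n] x) k) (d.v lam n x) k) :=
    Finset.sum_congr rfl fun k _ => by rw [ξ, b_add, v_add]
  rw [h2]; exact h1

lemma c_mul_conj (n : ℕ) : ((lam : ℂ) * d.z ^ (n + 1)) * conj ((lam : ℂ) * d.z ^ (n + 1)) =
    (lam : ℂ) ^ 2 := by
  rw [map_mul, Complex.conj_ofReal]
  linear_combination (lam : ℂ) ^ 2 * conj_z_pow_mul (d := d) (n + 1)

/-- The rotation `z^(n+1)` is pulled out of each term: a term with `v^k` carries `(conj z^k)^n`, so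
only the `|s|²` term is stationary for every `z`. -/
lemma growthPoly_eq (n M : ℕ) (x : X) (v : ℂ) :
    growthPoly (fun k => (lam * d.z ^ (n + 1)) * d.beta (H.T^[n] x) k) v M =
      -(2 * lam * conj d.z) * (conj d.z ^ n * v ^ 1 * conj (d.s M (H.T^[n] x))) +
      (lam : ℂ) ^ 2 * (d.s M (H.T^[n] x) * conj (d.s M (H.T^[n] x))) -
      ((lam : ℂ) ^ 2 * conj d.z ^ 2) * ((conj d.z ^ 2) ^ n * v ^ 2 * conj (d.s M (H.T^[n] x) ^ 2)) +
      (2 * (lam : ℂ) ^ 3 * conj d.z) * (conj d.z ^ n * v ^ 1 * d.τ M (H.T^[n] x)) -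
      (2 / 3 * (lam : ℂ) ^ 3 * conj d.z ^ 3) *
        ((conj d.z ^ 3) ^ n * v ^ 3 * conj (d.s M (H.T^[n] x) ^ 3)) := by
  have h := c_mul_conj (d := d) (lam := lam) n
  rw [growthPoly, wS_smul, wτ_smul, h]
  have h2 : (lam : ℂ) * d.z ^ (n + 1) * d.s M (H.T^[n] x) *
    conj ((lam : ℂ) * d.z ^ (n + 1) * d.s M (H.T^[n] x)) =
      (lam : ℂ) ^ 2 * (d.s M (H.T^[n] x) * conj (d.s M (H.T^[n] x))) := by
    rw [map_mul]; linear_combination (d.s M (H.T^[n] x) * conj (d.s M (H.T^[n] x))) * h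
  change -2 * (conj (lam * d.z ^ (n + 1) * d.s M (H.T^[n] x)) * v) +
    lam * d.z ^ (n + 1) * d.s M (H.T^[n] x) * conj (lam * d.z ^ (n + 1) * d.s M (H.T^[n] x)) -
    conj (lam * d.z ^ (n + 1) * d.s M (H.T^[n] x)) ^ 2 * v ^ 2 +
    2 * (conj (lam * d.z ^ (n + 1)) * (lam : ℂ) ^ 2 * d.τ M (H.T^[n] x) * v) -
    2 / 3 * (conj (lam * d.z ^ (n + 1) * d.s M (H.T^[n] x)) ^ 3 * v ^ 3) = _
  rw [h2]
  simp only [map_mul, map_pow, Complex.conj_ofReal]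
  ring

/-- The growth over a window, up to the resonant third order term. -/
theorem exists_growth (d : H.Data) (hz1 : d.z ≠ 1) (hz2 : d.z ^ 2 ≠ 1) :
    ∃ C, 0 ≤ C ∧ ∀ lam, d.Small lam → ∀ i : ℕ, 1 ≤ i → 9 * i * lam ≤ 1 / 8 → ∀ ε,
    LDle H.P (fun n x => d.m3 i * ((conj d.z ^ 3) ^ n * d.v lam n x ^ 3)) ε →
    LDle H.P (fun n x => ((∑ k ∈ Finset.Ico (6 * i) (9 * i), d.ξ lam (n + k) x -
      lam ^ 2 * (d.m2 i).re : ℝ) : ℂ))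
      (C * (i ^ 4 * (lam * (H.mu ^ i)⁻¹ + lam ^ 4)) + lam ^ 3 * ε) := by
  have hK := d.K_pos
  obtain ⟨C₁, p1, hC₁⟩ := exists_linear_window d 1
  obtain ⟨C₂, p2, hC₂⟩ := exists_quadratic_window d hz2
  obtain ⟨C₃, p3, hC₃⟩ := exists_nonres_obs d 1 le_rfl (by rwa [pow_one])
  obtain ⟨C₅, p5, hC₅⟩ := exists_fod d 3
  refine ⟨2 * C₁ + 2 * C₂ + 2 * C₃ * (10000 * d.K ^ 3) + C₅ * (5000 * d.K ^ 3) + 2000000,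
    by positivity, fun lam h i hi hil ε hε => ?_⟩
  have hlam := h.1
  have hzc : ‖conj d.z‖ = 1 := by rw [RCLike.norm_conj, d.hz]
  -- `T1` to `T5` treat the five terms of `growthPoly_eq` in order. In `T5` only the fluctuation of
  -- the cubic coefficient is decoupled; its mean `m3` is left to the hypothesis `hε`.
  have T1 := ((hC₁ lam h i (fun n => conj d.z ^ n) (fun n => by rw [norm_pow, hzc, one_pow])).2).const_mul
    (-(2 * lam * conj d.z))
  have T2 := ((ldle_birkhoff_mean (d.obs_window_sq i)).const_mul ((lam : ℂ) ^ 2))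
  have T3 := (hC₂ lam h i hi).const_mul ((lam : ℂ) ^ 2 * conj d.z ^ 2)
  have T4 := (hC₃ lam h i hi _ _ (d.obs_window_τ i)).const_mul (2 * (lam : ℂ) ^ 3 * conj d.z)
  have T5 := ((hC₅ lam h i _ _ (d.obs_window_cube i) (fun n => (conj d.z ^ 3) ^ n)
    (fun n => by rw [norm_pow, norm_pow, hzc]; simp)).add hε).const_mul
      (2 / 3 * (lam : ℂ) ^ 3 * conj d.z ^ 3)
  have T := (((((T1.add T2).sub T3).add T4).sub T5).re).of_norm_sub_le (δ := 204 * (9 * i * lam) ^ 4)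
    (Z := fun n x => ((∑ k ∈ Finset.Ico (6 * i) (9 * i), d.ξ lam (n + k) x -
      lam ^ 2 * (d.m2 i).re : ℝ) : ℂ)) (fun n x => ?_)
  · refine T.mono ?_
    simp only [norm_mul, norm_neg, norm_pow, hzc, Complex.norm_real, Real.norm_of_nonneg hlam.le,
      norm_div, Complex.norm_ofNat, one_pow, mul_one]
    have hi1 : (1:ℝ) ≤ i := by exact_mod_cast hi
    have hmu : 0 < (H.mu ^ i)⁻¹ := inv_pos.2 (H.mu_pow_pos i)
    set q := (H.mu ^ i)⁻¹ with hq
    have hq1 : q ≤ 1 := inv_le_one_of_one_le₀ (one_le_pow₀ H.one_lt_mu.le)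
    have hl1 : lam ≤ 1 := by linarith [h.2.1]
    have he : err H lam i = q + i * lam := rfl
    have he0 := err_nonneg h i
    have i14 : (i:ℝ) ≤ i ^ 4 := le_self_pow₀ hi1 (by norm_num)
    have i24 : (i:ℝ) ^ 2 ≤ i ^ 4 := pow_le_pow_right₀ hi1 (by norm_num)
    have i34 : (i:ℝ) ^ 3 ≤ i ^ 4 := pow_le_pow_right₀ hi1 (by norm_num)
    have l2 : lam ^ 2 ≤ lam := by nlinarith
    have l3 : lam ^ 3 ≤ lam := by nlinarith
    set Q := i ^ 4 * (lam * q + lam ^ 4) with hQ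
    have hQ0 : 0 ≤ Q := by positivity
    have g1 : lam * (i * q) ≤ Q := by
      have : lam * (i * q) ≤ lam * (i ^ 4 * q) := by gcongr
      have : 0 ≤ (i:ℝ) ^ 4 * lam ^ 4 := by positivity
      rw [hQ]; linarith
    have g2 : lam ^ 2 * (i ^ 2 * (q + lam * err H lam i)) ≤ 2 * Q := by
      have e : lam ^ 2 * (i ^ 2 * (q + lam * err H lam i)) =
        i ^ 2 * (lam ^ 2 * q) + i ^ 2 * (lam ^ 3 * q) + i ^ 3 * lam ^ 4 := by rw [he]; ring
      have a1 : (i:ℝ) ^ 2 * (lam ^ 2 * q) ≤ i ^ 4 * (lam * q) := by gcongr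
      have a2 : (i:ℝ) ^ 2 * (lam ^ 3 * q) ≤ i ^ 4 * (lam * q) := by gcongr
      have a3 : (i:ℝ) ^ 3 * lam ^ 4 ≤ i ^ 4 * lam ^ 4 := by gcongr
      have : 0 ≤ (i:ℝ) ^ 4 * lam ^ 4 := by positivity
      rw [e, hQ]; linarith
    have g3 : lam ^ 3 * (i ^ 3 * err H lam i) ≤ Q := by
      have e : lam ^ 3 * (i ^ 3 * err H lam i) = i ^ 3 * (lam ^ 3 * q) + i ^ 4 * lam ^ 4 := by
        rw [he]; ring
      have a1 : (i:ℝ) ^ 3 * (lam ^ 3 * q) ≤ i ^ 4 * (lam * q) := by gcongr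
      rw [e, hQ]; linarith
    have g4 : (9 * i * lam) ^ 4 ≤ 6561 * Q := by
      have : 0 ≤ (i:ℝ) ^ 4 * (lam * q) := by positivity
      rw [hQ]; nlinarith
    have hε0 : 0 ≤ ε := hε.nonneg
    have b1 := mul_le_mul_of_nonneg_left g1 (show 0 ≤ 2 * C₁ by positivity)
    have b2 := mul_le_mul_of_nonneg_left g2 p2
    have b3 := mul_le_mul_of_nonneg_left g3 (show 0 ≤ 2 * C₃ * (10000 * d.K ^ 3) by positivity)
    have b5 := mul_le_mul_of_nonneg_left g3 (show 0 ≤ C₅ * (5000 * d.K ^ 3) by positivity)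
    have b6 : 0 ≤ lam ^ 3 * ε := by positivity
    have b7 : 0 ≤ C₅ * (5000 * d.K ^ 3) * (lam ^ 3 * (i ^ 3 * err H lam i)) := by positivity
    nlinarith
  · have e1 : ∑ k ∈ Finset.Ico (6 * i) (9 * i), d.ξ lam (n + k) x =
        ∑ k ∈ Finset.range (9 * i), d.ξ lam (n + k) x - ∑ k ∈ Finset.range (6 * i), d.ξ lam (n + k) x :=
      Finset.sum_Ico_eq_sub _ (by omega)
    have f1 := sum_ξ_approx h (9 * i) n x (by push_cast; exact hil)
    have f2 := sum_ξ_approx h (6 * i) n x (by push_cast; nlinarith [h.1, (Nat.cast_nonneg i : (0:ℝ) ≤ i)])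
    rw [growthPoly_eq] at f1 f2
    rw [e1, ← Complex.ofReal_sub, Complex.norm_real, Real.norm_eq_abs]
    have f3 : ((6 * i : ℕ) * lam) ^ 4 ≤ (9 * i * lam) ^ 4 := by
      have := h.1; push_cast; gcongr; norm_num
    have f4 : ((9 * i : ℕ) * lam) ^ 4 = (9 * i * lam) ^ 4 := by push_cast; rfl
    rw [f4] at f1
    have e2 : ((lam : ℂ) ^ 2 * d.m2 i).re = lam ^ 2 * (d.m2 i).re := by
      rw [← Complex.ofReal_pow, Complex.re_ofReal_mul]
    rw [← e2]
    have : ∀ a b p q m r E : ℝ, |a - p| ≤ 102 * E → |b - q| ≤ 102 * E → r = p - q - m →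
        |a - b - m - r| ≤ 204 * E := by
      intro a b p q m r E h1 h2 h3
      rw [abs_le] at *
      constructor <;> linarith [h1.1, h1.2, h2.1, h2.2]
    refine this _ _ _ _ _ _ _ f1 (f2.trans (by linarith)) ?_
    rw [← Complex.sub_re, ← Complex.sub_re]
    congr 1
    simp only [m2, m3, map_sub]
    ring

end Data

end HypSys

/-! ### Cubes of the phases at a third root of unity -/

namespace HypSys

open ComplexConjugate Szego

variable {X : Type*} [TopologicalSpace X] [CompactSpace X] [SecondCountableTopology X]
  [MeasurableSpace X] [BorelSpace X] {H : HypSys X}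

namespace Data

variable {d : H.Data} {lam : ℝ}

lemma v_cube_approx (h : d.Small lam) (M n : ℕ) (x : X) (hM : M * lam ≤ 1 / 16) :
    ‖d.v lam (n + M) x ^ 3 -
      cubeWin (fun k => (lam * d.z ^ (n + 1)) * d.beta (H.T^[n] x) k) (d.v lam n x) M‖ ≤
      20000 * (M * lam) ^ 3 := by
  rw [v_add]
  exact vSeq_cube_approx (norm_c_beta_le h n x) (norm_v h n x) M hM h.2.1

/-- When `z³ = 1` the rotation attached to `v^5` is `conj z^(2n) = conj z^(5n)` and the one attached
to `v` is `z^(2n) = conj z^n`, so both quadratic terms have the form that `exists_nonres_obs`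
handles. Only the `v³` terms do not rotate. -/
lemma cubeWin_eq (hz3 : d.z ^ 3 = 1) (n M : ℕ) (x : X) (v : ℂ) :
    cubeWin (fun k => (lam * d.z ^ (n + 1)) * d.beta (H.T^[n] x) k) v M =
      v ^ 3 + (3 * lam * conj d.z) * (conj d.z ^ n * v ^ 4 * conj (d.s M (H.T^[n] x))) -
      (3 * lam * d.z) * (d.z ^ n * v ^ 2 * d.s M (H.T^[n] x)) +
      (6 * lam ^ 2 * conj d.z ^ 2) * ((conj d.z ^ 5) ^ n * v ^ 5 * conj (d.s M (H.T^[n] x) ^ 2)) +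
      (3 * lam ^ 2 * d.z ^ 2) * ((conj d.z ^ 1) ^ n * v ^ 1 * d.s M (H.T^[n] x) ^ 2) +
      lam ^ 2 * (1 * v ^ 3 * (-9 * (d.s M (H.T^[n] x) * conj (d.s M (H.T^[n] x))) +
        3 * (d.wx M (H.T^[n] x) - conj (d.wx M (H.T^[n] x))))) := by
  have h := c_mul_conj (d := d) (lam := lam) n
  have h3 : conj d.z ^ 3 = 1 := by rw [← map_pow, hz3, map_one]
  have h5 : conj d.z ^ 5 = conj d.z ^ 2 := by
    rw [show (5:ℕ) = 3 + 2 from rfl, pow_add, h3, one_mul]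
  have h1 : conj d.z ^ 1 = d.z ^ 2 := by
    have := conj_z_mul (d := d)
    linear_combination d.z ^ 2 * this - (conj d.z) * hz3
  rw [cubeWin, wS_smul, wX_smul, h, h5, h1]
  change v ^ 3 + 3 * (conj (lam * d.z ^ (n + 1) * d.s M (H.T^[n] x)) * v ^ 4) -
    3 * (lam * d.z ^ (n + 1) * d.s M (H.T^[n] x) * v ^ 2) +
    6 * (conj (lam * d.z ^ (n + 1) * d.s M (H.T^[n] x)) ^ 2 * v ^ 5) +
    3 * ((lam * d.z ^ (n + 1) * d.s M (H.T^[n] x)) ^ 2 * v) -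
    9 * (lam * d.z ^ (n + 1) * d.s M (H.T^[n] x) *
      conj (lam * d.z ^ (n + 1) * d.s M (H.T^[n] x)) * v ^ 3) +
    3 * ((lam ^ 2 * d.wx M (H.T^[n] x) - conj (lam ^ 2 * d.wx M (H.T^[n] x))) * v ^ 3) = _
  have h2 : lam * d.z ^ (n + 1) * d.s M (H.T^[n] x) *
    conj (lam * d.z ^ (n + 1) * d.s M (H.T^[n] x)) =
      (lam : ℂ) ^ 2 * (d.s M (H.T^[n] x) * conj (d.s M (H.T^[n] x))) := by
    rw [map_mul]; linear_combination (d.s M (H.T^[n] x) * conj (d.s M (H.T^[n] x))) * h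
  rw [h2]
  simp only [map_mul, map_pow, Complex.conj_ofReal]
  ring

/-- At a third root of unity the cubes of the phases average out when the asymptotic variance
does not vanish. -/
theorem exists_cube (d : H.Data) (hz1 : d.z ≠ 1) (hz3 : d.z ^ 3 = 1) :
    ∃ C, 0 ≤ C ∧ ∀ lam, d.Small lam → ∀ i : ℕ, 1 ≤ i → 9 * i * lam ≤ 1 / 16 →
    (d.m2 i).re ≠ 0 →
    LDle H.P (fun n x => d.v lam n x ^ 3)
      (C * (i ^ 3 * (lam⁻¹ * (H.mu ^ i)⁻¹ + lam)) / |(d.m2 i).re|) := by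
  have hK := d.K_pos
  have hz5 : d.z ^ 5 ≠ 1 := by
    intro h5
    apply hz1
    have : d.z ^ 2 = 1 := by linear_combination h5 - d.z ^ 2 * hz3
    linear_combination hz3 - d.z * this
  obtain ⟨C₁, p1, hC₁⟩ := exists_linear_window d 4
  obtain ⟨C₂, p2, hC₂⟩ := exists_linear_window d 2
  obtain ⟨C₃, p3, hC₃⟩ := exists_nonres_obs d 5 (by norm_num) hz5
  obtain ⟨C₄, p4, hC₄⟩ := exists_nonres_obs d 1 le_rfl (by rwa [pow_one])
  obtain ⟨C₅, p5, hC₅⟩ := exists_fod d 3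
  refine ⟨3 * C₁ + 3 * C₂ + 6 * C₃ * (400 * d.K ^ 2) + 3 * C₄ * (400 * d.K ^ 2) +
    C₅ * (6600 * d.K ^ 2) + 40000 * 729, by positivity, fun lam h i hi hil hm0 => ?_⟩
  have hlam := h.1
  have hzc : ‖conj d.z‖ = 1 := by rw [RCLike.norm_conj, d.hz]
  set f : X → ℂ := fun x =>
    -9 * (d.s (9 * i) x * conj (d.s (9 * i) x) - d.s (6 * i) x * conj (d.s (6 * i) x)) +
    3 * ((d.wx (9 * i) x - conj (d.wx (9 * i) x)) - (d.wx (6 * i) x - conj (d.wx (6 * i) x))) with hf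
  have of : H.Obs (6600 * d.K ^ 2 * i ^ 2) f := by
    refine (((d.obs_window_sq i).const_mul (-9)).add ((d.obs_window_wx i).const_mul 3)).mono
      (le_of_eq ?_)
    rw [norm_neg, Complex.norm_ofNat, Complex.norm_ofNat]; ring
  set m := ∫ x, f x ∂H.P with hm
  -- `wx - conj wx` is purely imaginary, so it cannot cancel the drift.
  have hmre : m.re = -9 * (d.m2 i).re := by
    have e : m = -9 * d.m2 i + 3 * ∫ x, ((d.wx (9 * i) x - conj (d.wx (9 * i) x)) -
        (d.wx (6 * i) x - conj (d.wx (6 * i) x))) ∂H.P := by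
      rw [m2, ← integral_const_mul, ← integral_const_mul, ← integral_add]
      · exact H.integrable ((d.obs_window_sq i).const_mul (-9)).cont
      · exact H.integrable ((d.obs_window_wx i).const_mul 3).cont
    have e2 : (∫ x, ((d.wx (9 * i) x - conj (d.wx (9 * i) x)) -
        (d.wx (6 * i) x - conj (d.wx (6 * i) x))) ∂H.P).re = 0 := by
      have := integral_re (𝕜 := ℂ) (H.integrable (d.obs_window_wx i).cont)
      refine Eq.trans this.symm ?_
      simp
    rw [e, Complex.add_re]
    have a1 : (-9 * d.m2 i).re = -9 * (d.m2 i).re := by simp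
    have a2 : ∀ w : ℂ, (3 * w).re = 3 * w.re := fun w => by simp
    rw [a1, a2, e2]; ring
  have hmn : 9 * |(d.m2 i).re| ≤ ‖m‖ := by
    have := Complex.abs_re_le_norm m
    rw [hmre, abs_mul] at this
    simpa using this
  have hm2 : 0 < |(d.m2 i).re| := abs_pos.2 hm0
  have T1 := ((hC₁ lam h i (fun n => conj d.z ^ n) (fun n => by rw [norm_pow, hzc, one_pow])).2).const_mul
    (3 * lam * conj d.z)
  have T2 := ((hC₂ lam h i (fun n => d.z ^ n) (fun n => by rw [norm_pow, d.hz, one_pow])).1).const_mul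
    (3 * lam * d.z)
  have T3 := (hC₃ lam h i hi _ _ (d.obs_window_sq' i).cconj).const_mul (6 * lam ^ 2 * conj d.z ^ 2)
  have T4 := (hC₄ lam h i hi _ _ (d.obs_window_sq' i)).const_mul (3 * lam ^ 2 * d.z ^ 2)
  have T5 := (hC₅ lam h i _ _ of (fun _ => 1) (fun n => by simp)).const_mul (lam ^ 2 : ℂ)
  -- The sums of these differences are bounded since both are shifts of one sequence. By the
  -- expansion they also equal `lam² m ∑ v³` plus negligible terms, so dividing by `lam² m ≠ 0`
  -- bounds the averages of `v³`.
  have T0 : LDle H.P (fun n x => d.v lam (n + 9 * i) x ^ 3 - d.v lam (n + 6 * i) x ^ 3) 0 := by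
    have hB : ∀ n x, ‖d.v lam n x ^ 3‖ ≤ 1 := fun n x => by rw [norm_pow, norm_v h, one_pow]
    refine LDle.of_sum_bounded (B := 2 * (9 * i : ℕ) * 1 + 2 * (6 * i : ℕ) * 1) fun N x => ?_
    have a := norm_sum_shift_le (fun n => hB n x) (9 * i) N
    have b := norm_sum_shift_le (fun n => hB n x) (6 * i) N
    rw [Finset.sum_sub_distrib, ← sub_sub_sub_cancel_left _ _ (∑ n ∈ Finset.range N, d.v lam n x ^ 3)]
    refine (norm_sub_le _ _).trans (le_of_le_of_eq (add_le_add b a) ?_)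
    ring
  have T := (T0.sub ((((T1.sub T2).add T3).add T4).add T5)).of_norm_sub_le
    (δ := 40000 * (9 * i * lam) ^ 3)
    (Z := fun n x => (lam ^ 2 * m) * d.v lam n x ^ 3) (fun n x => ?_)
  · have hc : (lam : ℂ) ^ 2 * m ≠ 0 := by
      refine mul_ne_zero (pow_ne_zero _ (by exact_mod_cast hlam.ne')) (norm_pos_iff.1 ?_)
      linarith
    refine (LDle.of_const_mul hc T).mono ?_
    simp only [norm_mul, norm_pow, hzc, d.hz, Complex.norm_real,
      Real.norm_of_nonneg hlam.le, Complex.norm_ofNat, one_pow, mul_one]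
    have hi1 : (1:ℝ) ≤ i := by exact_mod_cast hi
    have hmu : 0 < (H.mu ^ i)⁻¹ := inv_pos.2 (H.mu_pow_pos i)
    set q := (H.mu ^ i)⁻¹ with hq
    have hl1 : lam ≤ 1 := by linarith [h.2.1]
    have he : err H lam i = q + i * lam := rfl
    have i13 : (i:ℝ) ≤ i ^ 3 := le_self_pow₀ hi1 (by norm_num)
    have i23 : (i:ℝ) ^ 2 ≤ i ^ 3 := pow_le_pow_right₀ hi1 (by norm_num)
    have l2 : lam ^ 2 ≤ lam := by nlinarith
    set Q := i ^ 3 * (lam * q + lam ^ 3) with hQ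
    have hQ0 : 0 ≤ Q := by positivity
    have hQe : lam ^ 2 * (i ^ 3 * (lam⁻¹ * q + lam)) = Q := by rw [hQ]; field_simp
    have g1 : lam * (i * q) ≤ Q := by
      have : lam * (i * q) ≤ lam * (i ^ 3 * q) := by gcongr
      have : 0 ≤ (i:ℝ) ^ 3 * lam ^ 3 := by positivity
      rw [hQ]; linarith
    have g2 : lam ^ 2 * (i ^ 2 * err H lam i) ≤ Q := by
      have e : lam ^ 2 * (i ^ 2 * err H lam i) = i ^ 2 * (lam ^ 2 * q) + i ^ 3 * lam ^ 3 := by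
        rw [he]; ring
      have a1 : (i:ℝ) ^ 2 * (lam ^ 2 * q) ≤ i ^ 3 * (lam * q) := by gcongr
      rw [e, hQ]; linarith
    have g3 : (9 * i * lam) ^ 3 ≤ 729 * Q := by
      have : 0 ≤ (i:ℝ) ^ 3 * (lam * q) := by positivity
      rw [hQ]; nlinarith
    have hm3 : 0 < ‖m‖ := by linarith
    rw [div_le_div_iff₀ (by positivity) hm2]
    have b1 := mul_le_mul_of_nonneg_left g1 (show 0 ≤ 3 * C₁ by positivity)
    have b2 := mul_le_mul_of_nonneg_left g1 (show 0 ≤ 3 * C₂ by positivity)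
    have b3 := mul_le_mul_of_nonneg_left g2 (show 0 ≤ 6 * C₃ * (400 * d.K ^ 2) by positivity)
    have b4 := mul_le_mul_of_nonneg_left g2 (show 0 ≤ 3 * C₄ * (400 * d.K ^ 2) by positivity)
    have b5 := mul_le_mul_of_nonneg_left g2 (show 0 ≤ C₅ * (6600 * d.K ^ 2) by positivity)
    set E := 3 * C₁ + 3 * C₂ + 6 * C₃ * (400 * d.K ^ 2) + 3 * C₄ * (400 * d.K ^ 2) +
      C₅ * (6600 * d.K ^ 2) + 40000 * 729 with hE
    have hE0 : 0 ≤ E := by positivity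
    have tot : 0 + (3 * lam * (C₁ * (i * q)) + 3 * lam * (C₂ * (i * q)) +
        6 * lam ^ 2 * (C₃ * (400 * d.K ^ 2 * i ^ 2) * err H lam i) +
        3 * lam ^ 2 * (C₄ * (400 * d.K ^ 2 * i ^ 2) * err H lam i) +
        lam ^ 2 * (C₅ * (6600 * d.K ^ 2 * i ^ 2) * err H lam i)) +
        40000 * (9 * i * lam) ^ 3 ≤ E * Q := by rw [hE]; linarith
    refine (mul_le_mul_of_nonneg_right tot hm2.le).trans ?_
    calc E * Q * |(d.m2 i).re| ≤ E * Q * ‖m‖ := by gcongr; linarith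
      _ = _ := by rw [← hQe]; ring
  · have f1 := v_cube_approx h (9 * i) n x (by push_cast; exact hil)
    have f2 := v_cube_approx h (6 * i) n x (by push_cast; nlinarith [h.1, (Nat.cast_nonneg i : (0:ℝ) ≤ i)])
    rw [cubeWin_eq hz3] at f1 f2
    have f3 : ((6 * i : ℕ) * lam) ^ 3 ≤ (9 * i * lam) ^ 3 := by
      push_cast; gcongr; norm_num
    have f4 : ((9 * i : ℕ) * lam) ^ 3 = (9 * i * lam) ^ 3 := by push_cast; rfl
    rw [f4] at f1
    refine le_trans (le_of_eq ?_) ((norm_sub_le _ _).trans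
      (show _ ≤ 40000 * (9 * i * lam) ^ 3 from (add_le_add f2 f1).trans (by linarith)))
    congr 1
    simp only [hf, map_sub]
    ring

end Data

end HypSys

/-! ### Autocorrelations, asymptotic variance and third moments -/

namespace HypSys

open ComplexConjugate Szego

variable {X : Type*} [TopologicalSpace X] [CompactSpace X] [SecondCountableTopology X]
  [MeasurableSpace X] [BorelSpace X] {H : HypSys X}

namespace Data

variable {d : H.Data} {lam : ℝ}

variable (d) in
/-- The autocorrelations of the sampling function. -/
noncomputable def corr (n : ℕ) : ℂ := ∫ x, conj (d.α x) * d.α (H.T^[n] x) ∂H.P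

variable (d) in
noncomputable def corrRe (n : ℕ) : ℝ := (d.z ^ n * d.corr n).re

variable (d) in
/-- The spectral density of the sampling function at `z`. -/
noncomputable def J : ℝ := d.corrRe 0 + 2 * ∑' n, d.corrRe (n + 1)

variable (d) in
/-- The mean square of the rotating sums. -/
noncomputable def msq (M : ℕ) : ℝ := (∫ x, d.s M x * conj (d.s M x) ∂H.P).re

lemma exists_corr_le (d : H.Data) : ∃ A r : ℝ, 0 ≤ A ∧ 0 < r ∧ r < 1 ∧
    ∀ n, ‖d.corr n‖ ≤ A * r ^ n := by
  have hmu := H.one_lt_mu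
  have hm0 := H.mu_pos
  have hK := d.K_pos
  have hC0 := H.C0_nonneg
  -- Decoupling over `n` steps gives `mu^(-i)` with `i = n / 3`; the divisor `r ^ 2` below pays for
  -- the rounding.
  set r : ℝ := (H.mu⁻¹) ^ (1 / 3 : ℝ) with hr
  have hr0 : 0 < r := Real.rpow_pos_of_pos (inv_pos.2 hm0) _
  have hr1 : r < 1 := Real.rpow_lt_one (inv_pos.2 hm0).le (inv_lt_one_of_one_lt₀ hmu) (by norm_num)
  have hr3 : r ^ 3 = H.mu⁻¹ := by
    rw [hr, ← Real.rpow_natCast, ← Real.rpow_mul (inv_pos.2 hm0).le]; norm_num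
  refine ⟨H.C0 * (d.K * d.K) / r ^ 2, r, by positivity, hr0, hr1, fun n => ?_⟩
  have h := norm_integral_mul_le (j := n) (i := n / 3) (G := fun x => conj (d.α x)) (D := d.K)
    (by simpa using (d.past_α 0).cconj) d.obs d.mean (by omega)
  refine h.trans ?_
  have e : (H.mu ^ (n / 3))⁻¹ = r ^ (3 * (n / 3)) := by rw [pow_mul, hr3, inv_pow]
  have e2 : r ^ (3 * (n / 3)) * r ^ 2 ≤ r ^ n := by
    rw [← pow_add]; exact pow_le_pow_of_le_one hr0.le hr1.le (by omega)
  rw [e, div_mul_eq_mul_div, le_div_iff₀ (by positivity)]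
  have := mul_le_mul_of_nonneg_left e2 (show 0 ≤ H.C0 * (d.K * d.K) by positivity)
  linarith

lemma integral_beta_mul (k j : ℕ) :
    ∫ x, d.beta x (j + k) * conj (d.beta x k) ∂H.P = d.z ^ j * d.corr j := by
  have e : ∀ x, d.beta x (j + k) * conj (d.beta x k) =
      d.z ^ j * (conj (d.α (H.T^[k] x)) * d.α (H.T^[j] (H.T^[k] x))) := fun x => by
    rw [beta, beta, map_mul, map_pow, Function.iterate_add_apply, pow_add]
    have := conj_z_pow_mul (d := d) k
    rw [map_pow] at this
    linear_combination d.z ^ j * (conj (d.α (H.T^[k] x)) * d.α (H.T^[j] (H.T^[k] x))) * this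
  simp only [e]
  rw [integral_const_mul, corr]
  congr 1
  exact H.integral_iter k (f := fun x => conj (d.α x) * d.α (H.T^[j] x))
    ((Complex.continuous_conj.comp d.obs.cont).mul (d.obs.iter j).cont)

lemma integral_beta_mul_conj_s (M : ℕ) : ∫ x, d.beta x M * conj (d.s M x) ∂H.P =
    ∑ j ∈ Finset.range M, d.z ^ (j + 1) * d.corr (j + 1) := by
  rw [← Finset.sum_range_reflect]
  simp only [s, wS, map_sum, Finset.mul_sum]
  rw [integral_finsetSum _ fun k _ => H.integrable ((d.obs_beta M).mul (d.obs_beta k).cconj).cont]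
  refine Finset.sum_congr rfl fun k hk => ?_
  rw [Finset.mem_range] at hk
  rw [← integral_beta_mul k]
  congr! 4
  omega

lemma msq_succ (M : ℕ) : d.msq (M + 1) =
    d.msq M + (d.corrRe 0 + 2 * ∑ j ∈ Finset.range M, d.corrRe (j + 1)) := by
  have e : ∀ x, d.s (M + 1) x * conj (d.s (M + 1) x) = d.s M x * conj (d.s M x) +
      (d.beta x (0 + M) * conj (d.beta x M) +
      (d.beta x M * conj (d.s M x) + conj (d.beta x M * conj (d.s M x)))) := fun x => by
    have : d.s (M + 1) x = d.s M x + d.beta x M := Finset.sum_range_succ _ _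
    rw [this, zero_add]; simp only [map_add, map_mul, Complex.conj_conj]; ring
  have o1 := ((d.obs_s M).mul (d.obs_s M).cconj).cont
  have o2 := ((d.obs_beta (0 + M)).mul (d.obs_beta M).cconj).cont
  have o3 := ((d.obs_beta M).mul (d.obs_s M).cconj).cont
  have o4 := ((d.obs_beta M).mul (d.obs_s M).cconj).cconj.cont
  have o34 : Continuous fun x => d.beta x M * conj (d.s M x) + conj (d.beta x M * conj (d.s M x)) :=
    o3.add o4
  have o234 : Continuous fun x => d.beta x (0 + M) * conj (d.beta x M) +
    (d.beta x M * conj (d.s M x) + conj (d.beta x M * conj (d.s M x))) := o2.add o34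
  unfold msq
  simp only [e]
  rw [integral_add (H.integrable o1) (H.integrable o234),
    integral_add (H.integrable o2) (H.integrable o34),
    integral_add (H.integrable o3) (H.integrable o4), integral_conj, integral_beta_mul,
    integral_beta_mul_conj_s, Complex.add_re, Complex.add_re, Complex.add_re, Complex.conj_re,
    Complex.re_sum]
  unfold corrRe
  ring

lemma abs_corrRe_le (n : ℕ) : |d.corrRe n| ≤ ‖d.corr n‖ := by
  refine (Complex.abs_re_le_norm _).trans ?_
  rw [norm_mul, norm_z_pow, one_mul]

/-- By `msq_succ` an increment of the mean square is a partial sum of the series for `J`, so the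
difference is a geometrically small tail. -/
lemma exists_msq_approx (d : H.Data) : ∃ B r : ℝ, 0 ≤ B ∧ 0 < r ∧ r < 1 ∧
    ∀ M, |d.msq (M + 1) - d.msq M - d.J| ≤ B * r ^ M := by
  obtain ⟨A, r, hA, hr0, hr1, h⟩ := exists_corr_le d
  have hb : ∀ n, ‖d.corrRe (n + 1)‖ ≤ A * r ^ (n + 1) := fun n => (abs_corrRe_le _).trans (h _)
  have hgeo : Summable fun n : ℕ => A * r ^ n :=
    (summable_geometric_of_lt_one hr0.le hr1).mul_left A
  have hs : Summable fun n => d.corrRe (n + 1) :=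
    Summable.of_norm_bounded ((summable_nat_add_iff 1).2 hgeo) hb
  refine ⟨2 * (A / (1 - r)), r, by have : 0 < 1 - r := by linarith
                                   positivity, hr0, hr1, fun M => ?_⟩
  have e : d.msq (M + 1) - d.msq M - d.J = -2 * ∑' j, d.corrRe (j + M + 1) := by
    rw [msq_succ, J, ← hs.sum_add_tsum_nat_add M]; ring
  have hM : HasSum (fun j => A * r ^ M * r ^ j) (A * r ^ M * (1 - r)⁻¹) :=
    (hasSum_geometric_of_lt_one hr0.le hr1).mul_left _
  have t := tsum_of_norm_bounded (f := fun j => d.corrRe (j + M + 1)) hM (fun j => by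
    refine (hb (j + M)).trans ?_
    have : r ^ (j + M + 1) ≤ r ^ M * r ^ j := by
      rw [← pow_add]; exact pow_le_pow_of_le_one hr0.le hr1.le (by omega)
    rw [mul_assoc]; gcongr)
  rw [e, abs_mul, abs_neg, abs_two]
  rw [Real.norm_eq_abs] at t
  rw [div_eq_mul_inv]
  linarith

lemma m2_re (i : ℕ) : (d.m2 i).re = d.msq (9 * i) - d.msq (6 * i) := by
  rw [m2, integral_sub, Complex.sub_re]
  · rfl
  · exact H.integrable ((d.obs_s _).mul (d.obs_s _).cconj).cont
  · exact H.integrable ((d.obs_s _).mul (d.obs_s _).cconj).cont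

lemma exists_m2_approx (d : H.Data) : ∃ B r : ℝ, 0 ≤ B ∧ 0 < r ∧ r < 1 ∧
    ∀ i : ℕ, |(d.m2 i).re - 3 * i * d.J| ≤ 3 * i * (B * r ^ i) := by
  obtain ⟨B, r, hB, hr0, hr1, h⟩ := exists_msq_approx d
  refine ⟨B, r, hB, hr0, hr1, fun i => ?_⟩
  have e : (d.m2 i).re - 3 * i * d.J =
      ∑ k ∈ Finset.range (3 * i), (d.msq (6 * i + k + 1) - d.msq (6 * i + k) - d.J) := by
    rw [Finset.sum_sub_distrib, m2_re]
    simp only [add_assoc]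
    rw [Finset.sum_range_sub (fun k => d.msq (6 * i + k))]
    have : 6 * i + 3 * i = 9 * i := by ring
    simp [this]
  rw [e]
  refine (Finset.abs_sum_le_sum_abs _ _).trans ((Finset.sum_le_sum (g := fun _ => B * r ^ i)
    fun k _ => (h (6 * i + k)).trans ?_).trans (le_of_eq ?_))
  · exact mul_le_mul_of_nonneg_left (pow_le_pow_of_le_one hr0.le hr1.le (by omega)) hB
  · simp

/-- For `J = 0` the increments themselves are summable. -/
lemma msq_bounded (hJ : d.J = 0) : ∃ B, 0 ≤ B ∧ ∀ M, d.msq M ≤ B := by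
  obtain ⟨B, r, hB, hr0, hr1, h⟩ := exists_msq_approx d
  have hr : 0 < 1 - r := by linarith
  refine ⟨B / (1 - r), by positivity, fun M => ?_⟩
  have e : d.msq M = ∑ k ∈ Finset.range M, (d.msq (k + 1) - d.msq k - d.J) := by
    simp only [hJ, sub_zero]
    rw [Finset.sum_range_sub]
    simp [msq, s, wS]
  rw [e]
  have hs : Summable fun n : ℕ => B * r ^ n := (summable_geometric_of_lt_one hr0.le hr1).mul_left B
  refine (Finset.sum_le_sum fun k _ => (le_abs_self _).trans (h k)).trans
    ((hs.sum_le_tsum _ fun k _ => by positivity).trans (le_of_eq ?_))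
  rw [tsum_mul_left, tsum_geometric_of_lt_one hr0.le hr1]; rfl

lemma norm_s_le (M : ℕ) (x : X) : ‖d.s M x‖ ≤ M := by
  have := norm_wS_le (norm_beta_le (d := d) x) M
  rwa [mul_one] at this

lemma msq_eq (M : ℕ) : d.msq M = ∫ x, ‖d.s M x‖ ^ 2 ∂H.P := by
  have := integral_re (𝕜 := ℂ) (H.integrable ((d.obs_s M).mul (d.obs_s M).cconj).cont)
  refine Eq.trans this.symm (integral_congr_ae (Eventually.of_forall fun x => ?_))
  simp only
  rw [Complex.mul_conj, Complex.normSq_eq_norm_sq]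
  exact Complex.ofReal_re _

/-- If the asymptotic variance vanishes, third moments are of smaller order. -/
lemma third_moment (hJ : d.J = 0) {δ : ℝ} (hδ : 0 < δ) :
    ∃ M₀ : ℕ, ∀ M ≥ M₀, ∫ x, ‖d.s M x‖ ^ 3 ∂H.P ≤ δ * M := by
  obtain ⟨B, hB, hB'⟩ := msq_bounded hJ
  obtain ⟨η, hη0, hη⟩ : ∃ η, 0 < η ∧ η * B ≤ δ / 2 := by
    refine ⟨δ / (2 * (B + 1)), by positivity, ?_⟩
    rw [div_mul_eq_mul_div, div_le_div_iff₀ (by positivity) (by norm_num)]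
    nlinarith
  obtain ⟨c, hc, N₀, hN⟩ := ldle_birkhoff (w := fun n => d.z ^ n)
    (fun n => (norm_z_pow n).le) d.obs d.mean η hη0
  have hlim : Tendsto (fun M : ℕ => (M:ℝ) ^ 2 * Real.exp (-c) ^ M) atTop (𝓝 0) :=
    tendsto_pow_const_mul_const_pow_of_abs_lt_one 2 (by
      rw [abs_of_pos (Real.exp_pos _), Real.exp_lt_one_iff]; linarith)
  obtain ⟨M₁, hM₁⟩ := eventually_atTop.1 (hlim.eventually_le_const (half_pos hδ))
  refine ⟨max N₀ M₁, fun M hM => ?_⟩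
  have c1 := hN M ((le_max_left _ _).trans hM)
  have c2 := hM₁ M ((le_max_right _ _).trans hM)
  have hcs := (d.obs_s M).cont.norm
  set S : Set X := {x | η * M < ‖d.s M x‖} with hS
  have hSm : MeasurableSet S := (isOpen_lt continuous_const hcs).measurableSet
  have c3 : H.P.real S ≤ Real.exp (-(c * M)) := c1
  -- Off the exceptional set one factor is at most `η M` and the mean square is bounded. On it the
  -- trivial bound `M³` is beaten by its exponentially small measure.
  have pt : ∀ x, ‖d.s M x‖ ^ 3 ≤ η * M * ‖d.s M x‖ ^ 2 + S.indicator (fun _ => (M:ℝ) ^ 3) x := by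
    intro x
    by_cases hx : x ∈ S
    · rw [Set.indicator_of_mem hx]
      have : ‖d.s M x‖ ^ 3 ≤ (M:ℝ) ^ 3 := pow_le_pow_left₀ (norm_nonneg _) (norm_s_le M x) 3
      have : 0 ≤ η * M * ‖d.s M x‖ ^ 2 := by positivity
      linarith
    · rw [Set.indicator_of_notMem hx, add_zero]
      have hx' : ‖d.s M x‖ ≤ η * M := not_lt.1 hx
      have := mul_le_mul_of_nonneg_right hx' (sq_nonneg ‖d.s M x‖)
      linarith [show ‖d.s M x‖ ^ 3 = ‖d.s M x‖ * ‖d.s M x‖ ^ 2 by ring]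
  have i1 : Integrable (fun x => η * M * ‖d.s M x‖ ^ 2) H.P :=
    H.integrable (continuous_const.mul (hcs.pow 2))
  have i2 : Integrable (S.indicator (fun _ => (M:ℝ) ^ 3)) H.P :=
    (integrable_const _).indicator hSm
  have := integral_mono (H.integrable (hcs.pow 3)) (i1.add i2) pt
  refine this.trans ?_
  simp only [Pi.add_apply]
  rw [integral_add i1 i2, integral_const_mul, ← msq_eq, integral_indicator_const _ hSm, smul_eq_mul]
  have e : Real.exp (-(c * M)) = Real.exp (-c) ^ M := by rw [← Real.exp_nat_mul]; ring_nf
  have k1 : η * M * d.msq M ≤ δ / 2 * M := by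
    have := mul_le_mul_of_nonneg_left (hB' M) (show 0 ≤ η * M by positivity)
    have := mul_le_mul_of_nonneg_right hη (Nat.cast_nonneg (α := ℝ) M)
    linarith
  have k2 : H.P.real S * (M:ℝ) ^ 3 ≤ δ / 2 * M := by
    have a1 := mul_le_mul_of_nonneg_right c3 (show 0 ≤ (M:ℝ) ^ 3 by positivity)
    rw [e] at a1
    have a2 := mul_le_mul_of_nonneg_right c2 (Nat.cast_nonneg (α := ℝ) M)
    nlinarith
  linarith

lemma norm_m3_le (i : ℕ) : ‖d.m3 i‖ ≤ ∫ x, ‖d.s (9 * i) x‖ ^ 3 ∂H.P + ∫ x, ‖d.s (6 * i) x‖ ^ 3 ∂H.P := by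
  have c : ∀ M, Integrable (fun x => ‖d.s M x‖ ^ 3) H.P := fun M =>
    H.integrable ((d.obs_s M).cont.norm.pow 3)
  rw [← integral_add (c _) (c _)]
  refine norm_integral_le_of_norm_le ((c _).add (c _)) (Eventually.of_forall fun x => ?_)
  rw [RCLike.norm_conj]
  refine (norm_sub_le _ _).trans (le_of_eq ?_)
  rw [norm_pow, norm_pow]

lemma norm_m3_le' (i : ℕ) : ‖d.m3 i‖ ≤ 5000 * d.K ^ 3 * i ^ 3 := by
  have := norm_integral_le_of_norm_le_const (μ := H.P)
    (Eventually.of_forall (d.obs_window_cube i).bound)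
  rwa [probReal_univ, mul_one] at this

end Data

end HypSys

/-! ### Choice of the window length and the growth rate -/

lemma tendsto_succ_pow_mul_pow (k : ℕ) {r : ℝ} (h0 : 0 < r) (h1 : r < 1) :
    Tendsto (fun i : ℕ => ((i:ℝ) + 1) ^ k * r ^ i) atTop (𝓝 0) := by
  have h := ((tendsto_pow_const_mul_const_pow_of_abs_lt_one k (r := r)
    (by rwa [abs_of_pos h0])).comp (tendsto_add_atTop_nat 1)).mul_const r⁻¹
  rw [zero_mul] at h
  refine h.congr fun i => ?_
  simp only [Function.comp, Nat.cast_add, Nat.cast_one, pow_succ r]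
  field_simp

namespace HypSys

open ComplexConjugate Szego

variable {X : Type*} [TopologicalSpace X] [CompactSpace X] [SecondCountableTopology X]
  [MeasurableSpace X] [BorelSpace X] {H : HypSys X}

namespace Data

variable {d : H.Data} {lam : ℝ}

/-- The window length `i` is of the order of `lam ^ (-1 / 20)`. -/
def Coupled (lam : ℝ) (i : ℕ) : Prop := lam * (i:ℝ) ^ 20 ≤ 1 ∧ 1 ≤ lam * ((i:ℝ) + 1) ^ 20

lemma Coupled.inv_le {i : ℕ} (h : Coupled lam i) (h0 : 0 < lam) : lam⁻¹ ≤ ((i:ℝ) + 1) ^ 20 := by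
  rw [inv_le_iff_one_le_mul₀ h0, mul_comm]; exact h.2

lemma Coupled.mul_le {i : ℕ} (h : Coupled lam i) (h0 : 0 < lam) (hi : 1 ≤ i) {k : ℕ} (hk : k < 20) :
    lam * (i:ℝ) ^ k ≤ (i:ℝ)⁻¹ := by
  have hi1 : (1:ℝ) ≤ i := by exact_mod_cast hi
  rw [inv_eq_one_div, le_div_iff₀ (by positivity), mul_assoc, ← pow_succ]
  refine le_trans ?_ h.1
  have := pow_le_pow_right₀ hi1 (show k + 1 ≤ 20 by omega)
  gcongr

/-- The last `i` with `lam i^20 ≤ 1`. It exceeds any prescribed threshold once `lam` is small. -/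
lemma exists_coupled (h0 : 0 < lam) (h1 : lam < 1) {I : ℕ} (hI : lam * (I:ℝ) ^ 20 ≤ 1) :
    ∃ i ≥ I, Coupled lam i := by
  classical
  have hex : ∃ n : ℕ, 1 < lam * (n:ℝ) ^ 20 := by
    obtain ⟨n, hn⟩ := exists_nat_gt lam⁻¹
    refine ⟨n, ?_⟩
    have hn1 : (1:ℝ) ≤ n := ((one_le_inv₀ h0).2 h1.le).trans hn.le
    have : (n:ℝ) ≤ n ^ 20 := le_self_pow₀ hn1 (by norm_num)
    calc 1 = lam * lam⁻¹ := (mul_inv_cancel₀ h0.ne').symm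
      _ < lam * (n:ℝ) ^ 20 := by gcongr; linarith
  set m := Nat.find hex with hm
  have h2 := Nat.find_spec hex
  have hmI : I < m := by
    by_contra! hcon
    have : lam * ((m:ℕ):ℝ) ^ 20 ≤ lam * (I:ℝ) ^ 20 := by gcongr
    linarith
  refine ⟨m - 1, by omega, ?_, ?_⟩
  · exact not_lt.1 (Nat.find_min hex (show m - 1 < m by omega))
  · have : ((m - 1 : ℕ) : ℝ) + 1 = m := by
      have : m - 1 + 1 = m := by omega
      exact_mod_cast this
    rw [this]; exact h2.le

/-- The resonant third order term is of smaller order. -/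
lemma exists_resonant (d : H.Data) (hz1 : d.z ≠ 1) {δ : ℝ} (hδ : 0 < δ) :
    ∃ I₀ : ℕ, ∀ i ≥ I₀, ∀ lam, d.Small lam → Coupled lam i →
    LDle H.P (fun n x => d.m3 i * ((conj d.z ^ 3) ^ n * d.v lam n x ^ 3)) (δ * i) := by
  have hK := d.K_pos
  by_cases hz3 : d.z ^ 3 = 1
  · have hz3' : conj d.z ^ 3 = 1 := by rw [← map_pow, hz3, map_one]
    simp only [hz3', one_pow, one_mul]
    by_cases hJ : d.J = 0
    -- Here the coefficient `m3` is itself small and no cancellation in `v³` is needed. The windows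
    -- have total length `9i + 6i = 15i`.
    · obtain ⟨M₀, hM₀⟩ := third_moment hJ (show 0 < δ / 15 by positivity)
      refine ⟨M₀, fun i hi lam h _ => LDle.of_bounded fun n x => ?_⟩
      rw [norm_mul, norm_pow, norm_v h, one_pow, mul_one]
      have a9 := hM₀ (9 * i) (by omega)
      have a6 := hM₀ (6 * i) (by omega)
      push_cast at a9 a6
      linarith [norm_m3_le (d := d) i]
    -- Now `|m2|` is at least `i |J|` for large `i`, and `m3 = O(i³)`. The exponent `26` below is `3
    -- + 3` from `m3` and `exists_cube`, plus `20` from `lam⁻¹ ≤ (i+1)^20`.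
    · obtain ⟨C, hC, hC'⟩ := exists_cube d hz1 hz3
      obtain ⟨B, r, hB, hr0, hr1, hm2⟩ := exists_m2_approx d
      have hJ' : 0 < |d.J| := abs_pos.2 hJ
      have t1 := (tendsto_pow_atTop_nhds_zero_of_lt_one hr0.le hr1).const_mul B
      rw [mul_zero] at t1
      have mu0 := inv_pos.2 H.mu_pos
      have mu1 := inv_lt_one_of_one_lt₀ H.one_lt_mu
      have t2 := (tendsto_succ_pow_mul_pow 26 mu0 mu1).const_mul (5000 * d.K ^ 3 * C)
      have t3 := (tendsto_inv_atTop_nhds_zero_nat (𝕜 := ℝ)).const_mul (5000 * d.K ^ 3 * C)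
      have t23 := t2.add t3
      rw [mul_zero, add_zero] at t23
      have p : 0 < δ * |d.J| := by positivity
      obtain ⟨I₀, hI⟩ := eventually_atTop.1 (((t1.eventually_le_const (half_pos hJ')).and
        (t23.eventually_le_const p)).and (eventually_ge_atTop 200))
      refine ⟨I₀, fun i hi lam h hc => ?_⟩
      obtain ⟨⟨e1, e2⟩, hi200⟩ := hI i hi
      have hlam := h.1
      have hi1 : (200:ℝ) ≤ i := by exact_mod_cast hi200
      have l1 := hc.mul_le hlam (by omega) (k := 1) (by norm_num)
      have l6 := hc.mul_le hlam (by omega) (k := 6) (by norm_num)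
      have hinv : (i:ℝ)⁻¹ ≤ 1 / 200 := by
        rw [inv_eq_one_div]; exact one_div_le_one_div_of_le (by norm_num) hi1
      rw [pow_one] at l1
      have hm : (i:ℝ) * |d.J| ≤ |(d.m2 i).re| := by
        have a := hm2 i
        have b := abs_sub_abs_le_abs_sub (3 * i * d.J) (d.m2 i).re
        rw [abs_sub_comm, abs_mul, abs_of_pos (by positivity : (0:ℝ) < 3 * i)] at b
        nlinarith [mul_le_mul_of_nonneg_left e1 (show (0:ℝ) ≤ 3 * i by positivity)]
      have hm0 : 0 < |(d.m2 i).re| := lt_of_lt_of_le (by positivity) hm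
      refine ((hC' lam h i (by omega) (by linarith) (abs_pos.1 hm0)).const_mul (d.m3 i)).mono ?_
      have q0 : 0 < (H.mu ^ i)⁻¹ := inv_pos.2 (H.mu_pow_pos i)
      set q := (H.mu ^ i)⁻¹ with hq
      have hqe : H.mu⁻¹ ^ i = q := by rw [hq, inv_pow]
      rw [hqe] at e2
      have s1 : (i:ℝ) ^ 3 * (C * (i ^ 3 * (lam⁻¹ * q + lam))) ≤
          C * (((i:ℝ) + 1) ^ 26 * q + (i:ℝ)⁻¹) := by
        have a1 : (i:ℝ) ^ 6 * (lam⁻¹ * q) ≤ ((i:ℝ) + 1) ^ 26 * q := by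
          have := hc.inv_le hlam
          calc (i:ℝ) ^ 6 * (lam⁻¹ * q) ≤ ((i:ℝ) + 1) ^ 6 * (((i:ℝ) + 1) ^ 20 * q) := by
                gcongr; linarith
            _ = _ := by ring
        calc _ = C * ((i:ℝ) ^ 6 * (lam⁻¹ * q) + lam * (i:ℝ) ^ 6) := by ring
          _ ≤ _ := by gcongr
      have hX : 0 ≤ C * ((i:ℝ) ^ 3 * (lam⁻¹ * q + lam)) := by positivity
      rw [← mul_div_assoc, div_le_iff₀ hm0]
      calc ‖d.m3 i‖ * (C * ((i:ℝ) ^ 3 * (lam⁻¹ * q + lam)))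
          ≤ 5000 * d.K ^ 3 * i ^ 3 * (C * ((i:ℝ) ^ 3 * (lam⁻¹ * q + lam))) := by
            gcongr; exact norm_m3_le' i
        _ = 5000 * d.K ^ 3 * ((i:ℝ) ^ 3 * (C * (i ^ 3 * (lam⁻¹ * q + lam)))) := by ring
        _ ≤ 5000 * d.K ^ 3 * (C * (((i:ℝ) + 1) ^ 26 * q + (i:ℝ)⁻¹)) := by gcongr
        _ ≤ δ * |d.J| := by linarith
        _ ≤ δ * i * |(d.m2 i).re| := by
            have : (i:ℝ) * |d.J| ≤ i * |(d.m2 i).re| := by nlinarith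
            nlinarith
  · obtain ⟨C, hC, hC'⟩ := exists_nonres d 3 (by norm_num) hz3
    have t := (tendsto_inv_atTop_nhds_zero_nat (𝕜 := ℝ)).const_mul (5000 * d.K ^ 3 * C * 2)
    rw [mul_zero] at t
    obtain ⟨I₀, hI⟩ := eventually_atTop.1 ((t.eventually_le_const hδ).and (eventually_ge_atTop 1))
    refine ⟨I₀, fun i hi lam h hc => ?_⟩
    obtain ⟨e1, hi0⟩ := hI i hi
    have hlam := h.1
    have hi1 : (1:ℝ) ≤ i := by exact_mod_cast hi0
    refine ((hC' lam h i hi0).const_mul (d.m3 i)).mono ?_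
    have l1 := hc.mul_le hlam hi0 (k := 1) (by norm_num)
    have l3 := hc.mul_le hlam hi0 (k := 3) (by norm_num)
    have he : err H lam i ≤ 2 := by
      have : (H.mu ^ i)⁻¹ ≤ 1 := inv_le_one_of_one_le₀ (one_le_pow₀ H.one_lt_mu.le)
      have : (i:ℝ)⁻¹ ≤ 1 := inv_le_one_of_one_le₀ hi1
      rw [err]; linarith
    have he0 := err_nonneg h i
    calc ‖d.m3 i‖ * (C * (lam * err H lam i)) ≤ 5000 * d.K ^ 3 * i ^ 3 * (C * (lam * 2)) := by
          gcongr; exact norm_m3_le' i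
      _ = 5000 * d.K ^ 3 * C * 2 * (lam * i ^ 3) := by ring
      _ ≤ 5000 * d.K ^ 3 * C * 2 * (i:ℝ)⁻¹ := by gcongr
      _ ≤ δ * i := by nlinarith

lemma exists_ξ_bound : ∃ B, ∀ lam, d.Small lam → ∀ n x, |d.ξ lam n x| ≤ B := by
  refine ⟨Real.log 4 + Real.log 4, fun lam h n x => ?_⟩
  have hb := norm_b_le h x n
  have hv := norm_v h n x
  have hl := h.2.1
  have h0 := norm_nonneg (d.b lam x n)
  have key : ∀ t : ℝ, 1 / 4 ≤ t → t ≤ 4 → |Real.log t| ≤ Real.log 4 := by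
    intro t h1 h2
    rw [abs_le]
    constructor
    · rw [← Real.log_inv]; exact Real.log_le_log (by norm_num) (by linarith)
    · exact Real.log_le_log (by linarith) h2
  rw [ξ, xi]
  refine (abs_sub _ _).trans (add_le_add (key _ ?_ ?_) (key _ ?_ ?_))
  · have := le_norm_den (b := d.b lam x n) hv
    nlinarith
  · have : ‖1 - conj (d.b lam x n) * d.v lam n x‖ ≤ 1 + lam := by
      refine (norm_sub_le _ _).trans ?_
      rw [norm_one, norm_mul, RCLike.norm_conj, hv, mul_one]; linarith
    nlinarith [norm_nonneg (1 - conj (d.b lam x n) * d.v lam n x)]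
  · nlinarith
  · nlinarith

/-- Large deviations for the growth rate, with an error of third order in the coupling. -/
theorem exists_ldle_growth (d : H.Data) (hz1 : d.z ≠ 1) (hz2 : d.z ^ 2 ≠ 1) :
    ∃ lam₀, 0 < lam₀ ∧ ∀ lam, 0 < lam → lam < lam₀ → d.Small lam ∧
    LDle H.P (fun n x => ((d.ξ lam n x - lam ^ 2 * d.J : ℝ) : ℂ)) (lam ^ 3) := by
  obtain ⟨C, hC, hC'⟩ := exists_growth d hz1 hz2
  obtain ⟨I₁, hI₁⟩ := exists_resonant d hz1 one_pos
  obtain ⟨B, r, hB, hr0, hr1, hm2⟩ := exists_m2_approx d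
  obtain ⟨Bξ, hBξ⟩ := exists_ξ_bound (d := d)
  -- All errors are compared with `lam³ i`. The exponent `20` replaces one factor `lam⁻¹` and `43 =
  -- 3 + 2 * 20` replaces `i³ lam⁻²`; the exponentials in `i` beat both.
  have t1 := (tendsto_succ_pow_mul_pow 20 hr0 hr1).const_mul B
  have t2 := (tendsto_succ_pow_mul_pow 43 (inv_pos.2 H.mu_pos)
    (inv_lt_one_of_one_lt₀ H.one_lt_mu)).const_mul C
  have t3 := (tendsto_inv_atTop_nhds_zero_nat (𝕜 := ℝ)).const_mul C
  rw [mul_zero] at t1 t2 t3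
  obtain ⟨I₀, hI⟩ := eventually_atTop.1 (((t1.eventually_le_const (show (0:ℝ) < 1 / 3 by norm_num)).and
    ((t2.eventually_le_const (show (0:ℝ) < 1 / 2 by norm_num)).and
    (t3.eventually_le_const (show (0:ℝ) < 1 / 2 by norm_num)))).and (eventually_ge_atTop (max I₁ 200)))
  have hmu := H.one_lt_mu
  refine ⟨min (min (1 / 4) ((H.mu - 1) / 8)) (((I₀:ℝ) + 1) ^ 20)⁻¹,
    lt_min (lt_min (by norm_num) (by linarith)) (by positivity), fun lam h0 hl => ?_⟩
  have hl1 := hl.trans_le ((min_le_left _ _).trans (min_le_left _ _))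
  have hl2 := hl.trans_le ((min_le_left _ _).trans (min_le_right _ _))
  have hl3 := hl.trans_le (min_le_right _ _)
  have h : d.Small lam := ⟨h0, hl1.le, by linarith⟩
  refine ⟨h, ?_⟩
  obtain ⟨i, hi, hc⟩ := exists_coupled h0 (by linarith) (I := I₀) (by
    have : lam * (I₀:ℝ) ^ 20 ≤ (((I₀:ℝ) + 1) ^ 20)⁻¹ * ((I₀:ℝ) + 1) ^ 20 := by
      gcongr; linarith
    rwa [inv_mul_cancel₀ (by positivity)] at this)
  obtain ⟨⟨e1, e2, e3⟩, hiI⟩ := hI i hi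
  have hi200 : 200 ≤ i := (le_max_right _ _).trans hiI
  have hi1 : (200:ℝ) ≤ i := by exact_mod_cast hi200
  have l1 := hc.mul_le h0 (by omega) (k := 1) (by norm_num)
  have l3 := hc.mul_le h0 (by omega) (k := 3) (by norm_num)
  have hinv : (i:ℝ)⁻¹ ≤ 1 / 200 := by
    rw [inv_eq_one_div]; exact one_div_le_one_div_of_le (by norm_num) hi1
  rw [pow_one] at l1
  have G := hC' lam h i (by omega) (by linarith) _ (hI₁ i ((le_max_left _ _).trans hiI) lam h hc)
  have G2 := G.of_norm_sub_le (δ := lam ^ 2 * (3 * i * (B * r ^ i)))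
    (Z := fun n x => ∑ k ∈ Finset.Ico (6 * i) (9 * i), ((d.ξ lam (n + k) x - lam ^ 2 * d.J : ℝ) : ℂ))
    (fun n x => by
      rw [← Complex.ofReal_sum, ← Complex.ofReal_sub, Complex.norm_real, Real.norm_eq_abs,
        Finset.sum_sub_distrib, Finset.sum_const, Nat.card_Ico, nsmul_eq_mul]
      have : ((9 * i - 6 * i : ℕ) : ℝ) = 3 * i := by
        have : 9 * i - 6 * i = 3 * i := by omega
        rw [this]; push_cast; ring
      rw [this, sub_sub_sub_cancel_left]
      have e : lam ^ 2 * (d.m2 i).re - 3 * i * (lam ^ 2 * d.J) =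
        lam ^ 2 * ((d.m2 i).re - 3 * i * d.J) := by ring
      rw [e, abs_mul, abs_of_nonneg (by positivity : 0 ≤ lam ^ 2)]
      exact mul_le_mul_of_nonneg_left (hm2 i) (by positivity))
  -- A block of `3i` consecutive shifts deviates by at most `3 i lam³`: one `lam³ i` each from the
  -- window errors, the resonant term, and the replacement of `m2` by `3i J`. Dividing by the block
  -- length gives exactly `lam³`.
  refine (LDle.of_sum_shift (Y := fun n x => ((d.ξ lam n x - lam ^ 2 * d.J : ℝ) : ℂ))
    (B := Bξ + |lam ^ 2 * d.J|) (fun n x => ?_) _ ?_ G2).mono ?_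
  · rw [Complex.norm_real]
    exact (norm_sub_le _ _).trans (add_le_add (hBξ lam h n x) le_rfl)
  · rw [Finset.nonempty_Ico]; omega
  · have : ((Finset.Ico (6 * i) (9 * i)).card : ℝ) = 3 * i := by
      have : 9 * i - 6 * i = 3 * i := by omega
      rw [Nat.card_Ico, this]; push_cast; ring
    rw [this, div_le_iff₀ (by positivity)]
    have q0 : 0 < (H.mu ^ i)⁻¹ := inv_pos.2 (H.mu_pow_pos i)
    rw [inv_pow] at e2
    set q := (H.mu ^ i)⁻¹ with hq
    have hinvl := hc.inv_le h0
    have a1 : C * (i ^ 4 * (lam * q)) ≤ lam ^ 3 * i * (1 / 2) := by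
      have : (i:ℝ) ^ 3 * (lam⁻¹ ^ 2 * q) ≤ ((i:ℝ) + 1) ^ 43 * q := by
        calc (i:ℝ) ^ 3 * (lam⁻¹ ^ 2 * q) ≤ ((i:ℝ) + 1) ^ 3 * ((((i:ℝ) + 1) ^ 20) ^ 2 * q) := by
              gcongr; linarith
          _ = _ := by ring
      calc C * (i ^ 4 * (lam * q)) = lam ^ 3 * i * (C * ((i:ℝ) ^ 3 * (lam⁻¹ ^ 2 * q))) := by
            field_simp
        _ ≤ lam ^ 3 * i * (C * (((i:ℝ) + 1) ^ 43 * q)) := by gcongr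
        _ ≤ _ := by gcongr
    have a2 : C * (i ^ 4 * lam ^ 4) ≤ lam ^ 3 * i * (1 / 2) := by
      calc C * (i ^ 4 * lam ^ 4) = lam ^ 3 * i * (C * (lam * (i:ℝ) ^ 3)) := by ring
        _ ≤ lam ^ 3 * i * (C * (i:ℝ)⁻¹) := by gcongr
        _ ≤ _ := by gcongr
    have a3 : lam ^ 2 * (3 * i * (B * r ^ i)) ≤ lam ^ 3 * i := by
      calc lam ^ 2 * (3 * i * (B * r ^ i)) = lam ^ 3 * (3 * i * (B * (lam⁻¹ * r ^ i))) := by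
            field_simp
        _ ≤ lam ^ 3 * (3 * i * (B * (((i:ℝ) + 1) ^ 20 * r ^ i))) := by gcongr
        _ ≤ lam ^ 3 * (3 * i * (1 / 3)) := by gcongr
        _ = _ := by ring
    linarith

end Data

end HypSys

/-! ### A subadditive ergodic theorem -/

section BoundedLiminf

variable {u w : ℕ → ℝ} {B : ℝ}

lemma eventually_lt_of_lt_liminf_of_abs_le (hu : ∀ n, |u n| ≤ B) {b : ℝ}
    (h : b < liminf u atTop) : ∀ᶠ n in atTop, b < u n :=
  eventually_lt_of_lt_liminf h (isBoundedUnder_of ⟨-B, fun n => (abs_le.1 (hu n)).1⟩)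

lemma frequently_lt_of_liminf_lt_of_abs_le (hu : ∀ n, |u n| ≤ B) {b : ℝ}
    (h : liminf u atTop < b) : ∃ᶠ n in atTop, u n < b :=
  frequently_lt_of_liminf_lt (IsBoundedUnder.isCoboundedUnder_flip
    (isBoundedUnder_of ⟨B, fun n => (abs_le.1 (hu n)).2⟩)) h

lemma le_liminf_of_abs_le (hu : ∀ n, |u n| ≤ B) {b : ℝ} (h : ∀ᶠ n in atTop, b ≤ u n) :
    b ≤ liminf u atTop :=
  le_liminf_of_le (IsBoundedUnder.isCoboundedUnder_flip
    (isBoundedUnder_of ⟨B, fun n => (abs_le.1 (hu n)).2⟩)) h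

lemma liminf_le_of_frequently_of_abs_le (hu : ∀ n, |u n| ≤ B) {b : ℝ}
    (h : ∀ᶠ n in atTop, u n ≤ b) : liminf u atTop ≤ b := by
  by_contra! hcon
  obtain ⟨n, h1, h2⟩ := (h.and (eventually_lt_of_lt_liminf_of_abs_le hu hcon)).exists
  linarith

lemma liminf_le_liminf_of_tendsto (hu : ∀ n, |u n| ≤ B) (hw : ∀ n, |w n| ≤ B)
    (h : Tendsto (fun n => w n - u n) atTop (𝓝 0)) : liminf u atTop ≤ liminf w atTop := by
  refine le_of_forall_lt_imp_le_of_dense fun c hc => ?_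
  obtain ⟨c', h1, h2⟩ := exists_between hc
  refine le_liminf_of_abs_le hw ?_
  filter_upwards [eventually_lt_of_lt_liminf_of_abs_le hu h2,
    h.eventually_const_le (show c - c' < 0 by linarith)] with n h3 h4
  linarith

lemma liminf_eq_liminf_of_tendsto (hu : ∀ n, |u n| ≤ B) (hw : ∀ n, |w n| ≤ B)
    (h : Tendsto (fun n => w n - u n) atTop (𝓝 0)) : liminf u atTop = liminf w atTop :=
  le_antisymm (liminf_le_liminf_of_tendsto hu hw h)
    (liminf_le_liminf_of_tendsto hw hu (by simpa using h.neg))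

end BoundedLiminf

/-- Borel–Cantelli. -/
lemma ExpSmall.ae_eventually_notMem {X : Type*} [MeasurableSpace X] {P : Measure X}
    [IsFiniteMeasure P] {s : ℕ → Set X} (h : ExpSmall P s) :
    ∀ᵐ x ∂P, ∀ᶠ N : ℕ in atTop, x ∉ s N := by
  obtain ⟨c, hc, N₀, hN⟩ := h
  have hs : Summable fun N : ℕ => Real.exp (-c) ^ (N + N₀) :=
    (summable_nat_add_iff N₀).2 (summable_geometric_of_lt_one (Real.exp_pos _).le
      (by rw [Real.exp_lt_one_iff]; linarith))
  have hle : ∀ N : ℕ, P (s (N + N₀)) ≤ ENNReal.ofReal (Real.exp (-c) ^ (N + N₀)) := fun N => by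
    rw [← ofReal_measureReal]
    refine ENNReal.ofReal_le_ofReal ((hN (N + N₀) (by omega)).trans (le_of_eq ?_))
    rw [← Real.exp_nat_mul]; ring_nf
  have h1 := MeasureTheory.ae_eventually_notMem (ne_top_of_le_ne_top hs.tsum_ofReal_ne_top
    (ENNReal.tsum_le_tsum hle))
  filter_upwards [h1] with x hx
  rw [← map_add_atTop_eq_nat N₀, eventually_map]
  exact hx

/-- Sums with exponentially small large deviations grow sublinearly almost everywhere. -/
lemma LDle.ae_eventually {X : Type*} [MeasurableSpace X] {P : Measure X} [IsFiniteMeasure P]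
    {Y : ℕ → X → ℂ} (h : LDle P Y 0) :
    ∀ᵐ x ∂P, ∀ ε > 0, ∀ᶠ N : ℕ in atTop, ‖∑ n ∈ Finset.range N, Y n x‖ ≤ ε * N := by
  have key : ∀ ε > 0, ∀ᵐ x ∂P, ∀ᶠ N : ℕ in atTop, ‖∑ n ∈ Finset.range N, Y n x‖ ≤ ε * N := by
    intro ε hε
    filter_upwards [(show ExpSmall P _ from h ε hε).ae_eventually_notMem] with x hx
    filter_upwards [hx] with N hN
    exact not_lt.1 hN
  have h2 : ∀ᵐ x ∂P, ∀ k : ℕ, ∀ᶠ N : ℕ in atTop,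
      ‖∑ n ∈ Finset.range N, Y n x‖ ≤ (1 / ((k:ℝ) + 1)) * N :=
    ae_all_iff.2 fun k => key _ (by positivity)
  filter_upwards [h2] with x hx ε hε
  obtain ⟨k, hk⟩ := exists_nat_one_div_lt hε
  filter_upwards [hx k] with N hN
  refine hN.trans ?_
  gcongr

section Greedy

variable {X : Type*} {T : X → X} {a : ℕ → X → ℝ} {B : ℝ}

/-- Greedy covering of the orbit: from a point of `G` jump over a good block, which costs `n c`;
from any other point take one step, which costs `B ≤ c + 2B`. The last stretch, of length at most
`M`, is bounded trivially. -/
lemma subadditive_le_of_cover (hsub : ∀ m n x, a (m + n) x ≤ a m x + a n (T^[m] x))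
    (h0 : ∀ x, a 0 x ≤ B) (hleft : ∀ n x, a (n + 1) x ≤ a n (T x) + B)
    {c : X → ℝ} (hc : ∀ x, c (T x) = c x) (hcB : ∀ x, |c x| ≤ B) {G : Set X} {M : ℕ}
    (hG : ∀ x ∈ G, ∃ n, 1 ≤ n ∧ n ≤ M ∧ a n x ≤ n * c x) (N : ℕ) (x : X) :
    a N x ≤ N * c x + 2 * B * ∑ k ∈ Finset.range N, Gᶜ.indicator (fun _ => (1:ℝ)) (T^[k] x) +
      2 * B * (M + 1) := by
  have hB : 0 ≤ B := (abs_nonneg _).trans (hcB x)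
  have hind : ∀ y, 0 ≤ Gᶜ.indicator (fun _ => (1:ℝ)) y :=
    Set.indicator_nonneg fun _ _ => zero_le_one
  have hlin : ∀ n y, a n y ≤ (n + 1) * B := by
    intro n
    induction n with
    | zero => intro y; simpa using h0 y
    | succ n ih => intro y; have := hleft n y; have := ih (T y); push_cast; linarith
  have hcit : ∀ n y, c (T^[n] y) = c y := by
    intro n
    induction n with
    | zero => intro y; rfl
    | succ n ih => intro y; rw [Function.iterate_succ_apply, ih, hc]
  induction N using Nat.strong_induction_on generalizing x with
  | _ N ih =>
    have hcx := abs_le.1 (hcB x)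
    by_cases hNM : N ≤ M
    · have h1 := hlin N x
      have h2 : 0 ≤ ∑ k ∈ Finset.range N, Gᶜ.indicator (fun _ => (1:ℝ)) (T^[k] x) :=
        Finset.sum_nonneg fun k _ => hind _
      have h3 : (N:ℝ) * B ≤ M * B := by gcongr
      have h4 : -(N * B) ≤ N * c x := by
        have := mul_le_mul_of_nonneg_left hcx.1 (Nat.cast_nonneg (α := ℝ) N); linarith
      have h5 := mul_nonneg (mul_nonneg zero_le_two hB) h2
      linarith
    · by_cases hx : x ∈ G
      · obtain ⟨n, h1, h2, h3⟩ := hG x hx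
        obtain ⟨k, rfl⟩ : ∃ k, N = n + k := ⟨N - n, by omega⟩
        have h4 := ih k (by omega) (T^[n] x)
        rw [hcit] at h4
        have h5 := hsub n k x
        have h6 : ∑ j ∈ Finset.range k, Gᶜ.indicator (fun _ => (1:ℝ)) (T^[j] (T^[n] x)) ≤
            ∑ j ∈ Finset.range (n + k), Gᶜ.indicator (fun _ => (1:ℝ)) (T^[j] x) := by
          rw [Finset.sum_range_add]
          have : 0 ≤ ∑ j ∈ Finset.range n, Gᶜ.indicator (fun _ => (1:ℝ)) (T^[j] x) :=
            Finset.sum_nonneg fun k _ => hind _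
          simp only [← Function.iterate_add_apply]
          simp only [add_comm n]
          linarith
        have h7 := mul_le_mul_of_nonneg_left h6 (show 0 ≤ 2 * B by positivity)
        push_cast
        linarith
      · obtain ⟨k, rfl⟩ : ∃ k, N = k + 1 := ⟨N - 1, by omega⟩
        have h4 := ih k (by omega) (T x)
        rw [hc] at h4
        have h5 := hleft k x
        rw [Finset.sum_range_succ']
        have h6 : Gᶜ.indicator (fun _ => (1:ℝ)) (T^[0] x) = 1 := by
          rw [Set.indicator_of_mem]; exact hx
        rw [h6]
        simp only [Function.iterate_succ_apply]
        push_cast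
        linarith

/-- The sum of `a_{N+r}` over `r < q` is `q a_N` up to `O(q²)`. When `N` increases by one it changes
by `a_{N+q} - a_N ≤ a_q ∘ T^N`. -/
lemma subadditive_block (hsub : ∀ m n x, a (m + n) x ≤ a m x + a n (T^[m] x))
    (h0 : ∀ x, |a 0 x| ≤ B) (hright : ∀ n x, |a (n + 1) x - a n x| ≤ B) (q N : ℕ) (x : X) :
    q * a N x ≤ ∑ n ∈ Finset.range N, a q (T^[n] x) + 2 * B * (q + 1) ^ 2 := by
  have hB : 0 ≤ B := (abs_nonneg _).trans (h0 x)
  have hinc : ∀ r N, a N x ≤ a (N + r) x + r * B := by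
    intro r N
    induction r with
    | zero => simp
    | succ r ih =>
      have := (abs_le.1 (hright (N + r) x)).1
      push_cast; rw [← add_assoc]; linarith
  have hlin : ∀ r, a r x ≤ (r + 1) * B := by
    intro r
    induction r with
    | zero => simpa using (abs_le.1 (h0 x)).2
    | succ r ih => have := (abs_le.1 (hright r x)).2; push_cast; linarith
  have h1 : ∀ N, ∑ r ∈ Finset.range q, a (N + r) x ≤
      ∑ n ∈ Finset.range N, a q (T^[n] x) + ∑ r ∈ Finset.range q, a r x := by
    intro N
    induction N with
    | zero => simp
    | succ N ih =>
      have e1 := Finset.sum_range_succ (fun r => a (N + r) x) q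
      have e2 := Finset.sum_range_succ' (fun r => a (N + r) x) q
      rw [e1] at e2
      have e3 : ∀ r, N + 1 + r = N + (r + 1) := fun r => by ring
      simp only [e3]
      rw [Finset.sum_range_succ]
      have := hsub N q x
      simp only [add_zero] at e2
      linarith
  have h2 : ∑ r ∈ Finset.range q, a r x ≤ q * ((q + 1) * B) := by
    refine (Finset.sum_le_sum (g := fun _ => ((q:ℝ) + 1) * B) fun r hr => (hlin r).trans ?_).trans
      (le_of_eq (by simp))
    have : (r:ℝ) ≤ q := by exact_mod_cast (Finset.mem_range.1 hr).le
    gcongr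
  have h3 : (q:ℝ) * a N x - q * (q * B) ≤ ∑ r ∈ Finset.range q, a (N + r) x := by
    have : ∑ r ∈ Finset.range q, (a N x - q * B) ≤ ∑ r ∈ Finset.range q, a (N + r) x := by
      refine Finset.sum_le_sum fun r hr => ?_
      have : (r:ℝ) ≤ q := by exact_mod_cast (Finset.mem_range.1 hr).le
      have := mul_le_mul_of_nonneg_right this hB
      linarith [hinc r N]
    simp only [Finset.sum_const, Finset.card_range, nsmul_eq_mul] at this
    linarith
  have h4 := h1 N
  nlinarith [show (0:ℝ) ≤ q * B by positivity]

end Greedy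

namespace HypSys

variable {X : Type*} [TopologicalSpace X] [CompactSpace X] [SecondCountableTopology X]
  [MeasurableSpace X] [BorelSpace X] {H : HypSys X}

lemma integral_indicator_iter {s : Set X} (hs : MeasurableSet s) (k : ℕ) :
    ∫ x, s.indicator (fun _ => (1:ℝ)) (H.T^[k] x) ∂H.P = H.P.real s := by
  have e : (fun x => s.indicator (fun _ => (1:ℝ)) (H.T^[k] x)) =
      (H.T^[k] ⁻¹' s).indicator fun _ => (1:ℝ) := by
    ext x; rfl
  rw [e, integral_indicator_const _ ((H.mp_iter k).measurable hs), smul_eq_mul, mul_one,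
    Measure.real, Measure.real, (H.mp_iter k).measure_preimage hs.nullMeasurableSet]

/-- The subadditive ergodic theorem for regular processes with bounded increments. -/
theorem exists_tendsto_of_subadditive {a : ℕ → X → ℝ} {B : ℝ}
    (hobs : ∀ n, ∃ C, H.Obs C fun x => (a n x : ℂ))
    (hsub : ∀ m n x, a (m + n) x ≤ a m x + a n (H.T^[m] x))
    (h0 : ∀ x, |a 0 x| ≤ B) (hright : ∀ n x, |a (n + 1) x - a n x| ≤ B)
    (hleft : ∀ n x, |a (n + 1) x - a n (H.T x)| ≤ B) :
    ∃ L, ∀ᵐ x ∂H.P, Tendsto (fun n : ℕ => a n x / n) atTop (𝓝 L) := by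
  obtain ⟨x₀⟩ := H.nonempty
  have hB : 0 ≤ B := (abs_nonneg _).trans (h0 x₀)
  have hcont : ∀ n, Continuous (a n) := fun n => by
    obtain ⟨C, hC⟩ := hobs n
    exact Complex.continuous_re.comp hC.cont
  have hlin : ∀ n x, |a n x| ≤ (n + 1) * B := by
    intro n x
    induction n with
    | zero => simpa using h0 x
    | succ n ih =>
      have := abs_le.1 (hright n x)
      have := abs_le.1 ih
      rw [abs_le]; push_cast; constructor <;> linarith
  have hu : ∀ x n, |a n x / n| ≤ 2 * B := by
    intro x n
    rcases Nat.eq_zero_or_pos n with rfl | hn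
    · simpa using hB
    · have hn1 : (1:ℝ) ≤ n := by exact_mod_cast hn
      rw [abs_div, abs_of_pos (by linarith : (0:ℝ) < n), div_le_iff₀ (by linarith)]
      have := hlin n x
      nlinarith
  set f : X → ℝ := fun x => liminf (fun n : ℕ => a n x / n) atTop with hf
  have hfm : Measurable f := Measurable.liminf fun n => (hcont n).measurable.div_const _
  have hfB : ∀ x, |f x| ≤ 2 * B := fun x => abs_le.2
    ⟨le_liminf_of_abs_le (hu x) (Eventually.of_forall fun n => (abs_le.1 (hu x n)).1),
    liminf_le_of_frequently_of_abs_le (hu x) (Eventually.of_forall fun n => (abs_le.1 (hu x n)).2)⟩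
  have hfint : Integrable f H.P := Integrable.of_bound (C := 2 * B) hfm.aestronglyMeasurable
    (Eventually.of_forall hfB)
  -- Bounded increments on the left make the lower limit invariant everywhere, not only almost
  -- everywhere.
  have hfT : ∀ x, f (H.T x) = f x := by
    intro x
    have e : f x = liminf (fun n : ℕ => a (n + 1) x / ((n + 1 : ℕ) : ℝ)) atTop :=
      (liminf_nat_add (fun n : ℕ => a n x / n) 1).symm
    rw [e]
    refine liminf_eq_liminf_of_tendsto (hu (H.T x)) (fun n => hu x (n + 1)) ?_
    have t : Tendsto (fun n : ℕ => 3 * B * (1 / ((n:ℝ) + 1))) atTop (𝓝 0) := by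
      simpa using (tendsto_one_div_add_atTop_nhds_zero_nat (𝕜 := ℝ)).const_mul (3 * B)
    refine squeeze_zero_norm (fun n => ?_) t
    rw [Real.norm_eq_abs]
    have hn : (0:ℝ) < (n:ℝ) + 1 := by positivity
    have e2 : a (n + 1) x / ((n + 1 : ℕ) : ℝ) - a n (H.T x) / n =
        ((a (n + 1) x - a n (H.T x)) - (a n (H.T x) / n)) * (1 / ((n:ℝ) + 1)) +
        (a n (H.T x) - n * (a n (H.T x) / n)) * (1 / ((n:ℝ) + 1)) := by
      push_cast; field_simp; ring
    rcases Nat.eq_zero_or_pos n with rfl | hn0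
    · have b1 := hleft 0 (x)
      have b2 := h0 (H.T x)
      have b3 := abs_le.1 b1
      have b4 := abs_le.1 b2
      simp only [Nat.cast_zero, div_zero, sub_zero, zero_add, Nat.cast_one, div_one, mul_one]
      simp only [zero_add] at b3
      rw [abs_le]; constructor <;> linarith
    · have hn1 : (n:ℝ) ≠ 0 := by positivity
      rw [e2, mul_div_cancel₀ _ hn1, sub_self, zero_mul, add_zero, abs_mul,
        abs_of_pos (by positivity : 0 < 1 / ((n:ℝ) + 1))]
      gcongr
      exact (abs_sub _ _).trans (by linarith [hleft n x, hu (H.T x) n])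
  -- the means of the process are asymptotically at most the mean of `f`
  have hmean : ∀ ε > 0, ∃ q : ℕ, 1 ≤ q ∧ ∫ x, a q x ∂H.P ≤ q * (∫ x, f x ∂H.P + ε) := by
    intro ε hε
    set B' := 2 * B + ε with hB'
    have hB'0 : 0 < B' := by positivity
    set G : ℕ → Set X := fun M => {x | ∃ n, 1 ≤ n ∧ n ≤ M ∧ a n x ≤ n * (f x + ε / 3)} with hG
    have hGm : ∀ M, MeasurableSet (G M) := by
      intro M
      have : G M = ⋃ n ∈ Finset.Icc 1 M, {x | a n x ≤ n * (f x + ε / 3)} := by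
        ext x; simp [hG, and_assoc]
      rw [this]
      exact Finset.measurableSet_biUnion _ fun n _ => measurableSet_le (hcont n).measurable
        ((hfm.add_const _).const_mul _)
    have hempty : ⋂ M, (G M)ᶜ = ∅ := by
      rw [Set.eq_empty_iff_forall_notMem]
      intro x hx
      rw [Set.mem_iInter] at hx
      have h1 : f x < f x + ε / 3 := by linarith
      obtain ⟨n, hn1, hn2⟩ := ((frequently_lt_of_liminf_lt_of_abs_le (hu x) h1).and_eventually
        (eventually_ge_atTop 1)).exists
      have hn0 : (0:ℝ) < n := by exact_mod_cast hn2
      rw [div_lt_iff₀ hn0] at hn1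
      exact hx n ⟨n, hn2, le_rfl, by linarith⟩
    have hanti : Antitone fun M => (G M)ᶜ := by
      intro M M' hM
      refine Set.compl_subset_compl.2 ?_
      rintro x ⟨n, h1, h2, h3⟩
      exact ⟨n, h1, h2.trans hM, h3⟩
    have ht := tendsto_measure_iInter_atTop (μ := H.P) (fun M => (hGm M).compl.nullMeasurableSet)
      hanti ⟨0, measure_ne_top _ _⟩
    rw [hempty, measure_empty] at ht
    have ht' := (ENNReal.tendsto_toReal ENNReal.zero_ne_top).comp ht
    obtain ⟨M, hM⟩ := (ht'.eventually_le_const (show (0:ENNReal).toReal < ε / (6 * B') by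
      rw [ENNReal.toReal_zero]; positivity)).exists
    -- Almost every point lies in a block of length at most `M` on which the process is close to its
    -- lower limit; the choice of measure makes bad points contribute at most `ε / 3` per step to
    -- the mean.
    have hM' : H.P.real (G M)ᶜ ≤ ε / (6 * B') := hM
    obtain ⟨N, hN⟩ := exists_nat_gt (max 1 (2 * B' * (M + 1) / (ε / 3)))
    have hN1 : (1:ℝ) ≤ N := ((le_max_left _ _).trans_lt hN).le
    have hN2 : 2 * B' * (M + 1) ≤ N * (ε / 3) := by
      have := ((le_max_right _ _).trans_lt hN).le
      rwa [div_le_iff₀ (by positivity)] at this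
    refine ⟨N, by exact_mod_cast hN1, ?_⟩
    have hpt := subadditive_le_of_cover (T := H.T) (a := a) (B := B') hsub
      (fun x => (abs_le.1 (h0 x)).2.trans (by linarith))
      (fun n x => by linarith [(abs_le.1 (hleft n x)).2])
      (c := fun x => f x + ε / 3) (fun x => by rw [hfT])
      (fun x => by
        have := abs_le.1 (hfB x)
        rw [abs_le]; constructor <;> linarith) (G := G M) (M := M) (fun x hx => hx) N
    have i1 : ∀ k, Integrable (fun x => (G M)ᶜ.indicator (fun _ => (1:ℝ)) (H.T^[k] x)) H.P :=
      fun k => (H.mp_iter k).integrable_comp_of_integrable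
        ((integrable_const (1:ℝ)).indicator (hGm M).compl)
    have i2 : Integrable (fun x => ∑ k ∈ Finset.range N,
        (G M)ᶜ.indicator (fun _ => (1:ℝ)) (H.T^[k] x)) H.P := integrable_finsetSum _ fun k _ => i1 k
    have i3 : Integrable (fun x => (N:ℝ) * (f x + ε / 3)) H.P :=
      (hfint.add (integrable_const _)).const_mul _
    have i4 : Integrable (fun x => (N:ℝ) * (f x + ε / 3) + 2 * B' * ∑ k ∈ Finset.range N,
        (G M)ᶜ.indicator (fun _ => (1:ℝ)) (H.T^[k] x)) H.P := i3.add (i2.const_mul _)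
    have hI := integral_mono (H.integrable (hcont N)) (i4.add (integrable_const _)) hpt
    refine hI.trans ?_
    simp only [Pi.add_apply]
    rw [integral_add i4 (integrable_const _), integral_add i3 (i2.const_mul _), integral_const_mul,
      integral_const_mul, integral_add hfint (integrable_const _),
      integral_finsetSum _ fun k _ => i1 k]
    simp only [integral_indicator_iter (hGm M).compl, integral_const, probReal_univ, one_smul,
      Finset.sum_const, Finset.card_range, nsmul_eq_mul]
    have h5 : 2 * B' * (N * H.P.real (G M)ᶜ) ≤ N * (ε / 3) := by
      calc _ ≤ 2 * B' * (N * (ε / (6 * B'))) := by gcongr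
        _ = _ := by field_simp; ring
    linarith
  set L := ∫ x, f x ∂H.P with hL
  -- Birkhoff sums of blocks bound the process from above
  have hbir : ∀ᵐ x ∂H.P, ∀ q : ℕ, ∀ ε > 0, ∀ᶠ N : ℕ in atTop,
      ‖∑ n ∈ Finset.range N, ((a q (H.T^[n] x) : ℂ) - ∫ y, (a q y : ℂ) ∂H.P)‖ ≤ ε * N := by
    refine ae_all_iff.2 fun q => ?_
    obtain ⟨C, hC⟩ := hobs q
    exact (ldle_birkhoff_mean hC).ae_eventually
  have hup : ∀ᵐ x ∂H.P, ∀ ε > 0, ∀ᶠ N : ℕ in atTop, a N x / N ≤ L + ε := by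
    filter_upwards [hbir] with x hx ε hε
    obtain ⟨q, hq, hq'⟩ := hmean (ε / 3) (by positivity)
    have hq1 : (1:ℝ) ≤ q := by exact_mod_cast hq
    have hlim : Tendsto (fun N : ℕ => (N:ℝ) * (ε / 3)) atTop atTop :=
      tendsto_natCast_atTop_atTop.atTop_mul_const (by positivity)
    filter_upwards [hx q (ε / 3) (by positivity), hlim.eventually_ge_atTop (2 * B * (q + 1) ^ 2),
      eventually_ge_atTop 1] with N h1 h2 h3
    have hN1 : (1:ℝ) ≤ N := by exact_mod_cast h3
    have h4 := subadditive_block hsub h0 hright q N x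
    rw [integral_complex_ofReal, Finset.sum_sub_distrib, Finset.sum_const, Finset.card_range,
      nsmul_eq_mul, ← Complex.ofReal_sum, ← Complex.ofReal_natCast, ← Complex.ofReal_mul,
      ← Complex.ofReal_sub, Complex.norm_real, Real.norm_eq_abs] at h1
    have h5 := (abs_le.1 h1).2
    have h6 := mul_le_mul_of_nonneg_left hq' (show (0:ℝ) ≤ N by positivity)
    rw [div_le_iff₀ (by linarith)]
    have h7 : (q:ℝ) * a N x ≤ q * ((L + ε) * N) := by
      have : (N:ℝ) * (ε / 3) ≤ q * (N * (ε / 3)) := le_mul_of_one_le_left (by positivity) hq1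
      linarith
    exact le_of_mul_le_mul_left h7 (by linarith)
  have hfL : ∀ᵐ x ∂H.P, f x ≤ L := by
    filter_upwards [hup] with x hx
    exact le_of_forall_pos_le_add fun ε hε => liminf_le_of_frequently_of_abs_le (hu x) (hx ε hε)
  -- The lower limit is at most its own mean `L`, hence equal to it almost everywhere; together with
  -- `hup` this gives convergence.
  have hfeq : ∀ᵐ x ∂H.P, f x = L := by
    have h1 : 0 ≤ᵐ[H.P] fun x => L - f x := by
      filter_upwards [hfL] with x hx; simpa using hx
    have h2 := (integral_eq_zero_iff_of_nonneg_ae h1 ((integrable_const L).sub hfint)).1 (by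
      rw [integral_sub (integrable_const _) hfint]; simp [hL])
    filter_upwards [h2] with x hx
    have : L - f x = 0 := hx
    linarith
  refine ⟨L, ?_⟩
  filter_upwards [hup, hfeq] with x h1 h2
  rw [Metric.tendsto_atTop']
  intro ε hε
  have h3 := eventually_lt_of_lt_liminf_of_abs_le (hu x) (b := L - ε)
    (by change L - ε < f x; linarith)
  obtain ⟨N, hN⟩ := eventually_atTop.1 (h3.and (h1 (ε / 2) (by positivity)))
  refine ⟨N, fun n hn => ?_⟩
  obtain ⟨h4, h5⟩ := hN n hn.le
  rw [Real.dist_eq, abs_lt]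
  constructor <;> linarith

end HypSys

/-! ### Norms of the transfer matrices -/

namespace Szego

open ComplexConjugate

/-- Half of the squared Frobenius norm of the unnormalized transfer matrix. -/
noncomputable def sizeSq (b : ℕ → ℂ) (n : ℕ) : ℝ := ‖(xy b n).1‖ ^ 2 + ‖(xy b n).2‖ ^ 2

lemma xy_smul {c : ℂ} (hc : ‖c‖ = 1) (b : ℕ → ℂ) (n : ℕ) :
    xy (fun k => c * b k) n = ((xy b n).1, c * (xy b n).2) := by
  have h := conj_eq_inv hc
  induction n with
  | zero => simp [xy]
  | succ n ih =>
    simp only [xy, ih, map_mul, Prod.mk.injEq]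
    exact ⟨by linear_combination (-(b n) * conj (xy b n).2) * h, by ring⟩

lemma xy_neg (b : ℕ → ℂ) (n : ℕ) : xy (fun k => -b k) n = ((xy b n).1, -(xy b n).2) := by
  have := xy_smul (c := -1) (by simp) b n
  simpa using this

lemma xy_add (b : ℕ → ℂ) (m n : ℕ) : xy b (m + n) =
    ((xy (fun k => b (m + k)) n).1 * (xy b m).1 + (xy (fun k => b (m + k)) n).2 * conj (xy b m).2,
     (xy (fun k => b (m + k)) n).2 * conj (xy b m).1 + (xy (fun k => b (m + k)) n).1 * (xy b m).2) := by
  induction n with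
  | zero => simp [xy]
  | succ n ih =>
    rw [← add_assoc]
    simp only [xy, ih, map_add, map_mul, Complex.conj_conj, Prod.mk.injEq]
    constructor <;> ring

lemma sizeSq_smul {c : ℂ} (hc : ‖c‖ = 1) (b : ℕ → ℂ) (n : ℕ) :
    sizeSq (fun k => c * b k) n = sizeSq b n := by
  simp only [sizeSq, xy_smul hc, norm_mul, hc, one_mul]

/-- Submultiplicativity of the Frobenius norm for matrices with rows `(x, y)` and `(conj y, conj
x)`. The squared norm is `2 sizeSq`, which explains the factor here and in `logSize`. -/
lemma sizeSq_add_le (b : ℕ → ℂ) (m n : ℕ) :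
    sizeSq b (m + n) ≤ 2 * (sizeSq b m * sizeSq (fun k => b (m + k)) n) := by
  simp only [sizeSq, xy_add]
  set x := (xy b m).1
  set y := (xy b m).2
  set x' := (xy (fun k => b (m + k)) n).1
  set y' := (xy (fun k => b (m + k)) n).2
  have h1 : ‖x' * x + y' * conj y‖ ≤ ‖x'‖ * ‖x‖ + ‖y'‖ * ‖y‖ := by
    refine (norm_add_le _ _).trans (le_of_eq ?_)
    rw [norm_mul, norm_mul, RCLike.norm_conj]
  have h2 : ‖y' * conj x + x' * y‖ ≤ ‖y'‖ * ‖x‖ + ‖x'‖ * ‖y‖ := by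
    refine (norm_add_le _ _).trans (le_of_eq ?_)
    rw [norm_mul, norm_mul, RCLike.norm_conj]
  have h3 := pow_le_pow_left₀ (norm_nonneg _) h1 2
  have h4 := pow_le_pow_left₀ (norm_nonneg _) h2 2
  nlinarith [sq_nonneg (‖x'‖ * ‖y‖ - ‖y'‖ * ‖x‖), sq_nonneg (‖x'‖ * ‖x‖ - ‖y'‖ * ‖y‖)]

/-- Adding or removing one factor with `‖b‖ ≤ 1/4`, at either end of the product, changes the size
at most by a factor `2`. This yields the bounded increments on both sides. -/
lemma half_le_of_perturb {x y u w : ℂ} {t : ℝ} (ht : t ≤ 1 / 4) (hu : ‖u‖ ≤ t * ‖y‖)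
    (hw : ‖w‖ ≤ t * ‖x‖) :
    (‖x‖ ^ 2 + ‖y‖ ^ 2) / 2 ≤ ‖x - u‖ ^ 2 + ‖y - w‖ ^ 2 ∧
    ‖x - u‖ ^ 2 + ‖y - w‖ ^ 2 ≤ 2 * (‖x‖ ^ 2 + ‖y‖ ^ 2) := by
  have nx := norm_nonneg x
  have ny := norm_nonneg y
  have hu' : ‖u‖ ≤ ‖y‖ / 4 := hu.trans (by nlinarith)
  have hw' : ‖w‖ ≤ ‖x‖ / 4 := hw.trans (by nlinarith)
  have low : ∀ p q : ℂ, ‖p‖ ^ 2 - 2 * ‖p‖ * ‖q‖ ≤ ‖p - q‖ ^ 2 := by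
    intro p q
    have h := abs_norm_sub_norm_le p q
    have h2 : (‖p‖ - ‖q‖) ^ 2 ≤ ‖p - q‖ ^ 2 := by
      rw [← sq_abs (‖p‖ - ‖q‖)]; exact pow_le_pow_left₀ (abs_nonneg _) h 2
    nlinarith [sq_nonneg ‖q‖]
  have up : ∀ p q : ℂ, ‖p - q‖ ^ 2 ≤ (‖p‖ + ‖q‖) ^ 2 := fun p q =>
    pow_le_pow_left₀ (norm_nonneg _) (norm_sub_le p q) 2
  constructor
  · have h1 := low x u
    have h2 := low y w
    have h3 := mul_le_mul_of_nonneg_left hu' nx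
    have h4 := mul_le_mul_of_nonneg_left hw' ny
    nlinarith [sq_nonneg (‖x‖ - ‖y‖)]
  · have h1 := up x u
    have h2 := up y w
    have h3 : (‖x‖ + ‖u‖) ^ 2 ≤ (‖x‖ + ‖y‖ / 4) ^ 2 := by gcongr
    have h4 : (‖y‖ + ‖w‖) ^ 2 ≤ (‖y‖ + ‖x‖ / 4) ^ 2 := by gcongr
    nlinarith [sq_nonneg (‖x‖ - ‖y‖)]

lemma sizeSq_succ {b : ℕ → ℂ} {n : ℕ} (hb : ‖b n‖ ≤ 1 / 4) :
    sizeSq b n / 2 ≤ sizeSq b (n + 1) ∧ sizeSq b (n + 1) ≤ 2 * sizeSq b n :=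
  half_le_of_perturb hb (by rw [norm_mul, RCLike.norm_conj])
    (by rw [norm_mul, RCLike.norm_conj])

lemma sizeSq_succ' {b : ℕ → ℂ} (hb : ‖b 0‖ ≤ 1 / 4) (n : ℕ) :
    sizeSq (fun k => b (1 + k)) n / 2 ≤ sizeSq b (n + 1) ∧
    sizeSq b (n + 1) ≤ 2 * sizeSq (fun k => b (1 + k)) n := by
  have e : sizeSq b (n + 1) =
      ‖(xy (fun k => b (1 + k)) n).1 - (xy (fun k => b (1 + k)) n).2 * conj (b 0)‖ ^ 2 +
      ‖(xy (fun k => b (1 + k)) n).2 - (xy (fun k => b (1 + k)) n).1 * b 0‖ ^ 2 := by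
    rw [sizeSq, add_comm n 1, xy_add]
    simp [xy, sub_eq_add_neg]
  rw [e]
  exact half_le_of_perturb hb (by rw [norm_mul, RCLike.norm_conj, mul_comm])
    (by rw [norm_mul, mul_comm])

lemma sizeSq_pos {b : ℕ → ℂ} (hb : ∀ n, ‖b n‖ ≤ 1 / 4) (n : ℕ) : 0 < sizeSq b n := by
  induction n with
  | zero => simp [sizeSq, xy]
  | succ n ih => exact (half_pos ih).trans_le (sizeSq_succ (hb n)).1

/-- The logarithm of the squared Frobenius norm of the transfer matrix. -/
noncomputable def logSize (b : ℕ → ℂ) (n : ℕ) : ℝ :=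
  Real.log (2 * sizeSq b n) - ∑ k ∈ Finset.range n, Real.log (1 - ‖b k‖ ^ 2)

lemma abs_log_sub_log_le_log_two {s t : ℝ} (hs : 0 < s) (h1 : s / 2 ≤ t) (h2 : t ≤ 2 * s) :
    |Real.log (2 * t) - Real.log (2 * s)| ≤ Real.log 2 := by
  have ht : 0 < t := (half_pos hs).trans_le h1
  have a := Real.log_le_log (by positivity) (show 2 * t ≤ 2 * (2 * s) by linarith)
  have b := Real.log_le_log (by positivity) (show 2 * s ≤ 2 * (2 * t) by linarith)
  rw [Real.log_mul two_ne_zero (by positivity : 2 * s ≠ 0)] at a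
  rw [Real.log_mul two_ne_zero (by positivity : 2 * t ≠ 0)] at b
  rw [abs_le]; constructor <;> linarith

lemma abs_log_one_sub_le {b : ℂ} (hb : ‖b‖ ≤ 1 / 4) : |Real.log (1 - ‖b‖ ^ 2)| ≤ Real.log 2 := by
  have h0 := norm_nonneg b
  have h1 : (1:ℝ) / 2 ≤ 1 - ‖b‖ ^ 2 := by nlinarith
  rw [abs_le]
  constructor
  · rw [← Real.log_inv]; exact Real.log_le_log (by norm_num) (by linarith)
  · exact (Real.log_nonpos (by linarith) (by nlinarith)).trans (Real.log_nonneg (by norm_num))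

lemma logSize_zero (b : ℕ → ℂ) : logSize b 0 = Real.log 2 := by simp [logSize, sizeSq, xy]

lemma abs_logSize_succ_sub_le {b : ℕ → ℂ} (hb : ∀ n, ‖b n‖ ≤ 1 / 4) (n : ℕ) :
    |logSize b (n + 1) - logSize b n| ≤ 2 * Real.log 2 := by
  obtain ⟨h1, h2⟩ := sizeSq_succ (hb n)
  have a := abs_log_sub_log_le_log_two (sizeSq_pos hb n) h1 h2
  have c := abs_log_one_sub_le (hb n)
  have e : logSize b (n + 1) - logSize b n = (Real.log (2 * sizeSq b (n + 1)) -
      Real.log (2 * sizeSq b n)) - Real.log (1 - ‖b n‖ ^ 2) := by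
    rw [logSize, logSize, Finset.sum_range_succ]; ring
  rw [e]
  exact (abs_sub _ _).trans (by linarith)

lemma abs_logSize_succ_sub_le' {b : ℕ → ℂ} (hb : ∀ n, ‖b n‖ ≤ 1 / 4) (n : ℕ) :
    |logSize b (n + 1) - logSize (fun k => b (1 + k)) n| ≤ 2 * Real.log 2 := by
  obtain ⟨h1, h2⟩ := sizeSq_succ' (hb 0) n
  have a := abs_log_sub_log_le_log_two (sizeSq_pos (fun k => hb (1 + k)) n) h1 h2
  have c := abs_log_one_sub_le (hb 0)
  have e : logSize b (n + 1) - logSize (fun k => b (1 + k)) n = (Real.log (2 * sizeSq b (n + 1)) -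
      Real.log (2 * sizeSq (fun k => b (1 + k)) n)) - Real.log (1 - ‖b 0‖ ^ 2) := by
    rw [logSize, logSize, Finset.sum_range_succ']; simp only [add_comm 1]; ring
  rw [e]
  exact (abs_sub _ _).trans (by linarith)

lemma logSize_add_le {b : ℕ → ℂ} (hb : ∀ n, ‖b n‖ ≤ 1 / 4) (m n : ℕ) :
    logSize b (m + n) ≤ logSize b m + logSize (fun k => b (m + k)) n := by
  have p1 := sizeSq_pos hb m
  have p2 := sizeSq_pos (fun k => hb (m + k)) n
  have h := Real.log_le_log (mul_pos two_pos (sizeSq_pos hb (m + n)))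
    (show 2 * sizeSq b (m + n) ≤ (2 * sizeSq b m) * (2 * sizeSq (fun k => b (m + k)) n) by
      linarith [sizeSq_add_le b m n])
  rw [Real.log_mul (x := 2 * sizeSq b m) (by positivity) (by positivity)] at h
  rw [logSize, logSize, logSize, Finset.sum_range_add]
  linarith

lemma logSize_smul {c : ℂ} (hc : ‖c‖ = 1) (b : ℕ → ℂ) (n : ℕ) :
    logSize (fun k => c * b k) n = logSize b n := by
  simp only [logSize, sizeSq_smul hc, norm_mul, hc, one_mul]

end Szego

namespace HypSys

open ComplexConjugate Szego

variable {X : Type*} [TopologicalSpace X] [CompactSpace X] [SecondCountableTopology X]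
  [MeasurableSpace X] [BorelSpace X] {H : HypSys X}

lemma abs_log_sub_log_le {s t c : ℝ} (hc : 0 < c) (hs : c ≤ s) (ht : c ≤ t) :
    |Real.log s - Real.log t| ≤ |s - t| / c := by
  have key : ∀ s t : ℝ, c ≤ s → c ≤ t → Real.log s - Real.log t ≤ |s - t| / c := by
    intro s t hs ht
    have s0 := hc.trans_le hs
    have t0 := hc.trans_le ht
    rw [← Real.log_div s0.ne' t0.ne']
    refine (Real.log_le_sub_one_of_pos (div_pos s0 t0)).trans ?_
    rw [div_sub_one t0.ne']
    calc (s - t) / t ≤ |s - t| / t := by gcongr; exact le_abs_self _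
      _ ≤ |s - t| / c := by gcongr
  rw [abs_le]
  have h1 := key s t hs ht
  have h2 := key t s ht hs
  rw [abs_sub_comm] at h2
  constructor <;> linarith

/-- Logarithms of positive observables are observables. -/
lemma Obs.log {f : X → ℝ} {C : ℝ} (hf : H.Obs C fun x => (f x : ℂ)) (hpos : ∀ x, 0 < f x) :
    ∃ C', H.Obs C' fun x => (Real.log (f x) : ℂ) := by
  have hcont : Continuous f := Complex.continuous_re.comp hf.cont
  obtain ⟨x₀⟩ := H.nonempty
  obtain ⟨y, -, hy⟩ := isCompact_univ.exists_isMinOn ⟨x₀, Set.mem_univ _⟩ hcont.continuousOn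
  have hmin : ∀ x, f y ≤ f x := fun x => hy (Set.mem_univ x)
  have hc := hpos y
  have hlc : Continuous fun x => Real.log (f x) := hcont.log fun x => (hpos x).ne'
  obtain ⟨B, hB⟩ := (isCompact_range hlc).isBounded.exists_norm_le
  obtain ⟨D, hD, hD'⟩ := hf.ulip
  have hC := hf.nonneg
  have key : ∀ p q, ‖(Real.log (f q) : ℂ) - Real.log (f p)‖ ≤ ‖(f q : ℂ) - f p‖ / f y := by
    intro p q
    rw [← Complex.ofReal_sub, ← Complex.ofReal_sub, Complex.norm_real, Complex.norm_real]
    exact abs_log_sub_log_le hc (hmin q) (hmin p)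
  refine ⟨max B (C / f y), Complex.continuous_ofReal.comp hlc, fun p => ?_, fun b p => ?_,
    D / f y, by positivity, fun s p => ?_⟩
  · rw [Complex.norm_real]
    exact (hB _ ⟨p, rfl⟩).trans (le_max_left _ _)
  · refine (key _ _).trans ((div_le_div_of_nonneg_right (hf.slip b p) hc.le).trans ?_)
    rw [mul_div_right_comm]
    gcongr
    exact le_max_right _ _
  · refine (key _ _).trans ((div_le_div_of_nonneg_right (hD' s p) hc.le).trans (le_of_eq ?_))
    rw [mul_div_right_comm]

namespace Data

variable {d : H.Data} {lam : ℝ}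

lemma exists_obs_b (n : ℕ) : ∃ C, H.Obs C fun x => d.b lam x n :=
  ⟨_, (d.obs.iter n).const_mul (lam * d.z ^ (n + 1))⟩

lemma exists_obs_xy (n : ℕ) : (∃ C, H.Obs C fun x => (xy (d.b lam x) n).1) ∧
    ∃ C, H.Obs C fun x => (xy (d.b lam x) n).2 := by
  induction n with
  | zero => exact ⟨⟨_, Obs.const 1⟩, ⟨_, Obs.const 0⟩⟩
  | succ n ih =>
    obtain ⟨⟨C₁, h1⟩, ⟨C₂, h2⟩⟩ := ih
    obtain ⟨C₃, h3⟩ := d.exists_obs_b (lam := lam) n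
    exact ⟨⟨_, h1.sub (h3.mul h2.cconj)⟩, ⟨_, h2.sub (h3.mul h1.cconj)⟩⟩

lemma Obs.normSq {f : X → ℂ} {C : ℝ} (hf : H.Obs C f) :
    ∃ C', H.Obs C' fun x => ((‖f x‖ ^ 2 : ℝ) : ℂ) := by
  have e : (fun x => ((‖f x‖ ^ 2 : ℝ) : ℂ)) = fun x => f x * conj (f x) := by
    ext x; rw [Complex.mul_conj, Complex.normSq_eq_norm_sq]
  rw [e]
  exact ⟨_, hf.mul hf.cconj⟩

lemma norm_b_le_quarter (h : d.Small lam) (x : X) (n : ℕ) : ‖d.b lam x n‖ ≤ 1 / 4 :=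
  (norm_b_le h x n).trans h.2.1

lemma exists_obs_logSize (h : d.Small lam) (n : ℕ) :
    ∃ C, H.Obs C fun x => (logSize (d.b lam x) n : ℂ) := by
  have hb := norm_b_le_quarter h
  obtain ⟨⟨C₁, h1⟩, ⟨C₂, h2⟩⟩ := d.exists_obs_xy (lam := lam) n
  obtain ⟨C₃, h3⟩ := Obs.normSq h1
  obtain ⟨C₄, h4⟩ := Obs.normSq h2
  obtain ⟨C₅, h5⟩ := Obs.log (f := fun x => 2 * sizeSq (d.b lam x) n)
    (C := ‖(2:ℂ)‖ * (C₃ + C₄)) (by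
      convert (h3.add h4).const_mul 2 using 2 with x
      simp [sizeSq]) (fun x => mul_pos two_pos (sizeSq_pos (hb x) n))
  have h6 : ∀ k, ∃ C, H.Obs C fun x => (Real.log (1 - ‖d.b lam x k‖ ^ 2) : ℂ) := by
    intro k
    obtain ⟨C, hC⟩ := d.exists_obs_b (lam := lam) k
    obtain ⟨C', hC'⟩ := Obs.normSq hC
    refine Obs.log (f := fun x => 1 - ‖d.b lam x k‖ ^ 2) (C := ‖(1:ℂ)‖ + C') (by
      convert (Obs.const (H := H) 1).sub hC' using 2 with x
      simp) (fun x => ?_)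
    have := hb x k
    nlinarith [norm_nonneg (d.b lam x k)]
  choose C₆ h6 using h6
  refine ⟨C₅ + ∑ k ∈ Finset.range n, C₆ k, ?_⟩
  convert h5.sub (Obs.sum (Finset.range n) fun k _ => h6 k) using 2 with x
  simp [logSize]

/-- A time shift multiplies the rotated coefficients by the unimodular constant `z^m`, to which the
norm is blind; so `logSize` is a subadditive process over `T` although `b` depends explicitly on
time. -/
lemma logSize_shift (m n : ℕ) (x : X) :
    logSize (fun k => d.b lam x (m + k)) n = logSize (d.b lam (H.T^[m] x)) n := by
  have e : (fun k => d.b lam x (m + k)) = fun k => d.z ^ m * d.b lam (H.T^[m] x) k := by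
    ext k
    rw [b, b, ← Function.iterate_add_apply, add_comm m k]; ring
  rw [e, logSize_smul (norm_z_pow m)]

/-- The Lyapunov exponent exists. -/
theorem exists_tendsto_logSize (h : d.Small lam) :
    ∃ L, ∀ᵐ x ∂H.P, Tendsto (fun n : ℕ => logSize (d.b lam x) n / n) atTop (𝓝 L) := by
  have hb := norm_b_le_quarter h
  have hl : 0 ≤ Real.log 2 := Real.log_nonneg (by norm_num)
  refine exists_tendsto_of_subadditive (B := 2 * Real.log 2) (exists_obs_logSize h)
    (fun m n x => ?_) (fun x => ?_) (fun n x => abs_logSize_succ_sub_le (hb x) n) (fun n x => ?_)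
  · rw [← logSize_shift]; exact logSize_add_le (hb x) m n
  · rw [logSize_zero, abs_of_nonneg hl]; linarith
  · have := abs_logSize_succ_sub_le' (hb x) n
    rwa [logSize_shift] at this

end Data

end HypSys

/-! ### From the phases to the Lyapunov exponent -/

namespace HypSys

open ComplexConjugate Szego

variable {X : Type*} [TopologicalSpace X] [CompactSpace X] [SecondCountableTopology X]
  [MeasurableSpace X] [BorelSpace X] {H : HypSys X}

namespace Data

/-- The data with the opposite sampling function. -/
noncomputable def neg (d : H.Data) : H.Data where
  α x := -d.α x
  z := d.z
  K := d.K
  one_le_K := d.one_le_K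
  obs := d.obs.neg
  ulip s p := by rw [← neg_sub', norm_neg]; exact d.ulip s p
  bound p := by rw [norm_neg]; exact d.bound p
  mean := by rw [integral_neg, d.mean, neg_zero]
  hz := d.hz

variable {d : H.Data} {lam : ℝ}

lemma neg_b (x : X) : d.neg.b lam x = fun k => -d.b lam x k := by
  ext k; simp [neg, b]

lemma neg_J : d.neg.J = d.J := by
  simp [J, corrRe, corr, neg]

/-- For the starting phase `1` the denominator is the conjugate of the sum of the two entries, which
is the solution behind `φ_n`; the opposite data give the difference, behind `ψ_n`. -/
lemma sum_ξ (h : d.Small lam) (x : X) (n : ℕ) : ∑ k ∈ Finset.range n, d.ξ lam k x =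
    Real.log (‖(xy (d.b lam x) n).1 + (xy (d.b lam x) n).2‖ ^ 2) -
      ∑ k ∈ Finset.range n, Real.log (1 - ‖d.b lam x k‖ ^ 2) := by
  have e := sum_log_den (norm_b_lt h x) (v₀ := 1) norm_one n
  have e2 : ‖den (d.b lam x) 1 n‖ = ‖(xy (d.b lam x) n).1 + (xy (d.b lam x) n).2‖ := by
    rw [den, mul_one, ← map_add, RCLike.norm_conj]
  rw [e2] at e
  rw [← e, ← Finset.sum_sub_distrib]
  rfl

lemma add_ne_zero (h : d.Small lam) (x : X) (n : ℕ) :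
    (xy (d.b lam x) n).1 + (xy (d.b lam x) n).2 ≠ 0 := by
  have := (den_spec (norm_b_lt h x) (v₀ := 1) norm_one n).1
  rw [den, mul_one, ← map_add] at this
  exact fun h0 => this (by rw [h0, map_zero])

/-- The transfer matrices grow like the larger of the two solutions. -/
lemma abs_logSize_sub_le (h : d.Small lam) (x : X) (n : ℕ) {c ε : ℝ}
    (h1 : |∑ k ∈ Finset.range n, d.ξ lam k x - c| ≤ ε)
    (h2 : |∑ k ∈ Finset.range n, d.neg.ξ lam k x - c| ≤ ε) :
    |logSize (d.b lam x) n - c| ≤ ε + Real.log 2 := by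
  have h' : d.neg.Small lam := h
  have n1 := add_ne_zero h x n
  have n2 := add_ne_zero h' x n
  rw [sum_ξ h] at h1
  rw [sum_ξ h'] at h2
  rw [neg_b, xy_neg] at n2
  simp only [neg_b, xy_neg, norm_neg] at h2
  set R := ∑ k ∈ Finset.range n, Real.log (1 - ‖d.b lam x k‖ ^ 2)
  set p := (xy (d.b lam x) n).1
  set q := (xy (d.b lam x) n).2
  simp only [← sub_eq_add_neg] at n2 h2
  have p1 : 0 < ‖p + q‖ ^ 2 := by positivity
  have p2 : 0 < ‖p - q‖ ^ 2 := by positivity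
  have e : 2 * sizeSq (d.b lam x) n = ‖p + q‖ ^ 2 + ‖p - q‖ ^ 2 := by
    have := parallelogram_law_with_norm ℝ p q
    rw [sizeSq]; linarith
  have hl : 0 ≤ Real.log 2 := Real.log_nonneg (by norm_num)
  rw [logSize, e]
  change |Real.log (‖p + q‖ ^ 2 + ‖p - q‖ ^ 2) - R - c| ≤ _
  have low := Real.log_le_log p1 (show ‖p + q‖ ^ 2 ≤ ‖p + q‖ ^ 2 + ‖p - q‖ ^ 2 by linarith)
  rw [abs_le] at *
  refine ⟨by linarith, ?_⟩
  rcases le_total (‖p + q‖ ^ 2) (‖p - q‖ ^ 2) with hle | hle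
  · have up := Real.log_le_log (add_pos p1 p2)
      (show ‖p + q‖ ^ 2 + ‖p - q‖ ^ 2 ≤ 2 * ‖p - q‖ ^ 2 by linarith)
    rw [Real.log_mul two_ne_zero p2.ne'] at up
    linarith
  · have up := Real.log_le_log (add_pos p1 p2)
      (show ‖p + q‖ ^ 2 + ‖p - q‖ ^ 2 ≤ 2 * ‖p + q‖ ^ 2 by linarith)
    rw [Real.log_mul two_ne_zero p1.ne'] at up
    linarith

lemma expSmall_ξ (d : H.Data)
    (h : LDle H.P (fun n x => ((d.ξ lam n x - lam ^ 2 * d.J : ℝ) : ℂ)) (lam ^ 3)) (h0 : 0 < lam) :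
    ExpSmall H.P fun N => {x | 3 / 2 * lam ^ 3 * N <
      |∑ k ∈ Finset.range N, d.ξ lam k x - N * (lam ^ 2 * d.J)|} := by
  refine (show ExpSmall H.P _ from h (3 / 2 * lam ^ 3) (by have : 0 < lam ^ 3 := by positivity
                                                           linarith)).mono
    (Eventually.of_forall fun N x hx => ?_)
  simp only [Set.mem_ofPred_eq] at hx ⊢
  rwa [← Complex.ofReal_sum, Complex.norm_real, Real.norm_eq_abs, Finset.sum_sub_distrib,
    Finset.sum_const, Finset.card_range, nsmul_eq_mul]

/-- Asymptotics of the Lyapunov exponent and large deviation estimates, for small coupling. -/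
theorem exists_lyapunov (d : H.Data) (hz1 : d.z ≠ 1) (hz2 : d.z ^ 2 ≠ 1) :
    ∃ lam₀, 0 < lam₀ ∧ lam₀ < 1 ∧ ∀ lam, 0 < lam → lam < lam₀ →
    (∃ L, (∀ᵐ x ∂H.P, Tendsto (fun n : ℕ => logSize (d.b lam x) n / n) atTop (𝓝 L)) ∧
      |L - lam ^ 2 * d.J| ≤ 2 * lam ^ 3) ∧
    ExpSmall H.P fun N => {x | 2 * lam ^ 3 * N <
      |logSize (d.b lam x) N - N * (lam ^ 2 * d.J)|} := by
  obtain ⟨l₁, p1, hl₁⟩ := exists_ldle_growth d hz1 hz2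
  obtain ⟨l₂, p2, hl₂⟩ := exists_ldle_growth d.neg hz1 hz2
  refine ⟨min (min l₁ l₂) (1 / 2), lt_min (lt_min p1 p2) (by norm_num),
    (min_le_right _ _).trans_lt (by norm_num), fun lam h0 hl => ?_⟩
  obtain ⟨h, e1⟩ := hl₁ lam h0 (hl.trans_le ((min_le_left _ _).trans (min_le_left _ _)))
  obtain ⟨-, e2⟩ := hl₂ lam h0 (hl.trans_le ((min_le_left _ _).trans (min_le_right _ _)))
  have l3 : 0 < lam ^ 3 := by positivity
  have big : ∀ᶠ N : ℕ in atTop, Real.log 2 ≤ N * (lam ^ 3 / 2) :=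
    (tendsto_natCast_atTop_atTop.atTop_mul_const (by positivity)).eventually_ge_atTop _
  have small : ExpSmall H.P fun N => {x | 2 * lam ^ 3 * N <
      |logSize (d.b lam x) N - N * (lam ^ 2 * d.J)|} := by
    refine ((expSmall_ξ d e1 h0).union (expSmall_ξ d.neg e2 h0)).mono ?_
    filter_upwards [big] with N hN x hx
    simp only [Set.mem_union, Set.mem_ofPred_eq, neg_J] at hx ⊢
    by_contra! hcon
    have := abs_logSize_sub_le h x N hcon.1 hcon.2
    linarith
  refine ⟨?_, small⟩
  obtain ⟨L, hL⟩ := exists_tendsto_logSize h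
  refine ⟨L, hL, ?_⟩
  -- As `L` is constant, one point where both almost sure statements hold is enough.
  obtain ⟨x, hx1, hx2⟩ := (hL.and small.ae_eventually_notMem).exists
  have hlim : Tendsto (fun n : ℕ => |logSize (d.b lam x) n / n - lam ^ 2 * d.J|) atTop
      (𝓝 |L - lam ^ 2 * d.J|) := (hx1.sub_const _).abs
  refine le_of_tendsto hlim ?_
  filter_upwards [hx2, eventually_ge_atTop 1] with N h1 h2
  have hN : (0:ℝ) < N := by exact_mod_cast h2
  have h3 : |logSize (d.b lam x) N - N * (lam ^ 2 * d.J)| ≤ 2 * lam ^ 3 * N := not_lt.1 h1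
  have e : logSize (d.b lam x) N / N - lam ^ 2 * d.J =
      (logSize (d.b lam x) N - N * (lam ^ 2 * d.J)) / N := by field_simp
  rw [e, abs_div, abs_of_pos hN, div_le_iff₀ hN]
  exact h3

end Data

end HypSys

/-! ### Eigenvalues and eigenvectors of a hyperbolic integer matrix -/

section HyperbolicMatrix

variable {A : Matrix (Fin 2) (Fin 2) ℤ}

/-- A negative discriminant would force determinant `1` and conjugate eigenvalues of modulus one. So
both are real with product `±1`; neither has modulus one, hence one expands and the other contracts.
-/
lemma exists_real_eigenvalues (hA : IsHyperbolicToral A) : ∃ κ κ' : ℝ, 1 < |κ| ∧ |κ'| = |κ|⁻¹ ∧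
    κ + κ' = (A.trace : ℝ) ∧ κ * κ' = (A.det : ℝ) := by
  obtain ⟨hu, hs⟩ := hA
  set B : Matrix (Fin 2) (Fin 2) ℂ := A.map (Int.cast : ℤ → ℂ) with hB
  have htr : B.trace = (A.trace : ℂ) := by simp [hB, Matrix.trace]
  have hdet : B.det = (A.det : ℂ) := by simp [hB, Matrix.det_fin_two]
  have hroot : ∀ w : ℂ, w ^ 2 - A.trace * w + A.det = 0 → ‖w‖ ≠ 1 := by
    intro w hw
    refine hs w (Matrix.mem_spectrum_iff_isRoot_charpoly.2 ?_)
    rw [Matrix.charpoly_fin_two, htr, hdet]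
    simpa [Polynomial.IsRoot] using hw
  have hd2 : (A.det : ℝ) = 1 ∨ (A.det : ℝ) = -1 := by
    rcases Int.isUnit_iff.1 hu with h | h <;> simp [h]
  set t : ℝ := (A.trace : ℝ) with ht
  set D : ℝ := (A.det : ℝ) with hD
  have htc : ((A.trace : ℤ) : ℂ) = (t : ℂ) := by simp [ht]
  have hDc : ((A.det : ℤ) : ℂ) = (D : ℂ) := by simp [hD]
  rw [htc, hDc] at hroot
  have hΔ : 0 ≤ t ^ 2 - 4 * D := by
    by_contra! hneg
    have hD1 : D = 1 := by
      rcases hd2 with h | h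
      · exact h
      · rw [h] at hneg; nlinarith [sq_nonneg t]
    have hs0 := Real.sq_sqrt (show 0 ≤ 4 * D - t ^ 2 by linarith)
    set s := Real.sqrt (4 * D - t ^ 2)
    refine hroot (⟨t / 2, s / 2⟩ : ℂ) ?_ ?_
    · apply Complex.ext
      · simp [sq]; nlinarith
      · simp [sq]; ring
    · have : ‖(⟨t / 2, s / 2⟩ : ℂ)‖ ^ 2 = 1 := by
        rw [← Complex.normSq_eq_norm_sq, Complex.normSq_mk]; nlinarith
      exact (pow_eq_one_iff_of_nonneg (norm_nonneg _) two_ne_zero).1 this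
  have hs0 := Real.sq_sqrt hΔ
  set s := Real.sqrt (t ^ 2 - 4 * D)
  have hreal : ∀ x : ℝ, x ^ 2 - t * x + D = 0 → |x| ≠ 1 := by
    intro x hx
    have := hroot x (by exact_mod_cast hx)
    rwa [Complex.norm_real] at this
  have h1 := hreal ((t + s) / 2) (by nlinarith)
  have h2 := hreal ((t - s) / 2) (by nlinarith)
  have hprod : (t + s) / 2 * ((t - s) / 2) = D := by nlinarith
  have habs : |(t + s) / 2| * |(t - s) / 2| = 1 := by
    rw [← abs_mul, hprod]; rcases hd2 with h | h <;> simp [h]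
  rcases lt_or_gt_of_ne h1 with h | h
  · refine ⟨(t - s) / 2, (t + s) / 2, ?_, eq_inv_of_mul_eq_one_left habs, by ring,
      by rw [mul_comm]; exact hprod⟩
    by_contra! hcon
    nlinarith [abs_nonneg ((t + s) / 2), abs_nonneg ((t - s) / 2)]
  · exact ⟨(t + s) / 2, (t - s) / 2, h, eq_inv_of_mul_eq_one_right habs, by ring, hprod⟩

lemma exists_real_eigenvector {κ κ' : ℝ} (h1 : κ + κ' = (A.trace : ℝ))
    (h2 : κ * κ' = (A.det : ℝ)) :
    ∃ e : Fin 2 → ℝ, e ≠ 0 ∧ ∀ i, ∑ j, (A i j : ℝ) * e j = κ * e i := by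
  set B : Matrix (Fin 2) (Fin 2) ℝ := A.map (Int.cast : ℤ → ℝ) - Matrix.diagonal fun _ => κ with hB
  have hdet : B.det = 0 := by
    rw [Matrix.trace_fin_two] at h1
    rw [Matrix.det_fin_two] at h2 ⊢
    push_cast at h1 h2
    simp [hB]
    linear_combination κ * h1 - h2
  obtain ⟨e, he, he'⟩ := Matrix.exists_mulVec_eq_zero_iff.2 hdet
  refine ⟨e, he, fun i => ?_⟩
  have := congrFun he' i
  rw [hB, Matrix.sub_mulVec, Pi.sub_apply, Matrix.mulVec_diagonal, Pi.zero_apply, sub_eq_zero] at this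
  rw [← this]
  simp [Matrix.mulVec, dotProduct]

/-- Eigenvectors for distinct eigenvalues are independent; a vanishing determinant would give the
relations with coefficients `(e' i, -e i)`. -/
lemma eigenvector_det_ne_zero {κ κ' : ℝ} (hne : κ ≠ κ') {e e' : Fin 2 → ℝ} (he : e ≠ 0)
    (he' : e' ≠ 0) (h : ∀ i, ∑ j, (A i j : ℝ) * e j = κ * e i)
    (h' : ∀ i, ∑ j, (A i j : ℝ) * e' j = κ' * e' i) : e 0 * e' 1 - e 1 * e' 0 ≠ 0 := by
  intro hδ
  have key : ∀ p q : ℝ, (∀ i, p * e i + q * e' i = 0) → p = 0 ∧ q = 0 := by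
    intro p q hpq
    have hA : ∀ i, p * (κ * e i) + q * (κ' * e' i) = 0 := by
      intro i
      rw [← h, ← h', Finset.mul_sum, Finset.mul_sum, ← Finset.sum_add_distrib]
      refine Finset.sum_eq_zero fun j _ => ?_
      linear_combination (A i j : ℝ) * hpq j
    have hp : p = 0 := by
      by_contra hp
      refine he (funext fun i => ?_)
      have : (p * (κ - κ')) * e i = 0 := by linear_combination hA i - κ' * hpq i
      exact (mul_eq_zero.1 this).resolve_left (mul_ne_zero hp (sub_ne_zero.2 hne))
    refine ⟨hp, ?_⟩
    by_contra hq
    refine he' (funext fun i => ?_)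
    have := hpq i
    rw [hp, zero_mul, zero_add] at this
    exact (mul_eq_zero.1 this).resolve_left hq
  have k0 := key (e' 0) (-e 0) (fun i => by fin_cases i <;> simp <;> linarith)
  have k1 := key (e' 1) (-e 1) (fun i => by fin_cases i <;> simp <;> linarith)
  refine he (funext fun i => ?_)
  fin_cases i
  · simpa using k0.2
  · simpa using k1.2

end HyperbolicMatrix

/-! ### The torus as a hyperbolic system -/

section Torus

/-- The projection of the plane to the torus. -/
noncomputable def toTorus (v : Fin 2 → ℝ) : Torus2 := fun i => (v i : AddCircle (2 * Real.pi))

lemma toTorus_add (v w : Fin 2 → ℝ) : toTorus (v + w) = toTorus v + toTorus w := rfl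

lemma isOpenQuotientMap_toTorus : IsOpenQuotientMap toTorus :=
  IsOpenQuotientMap.piMap fun _ => QuotientAddGroup.isOpenQuotientMap_mk

lemma continuous_toTorus : Continuous toTorus := isOpenQuotientMap_toTorus.continuous

lemma exists_toTorus (p : Torus2) : ∃ v : Fin 2 → ℝ, (∀ i, v i ∈ Set.Icc 0 (2 * Real.pi)) ∧
    toTorus v = p := by
  have h : ∀ i, ∃ x : ℝ, x ∈ Set.Icc 0 (2 * Real.pi) ∧ (x : AddCircle (2 * Real.pi)) = p i := by
    intro i
    obtain ⟨x, hx, hx'⟩ := (AddCircle.coe_image_Ico_eq (2 * Real.pi) 0).ge (Set.mem_univ (p i))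
    rw [zero_add] at hx
    exact ⟨x, ⟨hx.1, hx.2.le⟩, hx'⟩
  choose v hv hv' using h
  exact ⟨v, hv, funext hv'⟩

/-- The toral endomorphism as a group homomorphism. -/
noncomputable def toralHom (A : Matrix (Fin 2) (Fin 2) ℤ) : Torus2 →+ Torus2 where
  toFun := toralMap A
  map_zero' := by ext i; simp [toralMap]
  map_add' p q := by ext i; simp [toralMap, Finset.sum_add_distrib]

lemma toralMap_toTorus (A : Matrix (Fin 2) (Fin 2) ℤ) (v : Fin 2 → ℝ) :
    toralMap A (toTorus v) = toTorus fun i => ∑ j, (A i j : ℝ) * v j := by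
  ext i
  simp only [toralMap, toTorus]
  simp [← zsmul_eq_mul]

lemma toralMap_add (A : Matrix (Fin 2) (Fin 2) ℤ) (p q : Torus2) :
    toralMap A (p + q) = toralMap A p + toralMap A q := (toralHom A).map_add p q

lemma continuous_toralMap (A : Matrix (Fin 2) (Fin 2) ℤ) : Continuous (toralMap A) := by
  unfold toralMap; fun_prop

lemma surjective_toralMap {A : Matrix (Fin 2) (Fin 2) ℤ} (hA : IsUnit A.det) :
    Function.Surjective (toralMap A) := by
  intro p
  obtain ⟨v, -, rfl⟩ := exists_toTorus p
  refine ⟨toTorus fun i => ∑ j, ((A⁻¹) i j : ℝ) * v j, ?_⟩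
  rw [toralMap_toTorus]
  congr 1
  ext i
  have h := Matrix.mul_nonsing_inv A hA
  have e : ∀ k, ∑ j, (A i j : ℝ) * ((A⁻¹) j k : ℝ) = if i = k then 1 else 0 := by
    intro k
    have := congrFun (congrFun h i) k
    rw [Matrix.mul_apply, Matrix.one_apply] at this
    exact_mod_cast this
  calc ∑ j, (A i j : ℝ) * ∑ k, ((A⁻¹) j k : ℝ) * v k
      = ∑ k, (∑ j, (A i j : ℝ) * ((A⁻¹) j k : ℝ)) * v k := by
        simp only [Finset.mul_sum, Finset.sum_mul]
        rw [Finset.sum_comm]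
        simp only [mul_assoc]
    _ = v i := by simp [e]

/-- Normalized Lebesgue measure on the torus. -/
noncomputable def torusProb : Measure Torus2 := (volume (Set.univ : Set Torus2))⁻¹ • volume

instance : IsProbabilityMeasure torusProb := by
  unfold torusProb; infer_instance

lemma volume_univ_torus : volume (Set.univ : Set Torus2) = ENNReal.ofReal (4 * Real.pi ^ 2) := by
  rw [volume_pi, Measure.pi_univ]
  simp only [AddCircle.measure_univ, Finset.prod_const, Finset.card_univ, Fintype.card_fin]
  rw [← ENNReal.ofReal_pow (by positivity)]
  ring_nf

lemma torusMean_eq (f : Torus2 → ℂ) : torusMean f = ∫ p, f p ∂torusProb := by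
  rw [torusMean, torusProb, integral_smul_measure, volume_univ_torus, ← ENNReal.ofReal_inv_of_pos (by positivity),
    ENNReal.toReal_ofReal (by positivity), Complex.real_smul]
  push_cast
  rw [one_div]

lemma measurePreserving_translation (q : Torus2) :
    MeasurePreserving (fun p => p + q) torusProb torusProb :=
  (measurePreserving_add_right volume q).smul_measure _

/-- A continuous surjective endomorphism of a compact group preserves Haar measure. -/
lemma measurePreserving_toralMap {A : Matrix (Fin 2) (Fin 2) ℤ} (hA : IsUnit A.det) :
    MeasurePreserving (toralMap A) torusProb torusProb :=
  (AddMonoidHom.measurePreserving (μ := volume) (ν := volume) (f := toralHom A)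
    (continuous_toralMap A) (surjective_toralMap hA) rfl).smul_measure _

/-- Translation flow in direction `e`. -/
noncomputable def torusFlow (e : Fin 2 → ℝ) (s : ℝ) (p : Torus2) : Torus2 := p + toTorus (s • e)

lemma continuous_torusFlow (e : Fin 2 → ℝ) : Continuous fun q : ℝ × Torus2 => torusFlow e q.1 q.2 :=
  continuous_snd.add (continuous_toTorus.comp (continuous_fst.smul continuous_const))

lemma toralMap_torusFlow {A : Matrix (Fin 2) (Fin 2) ℤ} {e : Fin 2 → ℝ} {κ : ℝ}
    (h : ∀ i, ∑ j, (A i j : ℝ) * e j = κ * e i) (s : ℝ) (p : Torus2) :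
    toralMap A (torusFlow e s p) = torusFlow e (κ * s) (toralMap A p) := by
  rw [torusFlow, toralMap_add, toralMap_toTorus, torusFlow]
  congr 2
  ext i
  simp only [Pi.smul_apply, smul_eq_mul]
  rw [mul_comm κ s, mul_assoc, ← h, Finset.mul_sum]
  exact Finset.sum_congr rfl fun j _ => by ring

/-- Lift the difference of the points to `[0, 2π]²` and expand it in the basis `e`, `e'`; Cramer's
rule bounds the coefficients uniformly. -/
lemma exists_joined {e e' : Fin 2 → ℝ} (hδ : e 0 * e' 1 - e 1 * e' 0 ≠ 0) :
    ∃ R : ℝ, ∀ p q, ∃ a b, |a| ≤ R ∧ |b| ≤ R ∧ q = torusFlow e a (torusFlow e' b p) := by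
  set δ := e 0 * e' 1 - e 1 * e' 0 with hδd
  have hδp : 0 < |δ| := abs_pos.2 hδ
  refine ⟨2 * Real.pi * (|e 0| + |e 1| + |e' 0| + |e' 1|) / |δ|, fun p q => ?_⟩
  obtain ⟨v, hv, hvp⟩ := exists_toTorus (q - p)
  have hv' : ∀ i, |v i| ≤ 2 * Real.pi := fun i => by
    rw [abs_of_nonneg (hv i).1]; exact (hv i).2
  have bd : ∀ c c' : ℝ, |c| + |c'| ≤ |e 0| + |e 1| + |e' 0| + |e' 1| →
      |(v 0 * c - v 1 * c') / δ| ≤ 2 * Real.pi * (|e 0| + |e 1| + |e' 0| + |e' 1|) / |δ| := by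
    intro c c' hcc
    rw [abs_div]
    gcongr
    calc |v 0 * c - v 1 * c'| ≤ |v 0 * c| + |v 1 * c'| := abs_sub _ _
      _ = |v 0| * |c| + |v 1| * |c'| := by rw [abs_mul, abs_mul]
      _ ≤ 2 * Real.pi * |c| + 2 * Real.pi * |c'| := by gcongr <;> exact hv' _
      _ = 2 * Real.pi * (|c| + |c'|) := by ring
      _ ≤ _ := by gcongr
  refine ⟨(v 0 * e' 1 - v 1 * e' 0) / δ, (v 0 * (-e 1) - v 1 * (-e 0)) / δ, bd _ _ ?_, bd _ _ ?_, ?_⟩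
  · linarith [abs_nonneg (e 0), abs_nonneg (e 1)]
  · rw [abs_neg, abs_neg]; linarith [abs_nonneg (e' 0), abs_nonneg (e' 1)]
  · rw [torusFlow, torusFlow, add_assoc, ← toTorus_add]
    have : ((v 0 * (-e 1) - v 1 * (-e 0)) / δ) • e' + ((v 0 * e' 1 - v 1 * e' 0) / δ) • e = v := by
      ext i
      simp only [Pi.add_apply, Pi.smul_apply, smul_eq_mul]
      fin_cases i
      · simp only [Fin.zero_eta, Fin.isValue]; field_simp; rw [hδd]; ring
      · simp only [Fin.mk_one, Fin.isValue]; field_simp; rw [hδd]; ring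
    rw [this, hvp]; abel

/-- A hyperbolic toral automorphism with its unstable and stable linear flows. -/
theorem exists_hypSys {A : Matrix (Fin 2) (Fin 2) ℤ} (hA : IsHyperbolicToral A) :
    ∃ H : HypSys Torus2, H.P = torusProb ∧ H.T = toralMap A ∧
      (∃ e, H.U = torusFlow e) ∧ ∃ e, H.S = torusFlow e := by
  obtain ⟨κ, κ', h1, h2, h3, h4⟩ := exists_real_eigenvalues hA
  obtain ⟨e, he, hAe⟩ := exists_real_eigenvector h3 h4
  obtain ⟨e', he', hAe'⟩ := exists_real_eigenvector (κ := κ') (κ' := κ) (by rw [add_comm, h3])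
    (by rw [mul_comm, h4])
  have hne : κ ≠ κ' := by
    rintro rfl
    have : |κ|⁻¹ < 1 := inv_lt_one_of_one_lt₀ h1
    linarith
  obtain ⟨R, hR⟩ := exists_joined (eigenvector_det_ne_zero hne he he' hAe hAe')
  exact ⟨{
    P := torusProb
    prob := inferInstance
    T := toralMap A
    U := torusFlow e
    S := torusFlow e'
    κ := κ
    κ' := κ'
    R := R
    cont_T := continuous_toralMap A
    mp_T := measurePreserving_toralMap hA.1
    surj_T := surjective_toralMap hA.1
    cont_U := continuous_torusFlow e
    mp_U := fun s => measurePreserving_translation _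
    U_add := fun s t p => by
      rw [torusFlow, torusFlow, torusFlow, add_assoc, ← toTorus_add, ← add_smul, add_comm t s]
    comm := fun s t p => by rw [torusFlow, torusFlow, torusFlow, torusFlow, add_right_comm]
    T_U := toralMap_torusFlow hAe
    T_S := toralMap_torusFlow hAe'
    one_lt := h1
    abs_κ' := h2
    joined := hR }, rfl, rfl, ⟨e, rfl⟩, ⟨e', rfl⟩⟩

lemma continuous_of_isC1 {f : Torus2 → ℂ} (hf : IsC1OnTorus f) : Continuous f :=
  isOpenQuotientMap_toTorus.isQuotientMap.continuous_iff.2 hf.continuous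

/-- `C¹` functions on the torus are Lipschitz along linear flows. -/
lemma exists_lipschitz {f : Torus2 → ℂ} (hf : IsC1OnTorus f) :
    ∃ C, 0 ≤ C ∧ ∀ e s p, ‖f (torusFlow e s p) - f p‖ ≤ C * ‖e‖ * |s| := by
  set F : (Fin 2 → ℝ) → ℂ := fun v => f (toTorus v) with hF
  have hF1 : ContDiff ℝ 1 F := hf
  have hcont : Continuous (fderiv ℝ F) := hF1.continuous_fderiv one_ne_zero
  have hK : IsCompact (Set.univ.pi fun _ : Fin 2 => Set.Icc (0:ℝ) (2 * Real.pi)) :=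
    isCompact_univ_pi fun _ => isCompact_Icc
  obtain ⟨C, hC⟩ := (hK.image hcont).isBounded.exists_norm_le
  -- Periodicity carries the bound from one compact period square to the plane.
  have hper : ∀ v, ‖fderiv ℝ F v‖ ≤ max C 0 := by
    intro v
    obtain ⟨w, hw, hwv⟩ := exists_toTorus (toTorus v)
    have e : F = fun y => F (y + (w - v)) := by
      ext y
      have h0 : toTorus (w - v) = 0 := by
        have : toTorus (w - v) + toTorus v = toTorus v := by rw [← toTorus_add, sub_add_cancel, hwv]
        simpa using this
      simp only [hF, toTorus_add, h0, add_zero]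
    have h1 : fderiv ℝ F v = fderiv ℝ F w := by
      conv_lhs => rw [e]
      rw [fderiv_comp_add_right]; simp
    rw [h1]
    exact (hC _ ⟨w, fun i _ => hw i, rfl⟩).trans (le_max_left _ _)
  refine ⟨max C 0, le_max_right _ _, fun e s p => ?_⟩
  obtain ⟨v, -, rfl⟩ := exists_toTorus p
  have h := convex_univ.norm_image_sub_le_of_norm_fderiv_le (𝕜 := ℝ) (f := F) (C := max C 0)
    (fun x _ => (hF1.differentiable one_ne_zero) x) (fun x _ => hper x) (Set.mem_univ v)
    (Set.mem_univ (v + s • e))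
  rw [add_sub_cancel_left, norm_smul, Real.norm_eq_abs] at h
  rw [torusFlow, ← toTorus_add]
  refine h.trans (le_of_eq (by ring))

end Torus

/-! ### Orthonormal polynomials in terms of the transfer matrices -/

section OrthogonalPolynomials

open ComplexConjugate Szego

variable {a : ℕ → ℂ} {z : ℂ}

lemma natDegree_orthoPoly_le (a : ℕ → ℂ) (n : ℕ) : (orthoPoly a n).natDegree ≤ n := by
  induction n with
  | zero => simp [orthoPoly]
  | succ n ih =>
    rw [orthoPoly]
    refine (Polynomial.natDegree_C_mul_le _ _).trans ((Polynomial.natDegree_sub_le _ _).trans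
      (max_le ?_ ((Polynomial.natDegree_C_mul_le _ _).trans ?_)))
    · refine Polynomial.natDegree_mul_le.trans ?_
      rw [Polynomial.natDegree_X]; omega
    · refine Polynomial.natDegree_reflect_le.trans (max_le (by omega) ?_)
      exact (Polynomial.natDegree_map_le).trans (by omega)

lemma eval_szegoDual (hz : ‖z‖ = 1) {n : ℕ} {P : Polynomial ℂ} (hP : P.natDegree ≤ n) :
    (szegoDual n P).eval z = z ^ n * conj (P.eval z) := by
  have hzz := conj_eq_inv hz
  have hzz' : z * conj z = 1 := by rw [mul_comm]; exact hzz
  let _ : Invertible (conj z) := ⟨z, hzz', hzz⟩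
  have h := Polynomial.eval₂_reflect_mul_pow (RingHom.id ℂ) (conj z) n (P.map (starRingEnd ℂ))
    (Polynomial.natDegree_map_le.trans hP)
  have h1 : ⅟(conj z) = z := rfl
  rw [h1] at h
  simp only [Polynomial.eval₂_id] at h
  rw [Polynomial.eval_map, Polynomial.eval₂_hom] at h
  rw [szegoDual, ← h]
  have hn : z ^ n * conj z ^ n = 1 := by rw [← mul_pow, hzz', one_pow]
  linear_combination -(Polynomial.eval z (Polynomial.reflect n (P.map (starRingEnd ℂ)))) * hn

/-- On the circle the dual polynomial is `z^n` times the conjugate value, so the recursion closes on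
`φ_n(z)` and its conjugate. Removing the free rotation `z^n` turns `a_k` into `z^(k+1) a_k` and
leaves the recursion of `xy`. -/
lemma prod_sqrt_mul_eval_orthoPoly (ha : ∀ n, ‖a n‖ < 1) (hz : ‖z‖ = 1) (n : ℕ) :
    ((∏ k ∈ Finset.range n, Real.sqrt (1 - ‖a k‖ ^ 2) : ℝ) : ℂ) * (orthoPoly a n).eval z =
      z ^ n * conj ((xy (fun k => z ^ (k + 1) * a k) n).1 +
        (xy (fun k => z ^ (k + 1) * a k) n).2) := by
  induction n with
  | zero => simp [orthoPoly, xy]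
  | succ n ih =>
    have hs : ((Real.sqrt (1 - ‖a n‖ ^ 2) : ℝ) : ℂ) ≠ 0 := by
      have : 0 < Real.sqrt (1 - ‖a n‖ ^ 2) := Real.sqrt_pos.2 (by
        nlinarith [ha n, norm_nonneg (a n)])
      exact_mod_cast this.ne'
    rw [Finset.prod_range_succ, orthoPoly]
    simp only [Polynomial.eval_mul, Polynomial.eval_sub, Polynomial.eval_C, Polynomial.eval_X,
      eval_szegoDual hz (natDegree_orthoPoly_le a n), Complex.ofReal_mul, Complex.ofReal_inv]
    set r := ((∏ k ∈ Finset.range n, Real.sqrt (1 - ‖a k‖ ^ 2) : ℝ) : ℂ) with hr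
    have hrc : conj r = r := Complex.conj_ofReal _
    have ih' := congrArg conj ih
    simp only [map_mul, map_pow, map_add, Complex.conj_conj, hrc] at ih'
    simp only [xy, map_sub, map_mul, map_add, map_pow, Complex.conj_conj]
    simp only [map_add] at ih
    set p := (xy (fun k => z ^ (k + 1) * a k) n).1
    set q := (xy (fun k => z ^ (k + 1) * a k) n).2
    set φ := (orthoPoly a n).eval z
    have hzn : z ^ n * conj z ^ n = 1 := by
      rw [← mul_pow, mul_comm z, conj_eq_inv hz, one_pow]
    have hzn1 : z ^ (n + 1) * conj z ^ (n + 1) = 1 := by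
      rw [← mul_pow, mul_comm z, conj_eq_inv hz, one_pow]
    have e : r * ((Real.sqrt (1 - ‖a n‖ ^ 2) : ℝ) : ℂ) * ((((Real.sqrt (1 - ‖a n‖ ^ 2) : ℝ) : ℂ))⁻¹ *
        (z * φ - conj (a n) * (z ^ n * conj φ))) =
        z * (r * φ) - conj (a n) * (z ^ n * (r * conj φ)) := by
      field_simp
    rw [e, ih, ih']
    linear_combination (-(conj (a n) * (p + q))) * hzn + conj (a n) * (p + q) * hzn1

/-- The polynomials of the first and second kind measure the size of the transfer matrices. -/
lemma log_orthoPoly_eq (ha : ∀ n, ‖a n‖ ≤ 1 / 4) (hz : ‖z‖ = 1) (n : ℕ) :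
    Real.log (‖(orthoPoly a n).eval z‖ ^ 2 + ‖(secondKindPoly a n).eval z‖ ^ 2) =
      logSize (fun k => z ^ (k + 1) * a k) n := by
  have ha1 : ∀ n, ‖a n‖ < 1 := fun n => (ha n).trans_lt (by norm_num)
  have h1 := congrArg (fun w : ℂ => ‖w‖ ^ 2) (prod_sqrt_mul_eval_orthoPoly ha1 hz n)
  have h2 := congrArg (fun w : ℂ => ‖w‖ ^ 2) (prod_sqrt_mul_eval_orthoPoly (a := fun k => -a k)
    (fun n => by rw [norm_neg]; exact ha1 n) hz n)
  have e : (fun k => z ^ (k + 1) * -a k) = fun k => -(z ^ (k + 1) * a k) := by ext; ring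
  rw [e, xy_neg] at h2
  simp only [norm_mul, norm_pow, hz, one_pow, one_mul, RCLike.norm_conj, Complex.norm_real,
    norm_neg, mul_pow] at h1 h2
  have hpos : ∀ k, 0 < 1 - ‖a k‖ ^ 2 := fun k => by nlinarith [ha1 k, norm_nonneg (a k)]
  have hprod : ‖∏ k ∈ Finset.range n, Real.sqrt (1 - ‖a k‖ ^ 2)‖ ^ 2 =
      ∏ k ∈ Finset.range n, (1 - ‖a k‖ ^ 2) := by
    rw [Real.norm_eq_abs, sq_abs, ← Finset.prod_pow]
    exact Finset.prod_congr rfl fun k _ => Real.sq_sqrt (hpos k).le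
  rw [hprod] at h1 h2
  have hb : ∀ k, ‖z ^ (k + 1) * a k‖ = ‖a k‖ := fun k => by
    rw [norm_mul, norm_pow, hz, one_pow, one_mul]
  have hsize := sizeSq_pos (b := fun k => z ^ (k + 1) * a k) (fun k => by rw [hb]; exact ha k) n
  set b := fun k => z ^ (k + 1) * a k with hbd
  -- Up to the normalization `φ` and `ψ` have the moduli of the sum and the difference of the two
  -- entries.
  have hpar := parallelogram_law_with_norm ℝ (xy b n).1 (xy b n).2
  have hR : 0 < ∏ k ∈ Finset.range n, (1 - ‖a k‖ ^ 2) := Finset.prod_pos fun k _ => hpos k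
  have hsum : ‖(orthoPoly a n).eval z‖ ^ 2 + ‖(secondKindPoly a n).eval z‖ ^ 2 =
      2 * sizeSq b n / ∏ k ∈ Finset.range n, (1 - ‖a k‖ ^ 2) := by
    rw [eq_div_iff hR.ne', secondKindPoly, sizeSq]
    rw [← sub_eq_add_neg] at h2
    linarith
  rw [hsum, Real.log_div (by positivity) hR.ne', Real.log_prod fun k _ => (hpos k).ne', logSize]
  simp only [hbd, hb]

end OrthogonalPolynomials

/-! ### The two-sided correlation series -/

section Correlations

open ComplexConjugate Szego

variable {A : Matrix (Fin 2) (Fin 2) ℤ} {H : HypSys Torus2} {d : H.Data} {η : ℝ}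

lemma correlation_natCast (hP : H.P = torusProb) (hT : H.T = toralMap A) (n : ℕ) :
    correlation A d.α n = d.corr n := by
  rw [correlation, if_pos (Int.natCast_nonneg n), torusMean_eq, HypSys.Data.corr, hP, hT]
  simp [sampled]

lemma correlation_neg_natCast (hP : H.P = torusProb) (hT : H.T = toralMap A) (n : ℕ) :
    correlation A d.α (-(n + 1 : ℕ)) = conj (d.corr (n + 1)) := by
  rw [correlation, if_neg (by omega), torusMean_eq, HypSys.Data.corr, hP, hT, ← integral_conj]
  simp only [neg_neg, Int.toNat_natCast, sampled, map_mul, Complex.conj_conj]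
  congr 1
  ext p
  rw [mul_comm]; rfl

lemma spectralTerm_natCast (hP : H.P = torusProb) (hT : H.T = toralMap A)
    (hz : d.z = Complex.exp (Complex.I * η)) (n : ℕ) :
    spectralTerm A d.α η n = d.z ^ n * d.corr n := by
  rw [spectralTerm, correlation_natCast hP hT, hz, ← Complex.exp_nat_mul]
  congr 2
  push_cast; ring

lemma spectralTerm_neg_natCast (hP : H.P = torusProb) (hT : H.T = toralMap A)
    (hz : d.z = Complex.exp (Complex.I * η)) (n : ℕ) :
    spectralTerm A d.α η (-(n + 1 : ℕ)) = conj (d.z ^ (n + 1) * d.corr (n + 1)) := by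
  rw [spectralTerm, correlation_neg_natCast hP hT, map_mul, hz, ← Complex.exp_nat_mul,
    ← Complex.exp_conj]
  congr 2
  simp only [map_mul, Complex.conj_I, Complex.conj_ofReal, map_natCast]
  push_cast; ring

/-- Terms with negative index are conjugates of those with positive index, so the sum is real and
equals `J`; convergence is the exponential decay of correlations. -/
lemma hasSum_spectralTerm (hP : H.P = torusProb) (hT : H.T = toralMap A)
    (hz : d.z = Complex.exp (Complex.I * η)) : HasSum (spectralTerm A d.α η) (d.J : ℂ) := by
  obtain ⟨C, r, hC, hr0, hr1, hcorr⟩ := HypSys.Data.exists_corr_le d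
  have hb : ∀ n, ‖d.z ^ (n + 1) * d.corr (n + 1)‖ ≤ C * r ^ (n + 1) := fun n => by
    rw [norm_mul, HypSys.Data.norm_z_pow, one_mul]; exact hcorr _
  have hgeo : Summable fun n : ℕ => C * r ^ (n + 1) :=
    (summable_nat_add_iff 1).2 ((summable_geometric_of_lt_one hr0.le hr1).mul_left C)
  have hs : Summable fun n => d.z ^ (n + 1) * d.corr (n + 1) := Summable.of_norm_bounded hgeo hb
  set S := ∑' n, d.z ^ (n + 1) * d.corr (n + 1) with hS
  have h1 : HasSum (fun n : ℕ => spectralTerm A d.α η n) (d.corr 0 + S) := by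
    simp only [spectralTerm_natCast hP hT hz]
    have := (hasSum_nat_add_iff (f := fun n : ℕ => d.z ^ n * d.corr n) 1).1 hs.hasSum
    simpa [add_comm] using this
  have h2 : HasSum (fun n : ℕ => spectralTerm A d.α η (-(n + 1))) (conj S) := by
    have e : (fun n : ℕ => spectralTerm A d.α η (-(n + 1))) =
        fun n : ℕ => conj (d.z ^ (n + 1) * d.corr (n + 1)) := by
      ext n
      rw [← spectralTerm_neg_natCast hP hT hz n]; push_cast; rfl
    rw [e]
    exact hs.hasSum.map (starRingEnd ℂ) Complex.continuous_conj
  have h3 := HasSum.of_nat_of_neg_add_one h1 h2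
  have hc0 : d.corr 0 = ((d.corr 0).re : ℂ) := by
    refine (Complex.conj_eq_iff_re.1 ?_).symm
    rw [HypSys.Data.corr, ← integral_conj]
    congr 1; ext x
    simp [mul_comm]
  have hJ : (d.J : ℂ) = d.corr 0 + S + conj S := by
    rw [add_assoc, Complex.add_conj, HypSys.Data.J]
    have e0 : d.corrRe 0 = (d.corr 0).re := by simp [HypSys.Data.corrRe]
    have e1 : ∑' n, d.corrRe (n + 1) = S.re := by
      rw [hS, Complex.re_tsum hs]; rfl
    rw [e0, e1, Complex.ofReal_add, ← hc0]
  rw [hJ]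
  exact h3

end Correlations

/-! ### Passing to Lebesgue measure and conclusion -/

/-- The system and sampling data attached to a hyperbolic toral automorphism. -/
theorem exists_data {A : Matrix (Fin 2) (Fin 2) ℤ} (hA : IsHyperbolicToral A) {α : Torus2 → ℂ}
    (hα : IsC1OnTorus α) (hdisc : ∀ p, ‖α p‖ < 1) (hmean : torusMean α = 0) {z : ℂ}
    (hz : ‖z‖ = 1) : ∃ (H : HypSys Torus2) (d : H.Data), H.P = torusProb ∧ H.T = toralMap A ∧
      d.α = α ∧ d.z = z := by
  obtain ⟨H, hP, hT, ⟨e, hU⟩, ⟨e', hS⟩⟩ := exists_hypSys hA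
  obtain ⟨C, hC, hlip⟩ := exists_lipschitz hα
  have hK : C * ‖e‖ ≤ max 1 (max (C * ‖e‖) (C * ‖e'‖)) := (le_max_left _ _).trans (le_max_right _ _)
  have hK' : C * ‖e'‖ ≤ max 1 (max (C * ‖e‖) (C * ‖e'‖)) := (le_max_right _ _).trans (le_max_right _ _)
  refine ⟨H, {
    α := α
    z := z
    K := max 1 (max (C * ‖e‖) (C * ‖e'‖))
    one_le_K := le_max_left _ _
    obs := ⟨continuous_of_isC1 hα, fun p => (hdisc p).le.trans (le_max_left _ _), fun b p => by
      rw [hS]; exact (hlip e' b p).trans (mul_le_mul_of_nonneg_right hK' (abs_nonneg b)),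
      C * ‖e‖, by positivity, fun s p => by rw [hU]; exact hlip e s p⟩
    ulip := fun s p => by
      rw [hU]; exact (hlip e s p).trans (mul_le_mul_of_nonneg_right hK (abs_nonneg s))
    bound := fun p => (hdisc p).le
    mean := by rw [hP, ← torusMean_eq, hmean]
    hz := hz }, hP, hT, rfl, rfl⟩

lemma volume_eq_mul_torusProb (s : Set Torus2) :
    volume s = ENNReal.ofReal (4 * Real.pi ^ 2 * torusProb.real s) := by
  have h0 : volume (Set.univ : Set Torus2) ≠ 0 := by
    rw [volume_univ_torus, Ne, ENNReal.ofReal_eq_zero, not_le]; positivity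
  rw [ENNReal.ofReal_mul (by positivity), ofReal_measureReal, ← volume_univ_torus, torusProb,
    Measure.smul_apply, smul_eq_mul, ← mul_assoc, ENNReal.mul_inv_cancel h0 (measure_ne_top _ _),
    one_mul]

lemma ae_volume_of_ae_torusProb {q : Torus2 → Prop} (h : ∀ᵐ p ∂torusProb, q p) : ∀ᵐ p, q p := by
  rw [ae_iff] at h ⊢
  rw [volume_eq_mul_torusProb, Measure.real, h]
  simp

lemma ExpSmall.volume_lt {s : ℕ → Set Torus2} (h : ExpSmall torusProb s) :
    ∃ c : ℝ, 0 < c ∧ ∃ N₀ : ℕ, ∀ N : ℕ, N₀ ≤ N →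
      volume (s N) < ENNReal.ofReal (Real.exp (-(c * N))) := by
  obtain ⟨c, hc, N₁, hN₁⟩ := h
  obtain ⟨N₂, hN₂⟩ := eventually_atTop.1 (eventually_mul_exp_le (4 * Real.pi ^ 2) hc)
  -- The first halving of the rate absorbs the total mass `4π²`; the second makes the inequality
  -- strict, which needs `N ≥ 1`.
  refine ⟨c / 4, by positivity, max (max N₁ N₂) 1, fun N hN => ?_⟩
  have h1 := hN₁ N (by omega)
  have h2 := hN₂ N (by omega)
  have hN0 : (0:ℝ) < N := by exact_mod_cast (show 0 < N by omega)
  rw [volume_eq_mul_torusProb]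
  refine (ENNReal.ofReal_lt_ofReal_iff (Real.exp_pos _)).2 ?_
  calc 4 * Real.pi ^ 2 * torusProb.real (s N) ≤ 4 * Real.pi ^ 2 * Real.exp (-(c * N)) := by gcongr
    _ ≤ Real.exp (-(c / 2 * N)) := h2
    _ < Real.exp (-(c / 4 * N)) := Real.exp_lt_exp.2 (by nlinarith)

lemma finiteLyapunov_eq {A : Matrix (Fin 2) (Fin 2) ℤ} {H : HypSys Torus2} (d : H.Data)
    (hT : H.T = toralMap A) {lam : ℝ} (h0 : 0 < lam) (h1 : lam ≤ 1 / 4) (N : ℕ) (p : Torus2) :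
    finiteLyapunov A d.α lam d.z N p = Szego.logSize (d.b lam p) N / N / 2 := by
  have ha : ∀ n, ‖verblunsky A d.α lam p n‖ ≤ 1 / 4 := fun n => by
    rw [verblunsky, norm_mul, Complex.norm_real, Real.norm_of_nonneg h0.le]
    exact (mul_le_of_le_one_right h0.le (d.bound _)).trans h1
  have e : (fun k => d.z ^ (k + 1) * verblunsky A d.α lam p k) = d.b lam p := by
    ext k
    rw [verblunsky, sampled, HypSys.Data.b, hT]; ring
  rw [finiteLyapunov, log_orthoPoly_eq ha d.hz, e, one_div, mul_inv, div_div, mul_comm (N : ℝ) 2,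
    div_eq_inv_mul, mul_inv]

theorem mainTheorem1
    (A : Matrix (Fin 2) (Fin 2) ℤ) (hA : IsHyperbolicToral A)
    (α : Torus2 → ℂ) (hα : IsC1OnTorus α) (hdisc : ∀ p, ‖α p‖ < 1) (hmean : torusMean α = 0)
    (z : ℂ) (η : ℝ) (hz : z = Complex.exp (Complex.I * (η : ℂ))) (hz1 : z ≠ 1) (hz2 : z ≠ -1) :
    Summable (spectralTerm A α η) ∧
    ∃ lam₀ : ℝ, 0 < lam₀ ∧ lam₀ < 1 ∧
      (∃ C : ℝ, 0 < C ∧ ∀ lam : ℝ, 0 < lam → lam < lam₀ →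
        ∃ L : ℝ, IsLyapunovExponent A α lam z L ∧
          ‖(L : ℂ) - (lam : ℂ) ^ 2 / 2 * spectralJ A α η‖ ≤ C * lam ^ 3) ∧
      (∀ lam : ℝ, 0 < lam → lam < lam₀ →
        ∃ c : ℝ, 0 < c ∧ ∃ N₀ : ℕ, ∀ N : ℕ, N₀ ≤ N →
          volume {p : Torus2 |
            lam ^ 3 <
              ‖(finiteLyapunov A α lam z N p : ℂ) - (lam : ℂ) ^ 2 / 2 * spectralJ A α η‖} <
            ENNReal.ofReal (Real.exp (-(c * N)))) := by
  have hz3 : ‖z‖ = 1 := by rw [hz, mul_comm]; exact Complex.norm_exp_ofReal_mul_I η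
  obtain ⟨H, d, hP, hT, hdα, hdz⟩ := exists_data hA hα hdisc hmean hz3
  have hsum := hasSum_spectralTerm hP hT (hdz.trans hz)
  rw [hdα] at hsum
  have hz1' : d.z ≠ 1 := by rw [hdz]; exact hz1
  have hz2' : d.z ^ 2 ≠ 1 := by
    rw [hdz]; exact fun h => (sq_eq_one_iff.1 h).elim hz1 hz2
  obtain ⟨lam₀, p0, p1, hmain⟩ := HypSys.Data.exists_lyapunov d hz1' hz2'
  have hfin : ∀ lam : ℝ, 0 < lam → lam < min lam₀ (1 / 4) → ∀ N p,
      finiteLyapunov A α lam z N p = Szego.logSize (d.b lam p) N / N / 2 := by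
    intro lam h0 hl N p
    rw [← hdα, ← hdz]
    exact finiteLyapunov_eq d hT h0 (hl.trans_le (min_le_right _ _)).le N p
  have hdiff : ∀ (lam : ℝ) (L : ℝ), ‖((L / 2 : ℝ) : ℂ) - (lam : ℂ) ^ 2 / 2 * spectralJ A α η‖ =
      |L - lam ^ 2 * d.J| / 2 := by
    intro lam L
    rw [spectralJ, hsum.tsum_eq]
    have e : ((L / 2 : ℝ) : ℂ) - (lam : ℂ) ^ 2 / 2 * d.J = (((L - lam ^ 2 * d.J) / 2 : ℝ) : ℂ) := by
      push_cast; ring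
    rw [e, Complex.norm_real, Real.norm_eq_abs, abs_div, abs_two]
  -- The factor `1/(2N)` in `L_N` halves the error `2 lam³` of `exists_lyapunov`, hence `C = 1` and
  -- the threshold `lam³`.
  refine ⟨hsum.summable, min lam₀ (1 / 4), lt_min p0 (by norm_num), (min_le_left _ _).trans_lt p1,
    ⟨1, one_pos, fun lam h0 hl => ?_⟩, fun lam h0 hl => ?_⟩
  · obtain ⟨⟨L, hL, hL'⟩, -⟩ := hmain lam h0 (hl.trans_le (min_le_left _ _))
    refine ⟨L / 2, ?_, ?_⟩
    · rw [hP] at hL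
      filter_upwards [ae_volume_of_ae_torusProb hL] with p hp
      simp only [hfin lam h0 hl]
      exact hp.div_const 2
    · rw [hdiff]; linarith
  · obtain ⟨-, hs⟩ := hmain lam h0 (hl.trans_le (min_le_left _ _))
    rw [hP] at hs
    refine (hs.mono ?_).volume_lt
    filter_upwards [eventually_ge_atTop 1] with N hN p hp
    have hN0 : (0:ℝ) < N := by exact_mod_cast hN
    simp only [Set.mem_ofPred_eq] at hp ⊢
    rw [hfin lam h0 hl, hdiff, lt_div_iff₀ two_pos] at hp
    have e : Szego.logSize (d.b lam p) N / N - lam ^ 2 * d.J =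
        (Szego.logSize (d.b lam p) N - N * (lam ^ 2 * d.J)) / N := by field_simp
    rw [e, abs_div, abs_of_pos hN0, lt_div_iff₀ hN0] at hp
    linarith
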